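/- Let $G$ be an oriented modular graph: a (possibly infinite) connected undirected graph in which every three vertices $x_1,x_2,x_3$ have a median, i.e. a vertex $y$ with $d(x_i,x_j)=d(x_i,y)+d(y,x_j)$ for all $i<j$ ($d=d_G$ the shortest path metric), together with an orientation of its edges that is admissible: for every 4-cycle $(x_1,x_2,x_3,x_4)$ one has $x_1\to x_2$ if and only if $x_4\to x_3$. Order the vertices by $v\preceq u$ iff there is a directed path from $u$ to $v$, and give $G\times G$ the product order. A modular semilattice is a meet-semilattice $L$ in which every principal ideal is a modular lattice and in which $x\vee y\vee z$ exists whenever $x\vee y$, $y\vee z$, $z\vee x$ exist; it is assumed to have a minimum element and a rank function $r:L\to\mathbb Z_+$, $r(p)$ being the (finite) length of a maximal chain from the minimum to $p$. For $p,q\in L$ let $I(p,q)$ be the set of all existing joins $a\vee b$ with $p\wedge q\preceq a\preceq p$ and $p\wedge q\preceq b\preceq q$; for $u\in I(p,q)$ put $r(u;p,q)=(r(u\wedge p)-r(p\wedge q),\,r(u\wedge q)-r(p\wedge q))\in\mathbb R_+^2$; let $\operatorname{Conv} I(p,q)$ be the convex hull of these vectors, $E(p,q)$ the set of $u\in I(p,q)$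 such that $r(u;p,q)$ is a (componentwise) maximal extreme point of $\operatorname{Conv} I(p,q)$, and, for $u\in E(p,q)$, $C(u;p,q)=\{c\in\mathbb R_+^2:\langle c,r(u;p,q)\rangle=\max_{x\in \operatorname{Conv} I(p,q)}\langle c,x\rangle\}$. For a closed convex cone $\{0\}\ne C\subseteq\mathbb R^2_+$ consisting of the vectors whose angle with the first axis lies in $[\beta,\alpha]$, $0\le\beta\le\alpha\le\pi/2$, put $[C]=\frac{\sin\alpha}{\sin\alpha+\cos\alpha}-\frac{\sin\beta}{\sin\beta+\cos\beta}$. A function $f:L\to\mathbb R\cup\{\infty\}$ is submodular if $E(p,q)$ is finite and $$f(p)+f(q)\ \ge\ f(p\wedge q)+\sum_{u\in E(p,q)}[C(u;p,q)]\,f(u)\qquad(p,q\in L).$$ For a poset $P$ and $g:P\to\mathbb R\cup\{\infty\}$, call $g$ "locally submodular and chain-connected" if every principal filter of $P$, and every principal ideal of $P$ with reversed order, is a modular semilattice on which $g$ is submodular, and any two elements of $\operatorname{dom} g=\{x:g(x)<\infty\}$ are joined by a finite sequence in $\operatorname{dom} g$ of consecutively comparable elements. Let $P^*$ be the set of intervals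 $[p,q]$ $(p\preceq q)$ of $P$ that are complemented modular lattices, ordered by inclusion, and $g^*([p,q])=(g(p)+g(q))/2$. Theorem. For every oriented modular graph $G$, the relation $\preceq$ is a partial order and the distance function $d:G\times G\to\mathbb R$ is L-convex on $G\times G$, in both of the following senses: (1) $d$ is locally submodular and chain-connected on the poset $G\times G$ (the definition of L-convexity when every interval is complemented); (2) $d^*$ is locally submodular and chain-connected on $(G\times G)^*$ (the definition of L-convexity on a general oriented modular graph). -/

import Mathlib

noncomputable section

/-! ### Modular semilattices -/

/-- The preorder `P` is (the order of) a modular lattice. -/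
def IsModularLatticeOrder (P : Type*) [inst : Preorder P] : Prop :=
  ∃ i : Lattice P, i.toSemilatticeInf.toPartialOrder.toPreorder = inst ∧
    @IsModularLattice P i

/-- The preorder `P` is (the order of) a complemented modular lattice. -/
def IsComplementedModularLatticeOrder (P : Type*) [inst : Preorder P] : Prop :=
  ∃ (i : Lattice P) (b : @BoundedOrder P i.toSemilatticeInf.toPartialOrder.toLE),
    i.toSemilatticeInf.toPartialOrder.toPreorder = inst ∧
    @IsModularLattice P i ∧ @ComplementedLattice P i b

/-- A modular semilattice: a meet-semilattice in which every principal ideal is a modular lattice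
and three elements have a join as soon as they have pairwise joins. The field `finite_rank` says
that there is a minimum element and a `ℕ`-valued rank function (chains below any given
element have bounded length), which the definition of submodularity presupposes. -/
structure IsModularSemilattice (L : Type*) [SemilatticeInf L] : Prop where
  nonempty : Nonempty L
  finite_rank : ∀ p : L, Order.height p ≠ ⊤
  ideal_modular : ∀ x : L, IsModularLatticeOrder (Set.Iic x)
  triple_join : ∀ x y z : L, (∃ u, IsLUB {x, y} u) → (∃ u, IsLUB {y, z} u) →
    (∃ u, IsLUB {z, x} u) → ∃ u, IsLUB {x, y, z} u

/-! ### Fractional joins and submodular functions -/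

namespace FractionalJoin

/-- The value `[C]` of a cone `C` in the nonnegative quadrant: if `β ≤ α` are the extreme angles
of `C` in `[0, π/2]`, then `[C] = sin α / (sin α + cos α) - sin β / (sin β + cos β)`. -/
def coneValue (C : Set (ℝ × ℝ)) : ℝ :=
  let A : Set ℝ := {θ | θ ∈ Set.Icc 0 (Real.pi / 2) ∧ (Real.cos θ, Real.sin θ) ∈ C}
  let α := sSup A
  let β := sInf A
  Real.sin α / (Real.sin α + Real.cos α) - Real.sin β / (Real.sin β + Real.cos β)

/-- `coneValue` on a cone presented by its two extreme angles. -/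
theorem coneValue_eq {α β : ℝ} (hβ : 0 ≤ β) (hβα : β ≤ α) (hα : α ≤ Real.pi / 2) :
    coneValue {c : ℝ × ℝ | 0 ≤ c.1 ∧ 0 ≤ c.2 ∧ c.2 * Real.cos α ≤ c.1 * Real.sin α ∧
        c.1 * Real.sin β ≤ c.2 * Real.cos β} =
      Real.sin α / (Real.sin α + Real.cos α) - Real.sin β / (Real.sin β + Real.cos β) := by
  have hpi := Real.pi_pos
  have hA : {θ : ℝ | θ ∈ Set.Icc 0 (Real.pi / 2) ∧ (Real.cos θ, Real.sin θ) ∈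
      {c : ℝ × ℝ | 0 ≤ c.1 ∧ 0 ≤ c.2 ∧ c.2 * Real.cos α ≤ c.1 * Real.sin α ∧
        c.1 * Real.sin β ≤ c.2 * Real.cos β}} = Set.Icc β α := by
    ext θ
    simp only [Set.mem_ofPred_eq, Set.mem_Icc]
    constructor
    · rintro ⟨⟨h0, h1⟩, -, -, h2, h3⟩
      constructor
      · by_contra h
        have := Real.sin_pos_of_pos_of_lt_pi (x := β - θ) (by linarith) (by linarith)
        rw [Real.sin_sub] at this
        linarith
      · by_contra h
        have := Real.sin_pos_of_pos_of_lt_pi (x := θ - α) (by linarith) (by linarith)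
        rw [Real.sin_sub] at this
        linarith
    · rintro ⟨h0, h1⟩
      have h2 := Real.sin_nonneg_of_nonneg_of_le_pi (x := α - θ) (by linarith) (by linarith)
      have h3 := Real.sin_nonneg_of_nonneg_of_le_pi (x := θ - β) (by linarith) (by linarith)
      rw [Real.sin_sub] at h2 h3
      exact ⟨⟨by linarith, by linarith⟩,
        Real.cos_nonneg_of_neg_pi_div_two_le_of_le (by linarith) (by linarith),
        Real.sin_nonneg_of_nonneg_of_le_pi (by linarith) (by linarith),
        by linarith, by linarith⟩
  unfold coneValue
  simp only [hA, csSup_Icc hβα, csInf_Icc hβα]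

variable {L : Type*} [SemilatticeInf L]

/-- The rank `r(p)`: the maximum length of a chain ending at `p`. -/
def rank (p : L) : ℕ := (Order.height p).toNat

/-- `I(p,q)`: the elements `a ∨ b` with `p ∧ q ≤ a ≤ p` and `p ∧ q ≤ b ≤ q`. -/
def joinSet (p q : L) : Set L :=
  {u | ∃ a b : L, a ∈ Set.Icc (p ⊓ q) p ∧ b ∈ Set.Icc (p ⊓ q) q ∧ IsLUB {a, b} u}

/-- The vector `r(u;p,q) = (r(u ∧ p) - r(p ∧ q), r(u ∧ q) - r(p ∧ q))`. -/
def rankVec (p q u : L) : ℝ × ℝ :=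
  ((rank (u ⊓ p) : ℝ) - rank (p ⊓ q), (rank (u ⊓ q) : ℝ) - rank (p ⊓ q))

/-- `Conv I(p,q)`. -/
def convSet (p q : L) : Set (ℝ × ℝ) := convexHull ℝ (rankVec p q '' joinSet p q)

/-- `E(p,q)`: the elements of `I(p,q)` mapped to maximal extreme points of `Conv I(p,q)`. -/
def support (p q : L) : Set L :=
  {u | u ∈ joinSet p q ∧ rankVec p q u ∈ (convSet p q).extremePoints ℝ ∧
    Maximal (· ∈ convSet p q) (rankVec p q u)}

/-- `C(u;p,q)`: the nonnegative normal cone of `Conv I(p,q)` at `r(u;p,q)`. -/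
def normalCone (p q u : L) : Set (ℝ × ℝ) :=
  {c | 0 ≤ c.1 ∧ 0 ≤ c.2 ∧ ∀ x ∈ convSet p q,
    c.1 * x.1 + c.2 * x.2 ≤ c.1 * (rankVec p q u).1 + c.2 * (rankVec p q u).2}

/-- `f(p) + f(q) ≥ f(p ∧ q) + ∑_{u ∈ E(p,q)} [C(u;p,q)] f(u)` for all `p, q`
(the sum being a finite sum). -/
def SubmodularInequality (f : L → WithTop ℝ) : Prop :=
  ∀ p q : L, (support p q).Finite ∧
    f (p ⊓ q) + ∑ᶠ u ∈ support p q, (coneValue (normalCone p q u) : WithTop ℝ) * f u ≤ f p + f q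

end FractionalJoin

/-- `f` is a submodular function on the modular semilattice `P`; being a modular semilattice is
part of the claim. -/
def IsSubmodular {P : Type*} [inst : Preorder P] (f : P → WithTop ℝ) : Prop :=
  ∃ i : SemilatticeInf P, i.toPartialOrder.toPreorder = inst ∧
    IsModularSemilattice P ∧ FractionalJoin.SubmodularInequality f

/-! ### L-convex functions -/

/-- Any two elements of `X` are joined by a sequence in `X` of consecutively comparable
elements. -/
def ChainConnected {P : Type*} [Preorder P] (X : Set P) : Prop :=
  ∀ p ∈ X, ∀ q ∈ X,
    Relation.ReflTransGen (fun a b => a ∈ X ∧ b ∈ X ∧ (a ≤ b ∨ b ≤ a)) p q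

/-- `g` is submodular on every principal filter and on every principal ideal (the latter with
the order reversed, so that the generating element is the minimum), and its domain is
chain-connected. -/
structure IsLConvex {P : Type*} [Preorder P] (g : P → WithTop ℝ) : Prop where
  filter : ∀ x : P, IsSubmodular (fun y : Set.Ici x => g y.1)
  ideal : ∀ x : P, IsSubmodular (fun y : (Set.Iic x)ᵒᵈ => g (OrderDual.ofDual y).1)
  chainConnected : ChainConnected {x : P | g x < ⊤}

/-- The set `P*` of all intervals `[p,q]`, `p ≤ q`, of `P` that are complemented modular lattices,
ordered by inclusion. -/
abbrev ComplementedInterval (P : Type*) [Preorder P] : Type _ :=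
  {s : NonemptyInterval P // IsComplementedModularLatticeOrder (Set.Icc s.fst s.snd)}

/-- The function `g*([p,q]) = (g(p) + g(q)) / 2` on `P*`. -/
def starExtension {P : Type*} [Preorder P] (g : P → WithTop ℝ)
    (s : ComplementedInterval P) : WithTop ℝ :=
  ((1 / 2 : ℝ) : WithTop ℝ) * (g s.1.fst + g s.1.snd)

/-! ### Oriented modular graphs -/

/-- `m` lies on shortest paths between each two of `x, y, z`. -/
def SimpleGraph.IsMedian {V : Type*} (G : SimpleGraph V) (x y z m : V) : Prop :=
  G.dist x y = G.dist x m + G.dist m y ∧ G.dist y z = G.dist y m + G.dist m z ∧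
    G.dist x z = G.dist x m + G.dist m z

/-- An oriented modular graph: a connected graph in which every triple of vertices has a median,
with an admissible orientation of its edges. -/
structure OrientedModularGraph (V : Type*) where
  graph : SimpleGraph V
  connected : graph.Connected
  exists_median : ∀ x y z : V, ∃ m, graph.IsMedian x y z m
  /-- `arrow u v`: the edge `uv` is oriented as `u → v`. -/
  arrow : V → V → Prop
  adj_iff : ∀ u v, graph.Adj u v ↔ arrow u v ∨ arrow v u
  arrow_asymm : ∀ u v, arrow u v → ¬ arrow v u
  admissible : ∀ x₁ x₂ x₃ x₄ : V, graph.Adj x₁ x₂ → graph.Adj x₂ x₃ → graph.Adj x₃ x₄ →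
    graph.Adj x₄ x₁ → x₁ ≠ x₃ → x₂ ≠ x₄ → (arrow x₁ x₂ ↔ arrow x₄ x₃)

namespace OrientedModularGraph

variable {V : Type*}

/-- The vertices of `Γ`, as a type that carries the order defined by the orientation. -/
def Vertex (_Γ : OrientedModularGraph V) : Type _ := V

/-- `v ≤ u` if there is a directed path from `u` to `v`. -/
instance (Γ : OrientedModularGraph V) : Preorder Γ.Vertex where
  le v u := Relation.ReflTransGen Γ.arrow u v
  le_refl _ := Relation.ReflTransGen.refl
  le_trans _ _ _ h₁ h₂ := h₂.trans h₁

/-- The shortest path metric as a function on `Γ × Γ`. -/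
def distFun (Γ : OrientedModularGraph V) (p : Γ.Vertex × Γ.Vertex) : WithTop ℝ :=
  ((Γ.graph.dist p.1 p.2 : ℝ) : WithTop ℝ)

end OrientedModularGraph

end

/-! The value `[C]` of a cone is the length of the set of `t ∈ [0, 1]` with `(1 - t, t) ∈ C`. For
irrational `t` the weight `(1 - t) r₁ + t r₂` separates integer vectors. Since maximizing pairs `(a,
b)` can be uncrossed, exactly one pair attains the maximum, and its join `u_t` lies in `E(p, q)`.
The sum over `E(p, q)` is therefore `∫ f(u_t) dt` over `[0, 1]`, and submodularity becomes `f(p ∧ q)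
+ ∫ f(u_t) dt ≤ f(p) + f(q)` (`integral_eq_sum_support`, `isSubmodular_filter`).

For a distance function on a product, meets and fractional joins are componentwise. The inequality
then says that passing from a pair `(p, q)` to its meet and its fractional joins does not increase
the total distance between two pairs. Inside one principal filter it suffices to lower `p` to a
lower cover `p'`. If `p'` is above the meet, the fractional joins move monotonically in both
coordinates, and the mean movement is at most 1 because the mean distance from `p` to `u_t` is the
rank of `q` above the meet, whatever `p` is (`integral_d_left`). Otherwise the fractional joins stay
put and the meet drops by at most 1 (`contracts_cover`). For pairs in two different filters, a
geodesic is routed through gates: two legs stay inside a filter, and the middle leg is an isometric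
order isomorphism that moves every point equally far (`contracts_gate`, `contracts_of_filters`).

Only the axioms of `ModularMetricPoset` are used. Vertices satisfy them because directed paths are
geodesics and the sets of ancestors and of descendants are convex. The axioms pass to duals, which
handles ideals, and to complemented intervals `[p, q]` with distance `d(p, p') + d(q, q')`
(`instStar`). Since `(G × G)* ≅ G* × G*`, and `d*` is half of the distance of `G*`, both claims are
instances of `isLConvex_d`. -/

/-! ### Posets with a modular metric -/

/-- A poset with an integer metric whose covering graph is a modular graph with an admissible
orientation: medians exist, the metric is additive along the order, and principal filters and
ideals are metrically convex. -/
class ModularMetricPoset (α : Type*) [PartialOrder α] where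
  d : α → α → ℕ
  d_comm : ∀ x y, d x y = d y x
  d_triangle : ∀ x y z, d x z ≤ d x y + d y z
  d_eq_zero : ∀ x y, d x y = 0 ↔ x = y
  exists_step : ∀ x y, x ≠ y → ∃ z, d x z = 1 ∧ d x y = 1 + d z y ∧ (x ≤ z ∨ z ≤ x)
  exists_median : ∀ x y z, ∃ m, d x y = d x m + d m y ∧ d y z = d y m + d m z ∧
    d x z = d x m + d m z
  d_add : ∀ x y z, x ≤ y → y ≤ z → d x z = d x y + d y z
  filter_convex : ∀ o x y z, o ≤ x → o ≤ y → d x y = d x z + d z y → o ≤ z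
  ideal_convex : ∀ o x y z, x ≤ o → y ≤ o → d x y = d x z + d z y → z ≤ o

namespace ModularMetricPoset

open OrderDual

instance instDual {α : Type*} [PartialOrder α] [ModularMetricPoset α] : ModularMetricPoset αᵒᵈ where
  d x y := d (ofDual x) (ofDual y)
  d_comm x y := d_comm (ofDual x) (ofDual y)
  d_triangle x y z := d_triangle (ofDual x) (ofDual y) (ofDual z)
  d_eq_zero x y := d_eq_zero (ofDual x) (ofDual y)
  exists_step x y h := by
    obtain ⟨z, h1, h2, h3⟩ := exists_step (ofDual x) (ofDual y) h
    exact ⟨toDual z, h1, h2, h3.symm⟩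
  exists_median x y z := exists_median (ofDual x) (ofDual y) (ofDual z)
  d_add x y z h1 h2 := by
    have := d_add (ofDual z) (ofDual y) (ofDual x) h2 h1
    rw [d_comm (ofDual x) (ofDual z), d_comm (ofDual x) (ofDual y), this,
      d_comm (ofDual z) (ofDual y), add_comm]
  filter_convex o x y z h1 h2 h := ideal_convex (ofDual o) (ofDual x) (ofDual y) (ofDual z) h1 h2 h
  ideal_convex o x y z h1 h2 h := filter_convex (ofDual o) (ofDual x) (ofDual y) (ofDual z) h1 h2 h

theorem d_toDual {α : Type*} [PartialOrder α] [ModularMetricPoset α] (x y : α) :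
    d (toDual x) (toDual y) = d x y := rfl

instance instProd {α β : Type*} [PartialOrder α] [PartialOrder β] [ModularMetricPoset α]
    [ModularMetricPoset β] : ModularMetricPoset (α × β) where
  d x y := d x.1 y.1 + d x.2 y.2
  d_comm x y := by rw [d_comm x.1, d_comm x.2]
  d_triangle x y z := by
    have h1 := d_triangle x.1 y.1 z.1
    have h2 := d_triangle x.2 y.2 z.2
    omega
  d_eq_zero x y := by
    rw [Nat.add_eq_zero_iff, d_eq_zero, d_eq_zero, Prod.ext_iff]
  exists_step x y h := by
    by_cases h1 : x.1 = y.1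
    · have h2 : x.2 ≠ y.2 := fun h2 => h (Prod.ext h1 h2)
      obtain ⟨z, hz1, hz2, hz3⟩ := exists_step _ _ h2
      have h0 := (d_eq_zero x.1 x.1).2 rfl
      refine ⟨(x.1, z), by simp [h0, hz1], by simp only; omega, ?_⟩
      rcases hz3 with h | h
      · exact Or.inl ⟨le_rfl, h⟩
      · exact Or.inr ⟨le_rfl, h⟩
    · obtain ⟨z, hz1, hz2, hz3⟩ := exists_step _ _ h1
      have h0 := (d_eq_zero x.2 x.2).2 rfl
      refine ⟨(z, x.2), by simp [h0, hz1], by simp only; omega, ?_⟩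
      rcases hz3 with h | h
      · exact Or.inl ⟨h, le_rfl⟩
      · exact Or.inr ⟨h, le_rfl⟩
  exists_median x y z := by
    obtain ⟨m, h1, h2, h3⟩ := exists_median x.1 y.1 z.1
    obtain ⟨n, k1, k2, k3⟩ := exists_median x.2 y.2 z.2
    exact ⟨(m, n), by simp only; omega, by simp only; omega, by simp only; omega⟩
  d_add x y z h1 h2 := by
    have := d_add _ _ _ h1.1 h2.1
    have := d_add _ _ _ h1.2 h2.2
    omega
  filter_convex o x y z h1 h2 h := by
    have t1 := d_triangle x.1 z.1 y.1
    have t2 := d_triangle x.2 z.2 y.2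
    exact ⟨filter_convex _ _ _ _ h1.1 h2.1 (by omega), filter_convex _ _ _ _ h1.2 h2.2 (by omega)⟩
  ideal_convex o x y z h1 h2 h := by
    have t1 := d_triangle x.1 z.1 y.1
    have t2 := d_triangle x.2 z.2 y.2
    exact ⟨ideal_convex _ _ _ _ h1.1 h2.1 (by omega), ideal_convex _ _ _ _ h1.2 h2.2 (by omega)⟩

theorem d_prod {α β : Type*} [PartialOrder α] [PartialOrder β] [ModularMetricPoset α]
    [ModularMetricPoset β] (x y : α × β) : d x y = d x.1 y.1 + d x.2 y.2 := rfl

/-- Pulling back the metric along an order isomorphism. -/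
abbrev ofOrderIso {α β : Type*} [PartialOrder α] [PartialOrder β] [ModularMetricPoset β]
    (e : α ≃o β) : ModularMetricPoset α where
  d x y := d (e x) (e y)
  d_comm x y := d_comm _ _
  d_triangle x y z := d_triangle _ _ _
  d_eq_zero x y := by rw [d_eq_zero, e.injective.eq_iff]
  exists_step x y h := by
    obtain ⟨z, h1, h2, h3⟩ := exists_step (e x) (e y) (fun h' => h (e.injective h'))
    refine ⟨e.symm z, by simpa using h1, by simpa using h2, ?_⟩
    rcases h3 with h3 | h3
    · exact Or.inl ((OrderIso.le_symm_apply e).2 h3)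
    · exact Or.inr ((OrderIso.symm_apply_le e).2 h3)
  exists_median x y z := by
    obtain ⟨m, h⟩ := exists_median (e x) (e y) (e z)
    exact ⟨e.symm m, by simpa using h⟩
  d_add x y z h1 h2 := d_add _ _ _ (e.monotone h1) (e.monotone h2)
  filter_convex o x y z h1 h2 h :=
    e.le_iff_le.1 (filter_convex _ _ _ _ (e.monotone h1) (e.monotone h2) h)
  ideal_convex o x y z h1 h2 h :=
    e.le_iff_le.1 (ideal_convex _ _ _ _ (e.monotone h1) (e.monotone h2) h)

/-- `m` is the meet of `x` and `y`. -/
def IsMeet {α : Type*} [PartialOrder α] (x y m : α) : Prop :=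
  m ≤ x ∧ m ≤ y ∧ ∀ z, z ≤ x → z ≤ y → z ≤ m

/-- `m` is the join of `x` and `y`. -/
def IsJoin {α : Type*} [PartialOrder α] (x y m : α) : Prop :=
  x ≤ m ∧ y ≤ m ∧ ∀ z, x ≤ z → y ≤ z → m ≤ z

theorem IsMeet.symm {α : Type*} [PartialOrder α] {x y m : α} (h : IsMeet x y m) : IsMeet y x m :=
  ⟨h.2.1, h.1, fun z h1 h2 => h.2.2 z h2 h1⟩

theorem IsJoin.symm {α : Type*} [PartialOrder α] {x y m : α} (h : IsJoin x y m) : IsJoin y x m :=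
  ⟨h.2.1, h.1, fun z h1 h2 => h.2.2 z h2 h1⟩

theorem IsMeet.unique {α : Type*} [PartialOrder α] {x y m n : α} (h : IsMeet x y m)
    (h' : IsMeet x y n) : m = n :=
  le_antisymm (h'.2.2 _ h.1 h.2.1) (h.2.2 _ h'.1 h'.2.1)

theorem IsJoin.unique {α : Type*} [PartialOrder α] {x y m n : α} (h : IsJoin x y m)
    (h' : IsJoin x y n) : m = n :=
  le_antisymm (h.2.2 _ h'.1 h'.2.1) (h'.2.2 _ h.1 h.2.1)

/-! ### Meets, joins, the rank valuation and parallel edges -/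

section Basic

variable {α : Type*} [PartialOrder α] [ModularMetricPoset α]

theorem d_self (x : α) : d x x = 0 := (d_eq_zero x x).2 rfl

theorem eq_of_d {x y : α} (h : d x y = 0) : x = y := (d_eq_zero x y).1 h

theorem comparable_of_d_eq_one {x y : α} (h : d x y = 1) : x ≤ y ∨ y ≤ x := by
  have hne : x ≠ y := fun e => by rw [e, d_self] at h; omega
  obtain ⟨z, h1, h2, h3⟩ := exists_step x y hne
  have : z = y := eq_of_d (by omega)
  rwa [this] at h3

theorem mem_Icc_of_between {x y z : α} (hxy : x ≤ y) (h : d x y = d x z + d z y) :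
    x ≤ z ∧ z ≤ y :=
  ⟨filter_convex _ _ _ _ le_rfl hxy h, ideal_convex _ _ _ _ hxy le_rfl h⟩

/-- The perimeter is twice the total distance to a median, so the underlying graph is bipartite. -/
theorem even_d (x y z : α) : Even (d x y + d y z + d x z) := by
  obtain ⟨m, h1, h2, h3⟩ := exists_median x y z
  rw [d_comm m y] at h1
  exact ⟨d x m + d y m + d m z, by omega⟩

/-- A median of `o, x, y` is the meet: it lies between `x` and `y`, so by filter convexity it is
above every common lower bound. -/
theorem exists_meet {o x y : α} (hx : o ≤ x) (hy : o ≤ y) :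
    ∃ m, IsMeet x y m ∧ d x y = d m x + d m y := by
  obtain ⟨m, h1, h2, h3⟩ := exists_median o x y
  obtain ⟨-, a2⟩ := mem_Icc_of_between hx h1
  obtain ⟨-, b2⟩ := mem_Icc_of_between hy h3
  refine ⟨m, ⟨a2, b2, fun z hz1 hz2 => filter_convex _ _ _ _ hz1 hz2 h2⟩, ?_⟩
  rw [d_comm m x, h2]

theorem IsMeet.d_eq {x y m : α} (h : IsMeet x y m) : d x y = d m x + d m y := by
  obtain ⟨n, hn, hd⟩ := exists_meet h.1 h.2.1
  rwa [h.unique hn]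

theorem exists_join {o x y : α} (hx : x ≤ o) (hy : y ≤ o) : ∃ m, IsJoin x y m := by
  obtain ⟨m, hm, -⟩ := exists_meet (α := αᵒᵈ) (o := toDual o) (x := toDual x) (y := toDual y) hx hy
  exact ⟨ofDual m, hm⟩

theorem IsJoin.d_eq {x y m : α} (h : IsJoin x y m) : d x y = d x m + d y m := by
  have := IsMeet.d_eq (α := αᵒᵈ) (x := toDual x) (y := toDual y) (m := toDual m) h
  simp only [d_toDual] at this
  rw [this, d_comm m x, d_comm m y]

theorem isMeet_of_between {x y m : α} (hx : m ≤ x) (hy : m ≤ y) (h : d x y = d m x + d m y) :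
    IsMeet x y m :=
  ⟨hx, hy, fun z h1 h2 => filter_convex z x y m h1 h2 (by rw [h, d_comm m x])⟩

/-- The distance between `x` and `y` can be measured through the meet or through the join; comparing
the two gives the modular rank identity. -/
theorem valuation {o x y m j : α} (ho : o ≤ m) (hm : IsMeet x y m) (hj : IsJoin x y j) :
    d o x + d o y = d o m + d o j := by
  have h1 := hm.d_eq
  have h2 := hj.d_eq
  have h3 := d_add _ _ _ ho hm.1
  have h4 := d_add _ _ _ ho hm.2.1
  have h5 := d_add _ _ _ (ho.trans hm.1) hj.1
  have h6 := d_add _ _ _ (ho.trans hm.2.1) hj.2.1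
  omega

theorem d_mono {o x y : α} (ho : o ≤ x) (h : x ≤ y) : d o x ≤ d o y := by
  have := d_add _ _ _ ho h
  omega

theorem eq_of_d_le {o x y : α} (ho : o ≤ x) (h : x ≤ y) (hd : d o y ≤ d o x) : x = y := by
  have := d_add _ _ _ ho h
  exact eq_of_d (by omega)

theorem eq_or_eq_of_cover {x y z : α} (h : d x y = 1) (h1 : x ≤ z) (h2 : z ≤ y) :
    z = x ∨ z = y := by
  have := d_add _ _ _ h1 h2
  rcases Nat.eq_zero_or_pos (d x z) with h0 | h0
  · exact Or.inl (eq_of_d h0).symm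
  · exact Or.inr (eq_of_d (by omega))

theorem exists_upper_step {x y : α} (h : x ≤ y) (hne : x ≠ y) : ∃ z, d x z = 1 ∧ x ≤ z ∧ z ≤ y := by
  obtain ⟨z, h1, h2, -⟩ := exists_step x y hne
  exact ⟨z, h1, mem_Icc_of_between h (by omega)⟩

theorem exists_lower_step {x y : α} (h : x ≤ y) (hne : x ≠ y) : ∃ z, d z y = 1 ∧ x ≤ z ∧ z ≤ y := by
  obtain ⟨z, h1, h2, -⟩ := exists_step y x hne.symm
  rw [d_comm] at h1
  rw [d_comm, d_comm z] at h2
  exact ⟨z, h1, mem_Icc_of_between h (by omega)⟩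

/-- Three elements that are pairwise bounded above are bounded above. -/
theorem exists_upper_bound {x y z a b c : α} (h1 : x ≤ a) (h2 : y ≤ a) (h3 : y ≤ b) (h4 : z ≤ b)
    (h5 : z ≤ c) (h6 : x ≤ c) : ∃ u, x ≤ u ∧ y ≤ u ∧ z ≤ u := by
  -- Each of `x, y, z` is below two of `a, b, c`, hence below anything between those two.
  obtain ⟨m, k1, k2, k3⟩ := exists_median a b c
  exact ⟨m, filter_convex _ _ _ _ h1 h6 k3, filter_convex _ _ _ _ h2 h3 k1,
    filter_convex _ _ _ _ h4 h5 k2⟩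

/-- If `m = p ∧ q`, `m ≤ a ≤ p` and `m ≤ b ≤ q`, then `(a ∨ b) ∧ p = a`. -/
theorem isMeet_join_left {p q m a b u : α} (hm : IsMeet p q m) (ha : m ≤ a) (hap : a ≤ p)
    (hb : m ≤ b) (hbq : b ≤ q) (hu : IsJoin a b u) : IsMeet u p a := by
  obtain ⟨c, hc, -⟩ := exists_meet hu.1 hap
  have hac : a ≤ c := hc.2.2 _ hu.1 hap
  have h1 : IsMeet c b m := ⟨ha.trans hac, hb, fun z h1 h2 => hm.2.2 _ (h1.trans hc.2.1) (h2.trans hbq)⟩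
  have h2 : IsJoin c b u := ⟨hc.1, hu.2.1, fun z h1 h2 => hu.2.2 _ (hac.trans h1) h2⟩
  have h3 : IsMeet a b m := ⟨ha, hb, fun z h1 h2 => hm.2.2 _ (h1.trans hap) (h2.trans hbq)⟩
  -- Replacing `a` by `c` changes neither the meet with `b` nor the join, so the ranks agree.
  have v1 := valuation le_rfl h1 h2
  have v2 := valuation le_rfl h3 hu
  have : a = c := eq_of_d_le ha hac (by omega)
  rwa [this]

theorem isMeet_join_right {p q m a b u : α} (hm : IsMeet p q m) (ha : m ≤ a) (hap : a ≤ p)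
    (hb : m ≤ b) (hbq : b ≤ q) (hu : IsJoin a b u) : IsMeet u q b :=
  isMeet_join_left hm.symm hb hbq ha hap hu.symm

/-- Opposite edges of a square have the same direction. -/
theorem square {x y x' y' : α} (h1 : d x y = 1) (h2 : d y y' = 1) (h3 : d x x' = 1)
    (h4 : d x' y' = 1) (h5 : d x y' = 2) (h6 : d y x' = 2) (hxy : x ≤ y) : x' ≤ y' := by
  rcases comparable_of_d_eq_one h4 with h | h
  · exact h
  rcases comparable_of_d_eq_one h3 with hx | hx
  · have := filter_convex x y x' y' hxy hx (by rw [h6, h2, d_comm, h4])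
    have := d_add _ _ _ this h
    rw [d_comm y'] at this
    omega
  · have := d_add _ _ _ (h.trans hx) hxy
    rw [d_comm y' x, d_comm y' y] at this
    omega

/-- Edges that are parallel at any distance have the same direction. -/
theorem parallel_le (k : ℕ) : ∀ x y x' y' : α, d x y = 1 → d x' y' = 1 → d x x' = k →
    d y y' = k → d x y' = k + 1 → d y x' = k + 1 → x ≤ y → x' ≤ y' := by
  induction k with
  | zero =>
    intro x y x' y' h1 h2 h3 h4 h5 h6 h
    rwa [← eq_of_d h3, ← eq_of_d h4]
  | succ k ih =>
    intro x y x' y' h1 h2 h3 h4 h5 h6 h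
    have hne : x ≠ x' := fun e => by rw [e, d_self] at h3; omega
    obtain ⟨x₁, a1, a2, -⟩ := exists_step x x' hne
    -- The median completes a square on `x, y, x₁`, which carries the direction one step along the
    -- geodesic from `x` to `x'`.
    obtain ⟨y₁, b1, b2, b3⟩ := exists_median y x₁ y'
    have t1 := d_triangle x₁ x' y'
    have t2 := d_triangle x x₁ y'
    have t3 := d_triangle y x₁ x'
    have t4 := d_triangle y x x₁
    rw [d_comm y x, h1] at t4
    have e1 : d x₁ y' = k + 1 := by omega
    have e2 : d y x₁ = 2 := by omega
    have c1 : d y y₁ = 1 := by rw [d_comm y₁ x₁] at b1; omega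
    have c2 : d x₁ y₁ = 1 := by rw [d_comm y₁ x₁] at b1; omega
    have t5 := d_triangle y y₁ x'
    have t6 := d_triangle y₁ x₁ x'
    rw [d_comm y₁ x₁] at t6
    have t7 := d_triangle x y₁ y'
    have t8 := d_triangle x x₁ y₁
    have s := square h1 c1 a1 c2 (by omega) e2 h
    exact ih x₁ y₁ x' y' c2 h2 (by omega) (by omega) (by omega) (by omega) s

end Basic

/-! ### Gates of convex sets -/

section Gate

variable {α : Type*} [PartialOrder α] [ModularMetricPoset α]

/-- `C` is metrically convex. -/
def IsConvexSet (C : Set α) : Prop :=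
  ∀ x ∈ C, ∀ y ∈ C, ∀ z, d x y = d x z + d z y → z ∈ C

/-- `π` maps every element to its gate in `C`. -/
def IsGateMap (C : Set α) (π : α → α) : Prop :=
  ∀ z, π z ∈ C ∧ ∀ w ∈ C, d z w = d z (π z) + d (π z) w

theorem isConvexSet_Ici (o : α) : IsConvexSet (Set.Ici o) :=
  fun _ hx _ hy _ h => filter_convex _ _ _ _ hx hy h

theorem isConvexSet_Icc (a b : α) : IsConvexSet (Set.Icc a b) :=
  fun _ hx _ hy _ h => ⟨filter_convex _ _ _ _ hx.1 hy.1 h, ideal_convex _ _ _ _ hx.2 hy.2 h⟩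

/-- A nearest point `g` is a gate: the median of `z, g, w` lies in `C` by convexity and is no
farther from `z`, so it equals `g`. -/
theorem IsConvexSet.exists_gateMap {C : Set α} (hC : IsConvexSet C) (hne : C.Nonempty) :
    ∃ π, IsGateMap C π := by
  have : ∀ z, ∃ g, g ∈ C ∧ ∀ w ∈ C, d z w = d z g + d g w := by
    intro z
    let f : C → ℕ := fun w => d z w
    have : Nonempty C := hne.to_subtype
    let g := Function.argmin f
    refine ⟨g, g.2, fun w hw => ?_⟩
    obtain ⟨m, h1, h2, h3⟩ := exists_median z g w
    have hm : m ∈ C := hC _ g.2 _ hw _ h2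
    have hle : d z g ≤ d z m := Function.argmin_le f ⟨m, hm⟩
    have : m = g := eq_of_d (by omega)
    rwa [this] at h3
  choose π hπ using this
  exact ⟨π, hπ⟩

theorem IsGateMap.eq_self {C : Set α} {π : α → α} (h : IsGateMap C π) {z : α} (hz : z ∈ C) :
    π z = z := by
  have := (h z).2 z hz
  rw [d_self] at this
  exact (eq_of_d (by omega)).symm

theorem IsGateMap.eq_of_between {C : Set α} {π : α → α} (h : IsGateMap C π) {z w : α}
    (hw : d z (π z) = d z w + d w (π z)) : π w = π z := by
  have h1 := (h z).2 _ (h w).1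
  have h2 := (h w).2 _ (h z).1
  have h3 := d_triangle z w (π w)
  exact eq_of_d (by omega)

theorem IsGateMap.d_le {C : Set α} {π : α → α} (h : IsGateMap C π) (x y : α) :
    d (π x) (π y) ≤ d x y := by
  have h1 := (h x).2 _ (h y).1
  have h2 := (h y).2 _ (h x).1
  have h3 := d_triangle x y (π y)
  have h4 := d_triangle y x (π x)
  rw [d_comm (π y) (π x)] at h2
  rw [d_comm y x] at h4
  omega

/-- A gate map either collapses an edge or sends it to a parallel edge, which has the same
direction. -/
theorem IsGateMap.monotone {C : Set α} {π : α → α} (h : IsGateMap C π) : Monotone π := by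
  have cover : ∀ x y, d x y = 1 → x ≤ y → π x ≤ π y := by
    intro x y hd hxy
    have h1 := (h x).2 _ (h y).1
    have h2 := (h y).2 _ (h x).1
    have h3 := d_triangle x y (π y)
    have h4 := d_triangle y x (π x)
    have h5 := h.d_le x y
    rw [d_comm (π y) (π x)] at h2
    rw [d_comm y x] at h4
    rcases Nat.eq_zero_or_pos (d (π x) (π y)) with h0 | h0
    · rw [eq_of_d h0]
    · exact parallel_le (d x (π x)) x y (π x) (π y) hd (by omega) rfl (by omega) (by omega)
        (by omega) hxy
  suffices ∀ n, ∀ x y, d x y = n → x ≤ y → π x ≤ π y from fun x y hxy => this _ x y rfl hxy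
  intro n
  induction n with
  | zero =>
    intro x y h0 _
    rw [eq_of_d h0]
  | succ n ih =>
    intro x y hd hxy
    have hne : x ≠ y := fun e => by rw [e, d_self] at hd; omega
    obtain ⟨z, h1, h2, h3⟩ := exists_upper_step hxy hne
    have := d_add _ _ _ h2 h3
    exact (cover x z h1 h2).trans (ih z y (by omega) h3)

section Pair

variable {C D : Set α} {π σ : α → α}

theorem gate_gate_gate (hπ : IsGateMap C π) (hσ : IsGateMap D σ) {z : α} (hz : z ∈ D) :
    π (σ (π z)) = π z := by
  have h1 := (hσ (π z)).2 z hz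
  refine hπ.eq_of_between ?_
  rw [d_comm z, h1, d_comm z, d_comm _ (π z), add_comm]

/-- On the fixed points of `π ∘ σ` both `σ` and its inverse `π` give gate equalities; adding them
shows that `σ` is isometric and displaces all points equally. -/
theorem d_gate_eq (hπ : IsGateMap C π) (hσ : IsGateMap D σ) {x y : α} (hx : π (σ x) = x)
    (hy : π (σ y) = y) : d x (σ x) = d y (σ y) ∧ d (σ x) (σ y) = d x y := by
  have hxC : x ∈ C := hx ▸ (hπ (σ x)).1
  have hyC : y ∈ C := hy ▸ (hπ (σ y)).1
  have h1 := (hσ x).2 _ (hσ y).1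
  have h2 := (hσ y).2 _ (hσ x).1
  have h3 := (hπ (σ x)).2 _ hyC
  have h4 := (hπ (σ y)).2 _ hxC
  rw [hx] at h3
  rw [hy] at h4
  rw [d_comm (σ x) y, d_comm (σ x) x] at h3
  rw [d_comm (σ y) x, d_comm (σ y) y, d_comm y x] at h4
  rw [d_comm (σ y) (σ x)] at h2
  omega

/-- The point `π (σ z)` lies between `z` and every fixed point. Applied to `x` and `y`, with `z`
between them, this leaves no room for `π (σ z) ≠ z`. -/
theorem gate_gate_convex (hC : IsConvexSet C) (hπ : IsGateMap C π) (hσ : IsGateMap D σ)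
    {x y z : α} (hx : π (σ x) = x) (hy : π (σ y) = y) (hz : d x y = d x z + d z y) :
    π (σ z) = z := by
  have hxC : x ∈ C := hx ▸ (hπ (σ x)).1
  have hyC : y ∈ C := hy ▸ (hπ (σ y)).1
  have hzC := hC x hxC y hyC z hz
  have key : ∀ c, π (σ c) = c → d z c = d z (π (σ z)) + d (π (σ z)) c := by
    intro c hc
    have hcC : c ∈ C := hc ▸ (hπ (σ c)).1
    have h0 := gate_gate_gate hσ hπ hzC
    have e1 := d_gate_eq hπ hσ (x := π (σ z)) (y := c) (by rw [h0]) hc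
    rw [h0] at e1
    have h1 := (hσ z).2 _ (hσ c).1
    have h2 := (hπ (σ c)).2 _ hzC
    have h3 := (hπ (σ z)).2 _ hzC
    rw [hc, d_comm (σ c) z, d_comm (σ c) c, d_comm c z] at h2
    rw [d_comm (σ z) z, d_comm (σ z), d_comm _ z] at h3
    omega
  have k1 := key x hx
  have k2 := key y hy
  have t := d_triangle x (π (σ z)) y
  rw [d_comm z x, d_comm _ x] at k1
  exact (eq_of_d (by omega)).symm

end Pair

end Gate

/-- `(a, b)` is a pair with `m ≤ a ≤ p`, `m ≤ b ≤ q` that has a join. -/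
def Joinable {α : Type*} [PartialOrder α] (m p q a b : α) : Prop :=
  (m ≤ a ∧ a ≤ p) ∧ (m ≤ b ∧ b ≤ q) ∧ ∃ u, a ≤ u ∧ b ≤ u

theorem Joinable.mono {α : Type*} [PartialOrder α] {m p q a b a' b' : α} (h : Joinable m p q a b) (ha : m ≤ a') (ha' : a' ≤ a)
    (hb : m ≤ b') (hb' : b' ≤ b) : Joinable m p q a' b' := by
  obtain ⟨⟨h1, h2⟩, ⟨h3, h4⟩, u, h5, h6⟩ := h
  exact ⟨⟨ha, ha'.trans h2⟩, ⟨hb, hb'.trans h4⟩, u, ha'.trans h5, hb'.trans h6⟩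

theorem Joinable.symm {α : Type*} [PartialOrder α] {m p q a b : α} (h : Joinable m p q a b) : Joinable m q p b a := by
  obtain ⟨h1, h2, u, h5, h6⟩ := h
  exact ⟨h2, h1, u, h6, h5⟩

theorem joinable_left {α : Type*} [PartialOrder α] {m p q : α} (hm : IsMeet p q m) : Joinable m p q p m :=
  ⟨⟨hm.1, le_rfl⟩, ⟨le_rfl, hm.2.1⟩, p, le_rfl, hm.1⟩

theorem irrational_combo {t : ℝ} (ht : Irrational t) {i j k l : ℕ}
    (h : (1 - t) * i + t * j = (1 - t) * k + t * l) : i = k ∧ j = l := by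
  by_cases h0 : ((j : ℤ) - l - (i - k)) = 0
  · have h1 : ((j : ℝ) - l - (i - k)) = 0 := by exact_mod_cast h0
    have h2 : (i : ℝ) = k := by linear_combination h - t * h1
    have h3 : (j : ℝ) = l := by linear_combination h + (1 - t) * h1
    exact ⟨by exact_mod_cast h2, by exact_mod_cast h3⟩
  · exfalso
    have h1 : t * (((j : ℤ) - l - (i - k) : ℤ) : ℝ) = (((k : ℤ) - i : ℤ) : ℝ) := by
      push_cast
      linear_combination h
    exact (ht.mul_intCast h0).ne_int _ h1

/-! ### Fractional joins at irrational parameters -/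

section FracJoin

variable {α : Type*} [PartialOrder α] [ModularMetricPoset α]

/-- The objective function whose maximizers are the fractional joins. -/
def objective (t : ℝ) (m a b : α) : ℝ := (1 - t) * d m a + t * d m b

/-- `(a, b)` maximizes the objective function among the joinable pairs. -/
def IsMaximizer (t : ℝ) (m p q a b : α) : Prop :=
  Joinable m p q a b ∧ ∀ a' b', Joinable m p q a' b' → objective t m a' b' ≤ objective t m a b

/-- `u = a ∨ b` for a pair `(a, b)` that maximizes the objective function. -/
def IsFracJoin (t : ℝ) (p q u : α) : Prop :=
  ∃ m a b, IsMeet p q m ∧ IsMaximizer t m p q a b ∧ IsJoin a b u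

/-- The elements `a, a', b` are pairwise bounded above (`a, a'` by `p`), hence jointly bounded. -/
theorem Joinable.sup {m p q a a' b c : α} (h : Joinable m p q a b) (h' : Joinable m p q a' b)
    (hc : IsJoin a a' c) : Joinable m p q c b := by
  obtain ⟨⟨h1, h2⟩, ⟨h3, h4⟩, u, h5, h6⟩ := h
  obtain ⟨⟨k1, k2⟩, -, v, k5, k6⟩ := h'
  obtain ⟨w, w1, w2, w3⟩ := exists_upper_bound h2 k2 k5 k6 h6 h5
  exact ⟨⟨h1.trans hc.1, hc.2.2 _ h2 k2⟩, ⟨h3, h4⟩, w, hc.2.2 _ w1 w2, w3⟩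

theorem Joinable.sup_inf {m p q a a' b b' c e : α} (h : Joinable m p q a b)
    (h' : Joinable m p q a' b') (hc : IsJoin a a' c) (he : IsMeet b b' e) :
    Joinable m p q c e := by
  have hm : m ≤ e := he.2.2 _ h.2.1.1 h'.2.1.1
  exact (h.mono h.1.1 le_rfl hm he.1).sup (h'.mono h'.1.1 le_rfl hm he.2.1) hc

theorem Joinable.inf_sup {m p q a a' b b' c e : α} (h : Joinable m p q a b)
    (h' : Joinable m p q a' b') (hc : IsMeet a a' c) (he : IsJoin b b' e) :
    Joinable m p q c e :=
  (h.symm.sup_inf h'.symm he hc).symm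

theorem IsMaximizer.symm {t : ℝ} {m p q a b : α} (h : IsMaximizer t m p q a b) :
    IsMaximizer (1 - t) m q p b a := by
  refine ⟨h.1.symm, fun a' b' h' => ?_⟩
  have := h.2 b' a' h'.symm
  simp only [objective] at this ⊢
  linarith

theorem IsFracJoin.symm {t : ℝ} {p q u : α} (h : IsFracJoin t p q u) :
    IsFracJoin (1 - t) q p u := by
  obtain ⟨m, a, b, h1, h2, h3⟩ := h
  exact ⟨m, b, a, h1.symm, h2.symm, h3.symm⟩

/-- Uncrossing: `(a ∨ a', b ∧ b')` competes with `(a, b)` and `(a ∧ a', b ∨ b')` with `(a', b')`.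
The objective is modular, so both are optimal, and irrationality of `t` forces equality of ranks.
Lowering `p` thus lowers the first coordinate and raises the second. -/
theorem IsMaximizer.compare {t : ℝ} (ht : Irrational t) {m p p' q a b a' b' : α} (hp : p' ≤ p)
    (h : IsMaximizer t m p q a b) (h' : IsMaximizer t m p' q a' b') : a' ≤ a ∧ b ≤ b' := by
  obtain ⟨hj, hmax⟩ := h
  obtain ⟨hj', hmax'⟩ := h'
  have hj'' : Joinable m p q a' b' := ⟨⟨hj'.1.1, hj'.1.2.trans hp⟩, hj'.2⟩
  obtain ⟨c, hc⟩ := exists_join hj.1.2 hj''.1.2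
  obtain ⟨f, hf, -⟩ := exists_meet hj.1.1 hj'.1.1
  obtain ⟨e, he, -⟩ := exists_meet hj.2.1.1 hj'.2.1.1
  obtain ⟨g, hg⟩ := exists_join hj.2.1.2 hj'.2.1.2
  have k1 := hmax c e (hj.sup_inf hj'' hc he)
  have j2 := hj.inf_sup hj'' hf hg
  have k2 := hmax' f g ⟨⟨j2.1.1, hf.2.1.trans hj'.1.2⟩, j2.2⟩
  have v1 : (d m a : ℝ) + d m a' = d m f + d m c := by
    exact_mod_cast valuation j2.1.1 hf hc
  have v2 : (d m b : ℝ) + d m b' = d m e + d m g := by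
    exact_mod_cast valuation (he.2.2 _ hj.2.1.1 hj'.2.1.1) he hg
  simp only [objective] at k1 k2
  have e1 : (1 - t) * d m c + t * d m e = (1 - t) * d m a + t * d m b := by
    refine le_antisymm k1 ?_
    have : (1 - t) * (d m a + d m a' : ℝ) + t * (d m b + d m b') =
        (1 - t) * (d m f + d m c) + t * (d m e + d m g) := by rw [v1, v2]
    linarith
  obtain ⟨e2, e3⟩ := irrational_combo ht e1
  have ha : a = c := eq_of_d_le hj.1.1 hc.1 e2.le
  have hb : e = b := eq_of_d_le (he.2.2 _ hj.2.1.1 hj'.2.1.1) he.1 e3.ge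
  exact ⟨ha ▸ hc.2.1, hb ▸ he.2.1⟩

theorem IsMaximizer.unique {t : ℝ} (ht : Irrational t) {m p q a b a' b' : α}
    (h : IsMaximizer t m p q a b) (h' : IsMaximizer t m p q a' b') : a = a' ∧ b = b' := by
  have h1 := h.compare ht le_rfl h'
  have h2 := h'.compare ht le_rfl h
  exact ⟨le_antisymm h2.1 h1.1, le_antisymm h1.2 h2.2⟩

theorem IsFracJoin.unique {t : ℝ} (ht : Irrational t) {p q u u' : α}
    (h : IsFracJoin t p q u) (h' : IsFracJoin t p q u') : u = u' := by
  obtain ⟨m, a, b, h1, h2, h3⟩ := h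
  obtain ⟨m', a', b', k1, k2, k3⟩ := h'
  obtain rfl := h1.unique k1
  obtain ⟨rfl, rfl⟩ := h2.unique ht k2
  exact h3.unique k3

/-- The rank vectors of the joinable pairs. -/
def rankPairs (m p q : α) : Set (ℕ × ℕ) :=
  {v | ∃ a b, Joinable m p q a b ∧ v = (d m a, d m b)}

theorem rankPairs_finite (m p q : α) : (rankPairs m p q).Finite := by
  refine (Set.finite_Iic ((d m p, d m q) : ℕ × ℕ)).subset ?_
  rintro _ ⟨a, b, h, rfl⟩
  exact ⟨d_mono h.1.1 h.1.2, d_mono h.2.1.1 h.2.1.2⟩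

theorem exists_isMaximizer (t : ℝ) {m p q : α} (hm : IsMeet p q m) :
    ∃ a b, IsMaximizer t m p q a b := by
  obtain ⟨v, ⟨a, b, hab, rfl⟩, hmax⟩ := Set.exists_max_image (rankPairs m p q)
    (fun v => (1 - t) * v.1 + t * v.2) (rankPairs_finite m p q) ⟨_, _, _, joinable_left hm, rfl⟩
  exact ⟨a, b, hab, fun a' b' h' => hmax _ ⟨a', b', h', rfl⟩⟩

theorem exists_isFracJoin (t : ℝ) {m p q : α} (hm : IsMeet p q m) : ∃ u, IsFracJoin t p q u := by
  obtain ⟨a, b, h⟩ := exists_isMaximizer t hm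
  obtain ⟨o, h1, h2⟩ := h.1.2.2
  obtain ⟨u, hu⟩ := exists_join h1 h2
  exact ⟨u, m, a, b, hm, h, hu⟩

/-- `U` selects the fractional joins of `p` and `q` at all irrational parameters. -/
def IsSelection (p q : α) (U : ℝ → α) : Prop :=
  ∀ t ∈ Set.Ioo (0 : ℝ) 1, Irrational t → IsFracJoin t p q (U t)

theorem measurableSet_irrational : MeasurableSet {t : ℝ | Irrational t} :=
  (Set.countable_range _).measurableSet.compl

theorem ae_irrational : ∀ᵐ t : ℝ, Irrational t :=
  (Set.countable_range ((↑) : ℚ → ℝ)).ae_notMem _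

/-- The pair `(a, b)` is recovered from `u` as `(u ∧ p, u ∧ q)`, so the condition on `t` is a family
of weak affine inequalities. -/
theorem isClosed_isFracJoin (p q u : α) : IsClosed {t : ℝ | IsFracJoin t p q u} := by
  by_cases h : ∃ t, IsFracJoin t p q u
  · obtain ⟨t₀, m, a, b, hm, hab, hu⟩ := h
    have : {t : ℝ | IsFracJoin t p q u} = ⋂ (a' : α) (b' : α) (_ : Joinable m p q a' b'),
        {t | objective t m a' b' ≤ objective t m a b} := by
      ext t
      simp only [Set.mem_iInter]
      constructor
      · rintro ⟨m', a₁, b₁, hm', hab', hu'⟩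
        obtain rfl := hm.unique hm'
        have h1 := (isMeet_join_left hm hab.1.1.1 hab.1.1.2 hab.1.2.1.1 hab.1.2.1.2 hu).unique
          (isMeet_join_left hm hab'.1.1.1 hab'.1.1.2 hab'.1.2.1.1 hab'.1.2.1.2 hu')
        have h2 := (isMeet_join_right hm hab.1.1.1 hab.1.1.2 hab.1.2.1.1 hab.1.2.1.2 hu).unique
          (isMeet_join_right hm hab'.1.1.1 hab'.1.1.2 hab'.1.2.1.1 hab'.1.2.1.2 hu')
        subst h1 h2
        exact hab'.2
      · intro h
        exact ⟨m, a, b, hm, ⟨hab.1, h⟩, hu⟩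
    rw [this]
    refine isClosed_iInter fun a' => isClosed_iInter fun b' => isClosed_iInter fun _ => ?_
    simp only [objective]
    exact isClosed_le (by fun_prop) (by fun_prop)
  · push Not at h
    simp [h]

/-- The fractional joins can be selected by a simple function of the parameter. -/
theorem exists_selection {m p q : α} (hm : IsMeet p q m) :
    ∃ U : MeasureTheory.SimpleFunc ℝ α, IsSelection p q U := by
  classical
  choose F hF using fun t => exists_isFracJoin t hm
  let I : Set ℝ := Set.Ioo 0 1 ∩ {t | Irrational t}
  have hI : MeasurableSet I := measurableSet_Ioo.inter measurableSet_irrational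
  -- The value `p` outside `I` is arbitrary: inside the unit interval it is used only on a null set.
  let U : ℝ → α := fun t => if t ∈ I then F t else p
  have hUI : ∀ t ∈ I, U t = F t := fun t ht => if_pos ht
  refine ⟨⟨U, ?_, ?_⟩, fun t h1 h2 => ?_⟩
  · intro u
    have : U ⁻¹' {u} = (I ∩ {t | IsFracJoin t p q u}) ∪ (Iᶜ ∩ {_t | p = u}) := by
      ext t
      by_cases ht : t ∈ I
      · have : F t = u ↔ IsFracJoin t p q u :=
          ⟨fun h => h ▸ hF t, fun h => (hF t).unique ht.2 h⟩
        simp [ht, hUI t ht, this]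
      · have : U t = p := if_neg ht
        simp [ht, this]
    rw [this]
    exact (hI.inter (isClosed_isFracJoin p q u).measurableSet).union
      (hI.compl.inter (MeasurableSet.const _))
  · have hfin : (F '' I).Finite := by
      have hF' := hF
      choose M a b hM hmax hjoin using hF'
      have hMm : ∀ t, M t = m := fun t => (hM t).unique hm
      -- Selected joins are separated by their rank vectors: with equal vectors, both pairs are
      -- optimal at the same irrational parameter.
      refine Set.Finite.of_injOn (f := fun u : α => if h : ∃ t ∈ I, F t = u then
        (d m (a h.choose), d m (b h.choose)) else (0, 0)) (t := rankPairs m p q) ?_ ?_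
        (rankPairs_finite m p q)
      · rintro u ⟨t, ht, htu⟩
        have h : ∃ t ∈ I, F t = u := ⟨t, ht, htu⟩
        simp only [h, dif_pos]
        have := (hmax h.choose).1
        rw [hMm] at this
        exact ⟨_, _, this, rfl⟩
      · rintro u hu v hv huv
        have h : ∃ t ∈ I, F t = u := hu
        have k : ∃ t ∈ I, F t = v := hv
        simp only [h, k, dif_pos, Prod.mk.injEq] at huv
        obtain ⟨h1, h2⟩ := h.choose_spec
        obtain ⟨k1, k2⟩ := k.choose_spec
        rw [← h2, ← k2]
        refine IsFracJoin.unique k1.2 ⟨m, _, _, hm, ?_, hjoin _⟩ (hF _)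
        have e1 := hmax h.choose
        have e2 := hmax k.choose
        rw [hMm] at e1 e2
        refine ⟨e1.1, fun a' b' h' => (e2.2 a' b' h').trans ?_⟩
        rw [objective, objective, huv.1, huv.2]
    refine (hfin.union (Set.finite_singleton p)).subset ?_
    rintro _ ⟨t, rfl⟩
    by_cases ht : t ∈ I
    · exact Or.inl ⟨t, ht, (hUI t ht).symm⟩
    · exact Or.inr (if_neg ht)
  · have ht : t ∈ I := ⟨h1, h2⟩
    change IsFracJoin t p q (U t)
    rw [hUI t ht]
    exact hF t

end FracJoin

open MeasureTheory

/-! ### The mean distance to the fractional joins -/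

section Integral

variable {α : Type*} [PartialOrder α] [ModularMetricPoset α]

theorem intervalIntegrable_of_simpleFunc (F : SimpleFunc ℝ ℝ) (a b : ℝ) :
    IntervalIntegrable F volume a b :=
  ⟨F.integrable_of_isFiniteMeasure, F.integrable_of_isFiniteMeasure⟩

theorem d_join_left {p q m a b u : α} (hm : IsMeet p q m) (h : Joinable m p q a b)
    (hu : IsJoin a b u) : (d p u : ℝ) = d m p - d m a + d m b := by
  have h1 := isMeet_join_left hm h.1.1 h.1.2 h.2.1.1 h.2.1.2 hu
  have h2 := h1.d_eq
  have h3 : IsMeet a b m :=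
    ⟨h.1.1, h.2.1.1, fun z k1 k2 => hm.2.2 _ (k1.trans h.1.2) (k2.trans h.2.1.2)⟩
  have h4 := valuation le_rfl h3 hu
  have h5 := d_add _ _ _ h.1.1 hu.1
  have h6 := d_add _ _ _ h.1.1 h.1.2
  rw [d_self] at h4
  rw [d_comm p u]
  have h7 : d u p + d m a = d m p + d m b := by omega
  have h8 : (d u p : ℝ) + d m a = d m p + d m b := by exact_mod_cast h7
  linarith

/-- The maximum of the objective function. -/
noncomputable def maxObjective (m p q : α) (t : ℝ) : ℝ :=
  ⨆ v : rankPairs m p q, ((1 - t) * (v.1.1 : ℝ) + t * v.1.2)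

theorem IsMaximizer.objective_eq {t : ℝ} {m p q a b : α} (h : IsMaximizer t m p q a b) :
    maxObjective m p q t = objective t m a b := by
  have : Nonempty (rankPairs m p q) := ⟨⟨_, a, b, h.1, rfl⟩⟩
  refine le_antisymm (ciSup_le ?_) ?_
  · rintro ⟨_, a', b', h', rfl⟩
    exact h.2 a' b' h'
  · have hb : BddAbove (Set.range fun v : rankPairs m p q => ((1 - t) * (v.1.1 : ℝ) + t * v.1.2)) := by
      refine ⟨objective t m a b, ?_⟩
      rintro _ ⟨⟨_, a', b', h', rfl⟩, rfl⟩
      exact h.2 a' b' h'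
    exact le_ciSup hb ⟨_, a, b, h.1, rfl⟩

theorem maxObjective_zero {m p q : α} (hm : IsMeet p q m) : maxObjective m p q 0 = d m p := by
  have : IsMaximizer 0 m p q p m := by
    refine ⟨joinable_left hm, fun a b h => ?_⟩
    have : (d m a : ℝ) ≤ d m p := by exact_mod_cast d_mono h.1.1 h.1.2
    simpa [objective] using this
  rw [this.objective_eq]
  simp [objective]

theorem maxObjective_one {m p q : α} (hm : IsMeet p q m) : maxObjective m p q 1 = d m q := by
  have : IsMaximizer 1 m p q m q := by
    refine ⟨(joinable_left hm.symm).symm, fun a b h => ?_⟩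
    have : (d m b : ℝ) ≤ d m q := by exact_mod_cast d_mono h.2.1.1 h.2.1.2
    simpa [objective] using this
  rw [this.objective_eq]
  simp [objective]

theorem continuous_maxObjective {m p q : α} (hm : IsMeet p q m) :
    Continuous (maxObjective m p q) := by
  have hne : (rankPairs_finite m p q).toFinset.Nonempty :=
    ⟨_, (rankPairs_finite m p q).mem_toFinset.2 ⟨_, _, joinable_left hm, rfl⟩⟩
  have : maxObjective m p q = fun t => (rankPairs_finite m p q).toFinset.sup' hne
      (fun v => (1 - t) * (v.1 : ℝ) + t * v.2) := by
    ext t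
    obtain ⟨a, b, h⟩ := exists_isMaximizer t hm
    rw [h.objective_eq]
    refine le_antisymm ?_ (Finset.sup'_le _ _ ?_)
    · exact Finset.le_sup' (f := fun v : ℕ × ℕ => (1 - t) * (v.1 : ℝ) + t * v.2)
        ((rankPairs_finite m p q).mem_toFinset.2 ⟨a, b, h.1, rfl⟩)
    · intro v hv
      obtain ⟨a', b', h', rfl⟩ := (rankPairs_finite m p q).mem_toFinset.1 hv
      exact h.2 a' b' h'
  rw [this]
  exact Continuous.finset_sup'_apply hne fun v _ => by fun_prop

/-- At an irrational parameter only one rank vector is optimal and there are finitely many others,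
so near `t` the maximum is the single affine function given by that vector. -/
theorem hasDerivAt_maxObjective {t : ℝ} (ht : Irrational t) {m p q a b : α}
    (h : IsMaximizer t m p q a b) :
    HasDerivAt (maxObjective m p q) ((d m b : ℝ) - d m a) t := by
  have h1 : HasDerivAt (fun s : ℝ => objective s m a b) ((d m b : ℝ) - d m a) t := by
    have e : (fun s : ℝ => objective s m a b) = fun s => (d m a : ℝ) + s * ((d m b : ℝ) - d m a) := by
      ext s
      simp only [objective]
      ring
    rw [e]
    simpa using ((hasDerivAt_id t).mul_const ((d m b : ℝ) - d m a)).const_add (d m a : ℝ)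
  refine h1.congr_of_eventuallyEq ?_
  have h2 : ∀ v ∈ rankPairs m p q, ∀ᶠ s in nhds t,
      (1 - s) * (v.1 : ℝ) + s * v.2 ≤ objective s m a b := by
    rintro _ ⟨a', b', h', rfl⟩
    by_cases hab : d m a' = d m a ∧ d m b' = d m b
    · refine Filter.Eventually.of_forall fun s => ?_
      simp [objective, hab.1, hab.2]
    · have hlt : objective t m a' b' < objective t m a b :=
        lt_of_le_of_ne (h.2 a' b' h') fun e => hab (irrational_combo ht e)
      have c1 : Continuous fun s : ℝ => objective s m a' b' := by
        simp only [objective]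
        fun_prop
      have c2 : Continuous fun s : ℝ => objective s m a b := by
        simp only [objective]
        fun_prop
      filter_upwards [(isOpen_lt c1 c2).mem_nhds hlt] with s hs
      exact hs.le
  filter_upwards [(rankPairs_finite m p q).eventually_all.2 h2] with s hs
  exact IsMaximizer.objective_eq ⟨h.1, fun a' b' h' => hs _ ⟨a', b', h', rfl⟩⟩

/-- The mean distance from `p` to the fractional joins of `p` and `q` is `d (p ∧ q) q`. -/
theorem integral_d_left {p q m : α} (hm : IsMeet p q m) (U : SimpleFunc ℝ α)
    (hU : IsSelection p q U) : ∫ t in (0 : ℝ)..1, (d p (U t) : ℝ) = d m q := by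
  have hint : IntervalIntegrable (fun t => (d p (U t) : ℝ)) volume 0 1 :=
    intervalIntegrable_of_simpleFunc (U.map fun u => (d p u : ℝ)) 0 1
  -- The slope `d m b - d m a` equals `d p (U t) - d m p`, so the fundamental theorem of calculus
  -- evaluates the integral from the endpoint values `d m p` and `d m q`; the rationals are the
  -- countable exception.
  have key := integral_eq_of_hasDerivAt_off_countable_of_le (maxObjective m p q)
    (fun t => (d p (U t) : ℝ) - d m p) zero_le_one (Set.countable_range ((↑) : ℚ → ℝ))
    (continuous_maxObjective hm).continuousOn
    (fun t ht => by
      obtain ⟨n, a, b, hn, hmax, hj⟩ := hU t ht.1 ht.2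
      obtain rfl := hm.unique hn
      have := hasDerivAt_maxObjective ht.2 hmax
      refine this.congr_deriv ?_
      rw [d_join_left hm hmax.1 hj]
      ring) (hint.sub (by simp))
  rw [intervalIntegral.integral_sub hint (by simp), maxObjective_zero hm, maxObjective_one hm] at key
  simp at key
  linarith

end Integral

/-! ### Contraction within one principal filter -/

section Contraction

variable {α : Type*} [PartialOrder α] [ModularMetricPoset α]

/-- The meets and fractional joins of `(p, q)` and `(p', q')` are at total distance at most `k`. -/
def Contracts (k : ℕ) (p q p' q' : α) : Prop :=
  ∀ m m' : α, IsMeet p q m → IsMeet p' q' m' → ∀ U U' : SimpleFunc ℝ α, IsSelection p q U →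
    IsSelection p' q' U' → (d m m' : ℝ) + ∫ t in (0 : ℝ)..1, (d (U t) (U' t) : ℝ) ≤ k

theorem intervalIntegrable_d (U U' : SimpleFunc ℝ α) :
    IntervalIntegrable (fun t => (d (U t) (U' t) : ℝ)) volume 0 1 :=
  intervalIntegrable_of_simpleFunc ((U.pair U').map fun u : α × α => (d u.1 u.2 : ℝ)) 0 1

theorem integral_mono_of_irrational {f g : ℝ → ℝ} (hf : IntervalIntegrable f volume 0 1)
    (hg : IntervalIntegrable g volume 0 1)
    (h : ∀ t ∈ Set.Ioo (0 : ℝ) 1, Irrational t → f t ≤ g t) :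
    ∫ t in (0 : ℝ)..1, f t ≤ ∫ t in (0 : ℝ)..1, g t := by
  rw [intervalIntegral.integral_of_le zero_le_one, intervalIntegral.integral_of_le zero_le_one,
    integral_Ioc_eq_integral_Ioo, integral_Ioc_eq_integral_Ioo]
  refine setIntegral_mono_on_ae ?_ ?_ measurableSet_Ioo ?_
  · exact ((intervalIntegrable_iff_integrableOn_Ioo_of_le zero_le_one).1 hf)
  · exact ((intervalIntegrable_iff_integrableOn_Ioo_of_le zero_le_one).1 hg)
  · filter_upwards [ae_irrational] with t ht h1
    exact h t h1 ht

/-- The middle pair needs a meet so that it has a selection, through which the triangle inequality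
can be integrated. -/
theorem Contracts.trans {k l : ℕ} {p q p' q' p'' q'' n : α} (hn : IsMeet p' q' n)
    (h : Contracts k p q p' q') (h' : Contracts l p' q' p'' q'') :
    Contracts (k + l) p q p'' q'' := by
  intro m m'' hm hm'' U U'' hU hU''
  obtain ⟨U', hU'⟩ := exists_selection hn
  have h1 := h m n hm hn U U' hU hU'
  have h2 := h' n m'' hn hm'' U' U'' hU' hU''
  have h3 : (d m m'' : ℝ) ≤ d m n + d n m'' := by exact_mod_cast d_triangle m n m''
  have h4 := integral_mono_of_irrational (intervalIntegrable_d U U'')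
    ((intervalIntegrable_d U U').add (intervalIntegrable_d U' U''))
    (fun t _ _ => by exact_mod_cast d_triangle (U t) (U' t) (U'' t))
  rw [intervalIntegral.integral_add (intervalIntegrable_d U U') (intervalIntegrable_d U' U'')] at h4
  push_cast
  linarith

theorem Contracts.reverse {k : ℕ} {p q p' q' : α} (h : Contracts k p q p' q') :
    Contracts k p' q' p q := by
  intro m m' hm hm' U U' hU hU'
  have := h m' m hm' hm U' U hU' hU
  simpa only [d_comm m m', d_comm (U _) (U' _)] using this

/-- Exchanging `p` and `q` exchanges the weights `1 - t` and `t`. -/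
theorem exists_selection_swap {p q : α} (U : SimpleFunc ℝ α) (hU : IsSelection p q U) :
    ∃ V : SimpleFunc ℝ α, IsSelection q p V ∧ ∀ t, V t = U (1 - t) := by
  refine ⟨U.comp (fun t => 1 - t) (by fun_prop), fun t ht hirr => ?_, fun t => rfl⟩
  have := (hU (1 - t) ⟨by linarith [ht.2], by linarith [ht.1]⟩
    (by simpa using hirr.ratCast_sub 1)).symm
  simpa using this

theorem Contracts.swap {k : ℕ} {p q p' q' : α} (h : Contracts k p q p' q') :
    Contracts k q p q' p' := by
  intro m m' hm hm' U U' hU hU'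
  obtain ⟨V, hV, hVU⟩ := exists_selection_swap U hU
  obtain ⟨V', hV', hVU'⟩ := exists_selection_swap U' hU'
  have := h m m' hm.symm hm'.symm V V' hV hV'
  simp only [hVU, hVU'] at this
  rwa [intervalIntegral.integral_comp_sub_left (fun t => (d (U t) (U' t) : ℝ)), sub_self,
    sub_zero] at this

theorem contracts_self (p q : α) : Contracts 0 p q p q := by
  intro m m' hm hm' U U' hU hU'
  obtain rfl := hm.unique hm'
  have := integral_mono_of_irrational (intervalIntegrable_d U U') (g := fun _ => 0) (by simp)
    (fun t ht hirr => by rw [(hU t ht hirr).unique hirr (hU' t ht hirr), d_self]; simp)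
  rw [d_self]
  simpa using this

/-- The path goes down from `u` to `a' ∨ b` and up to `u'`; each leg is a difference of ranks. -/
theorem d_join_join_le {m p q a b a' b' u u' : α} (hm : IsMeet p q m) (h : Joinable m p q a b)
    (h' : Joinable m p q a' b') (ha : a' ≤ a) (hb : b ≤ b') (hu : IsJoin a b u)
    (hu' : IsJoin a' b' u') : (d u u' : ℝ) ≤ d m a - d m a' + (d m b' - d m b) := by
  have meet : ∀ {x y}, Joinable m p q x y → IsMeet x y m := fun h =>
    ⟨h.1.1, h.2.1.1, fun z k1 k2 => hm.2.2 _ (k1.trans h.1.2) (k2.trans h.2.1.2)⟩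
  have hj : Joinable m p q a' b := h.mono h'.1.1 ha h.2.1.1 le_rfl
  obtain ⟨w, hw⟩ := exists_join (ha.trans hu.1) hu.2.1
  have h1 : w ≤ u := hw.2.2 _ (ha.trans hu.1) hu.2.1
  have h2 : w ≤ u' := hw.2.2 _ hu'.1 (hb.trans hu'.2.1)
  have v1 := valuation le_rfl (meet h) hu
  have v2 := valuation le_rfl (meet h') hu'
  have v3 := valuation le_rfl (meet hj) hw
  have e1 := d_add _ _ _ (h'.1.1.trans hw.1) h1
  have e2 := d_add _ _ _ (h'.1.1.trans hw.1) h2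
  have e3 := d_triangle u w u'
  rw [d_comm u w] at e3
  rw [d_self] at v1 v2 v3
  have e4 : d u u' + d m a' + d m b ≤ d m a + d m b' := by omega
  have : (d u u' : ℝ) + d m a' + d m b ≤ d m a + d m b' := by exact_mod_cast e4
  linarith

/-- Lowering `p` to a lower cover above the meet. -/
theorem contracts_cover_above {p p' q m : α} (hm : IsMeet p q m) (hmp : m ≤ p') (hp : p' ≤ p)
    (hd : d p' p = 1) : Contracts 1 p q p' q := by
  intro n n' hn hn' U U' hU hU'
  obtain rfl := hm.unique hn
  have hm' : IsMeet p' q m := ⟨hmp, hm.2.1, fun z h1 h2 => hm.2.2 _ (h1.trans hp) h2⟩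
  obtain rfl := hm'.unique hn'
  have i1 := intervalIntegrable_of_simpleFunc (U.map fun u => (d p u : ℝ)) 0 1
  have i2 := intervalIntegrable_of_simpleFunc (U'.map fun u => (d p' u : ℝ)) 0 1
  have e1 := integral_d_left hm U hU
  have e2 := integral_d_left hm' U' hU'
  -- Pointwise, the movement is at most `d p' (U' t) - d p (U t) + 1`. Both distances have mean `d m
  -- q`, so only the 1 survives.
  have h4 := integral_mono_of_irrational (intervalIntegrable_d U U')
    ((i2.sub i1).add (intervalIntegrable_const (c := (1 : ℝ)))) (fun t ht hirr => by
      obtain ⟨n, a, b, hn, hmax, hj⟩ := hU t ht hirr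
      obtain ⟨n', a', b', hn', hmax', hj'⟩ := hU' t ht hirr
      obtain rfl := hm.unique hn
      obtain rfl := hm'.unique hn'
      obtain ⟨ha, hb⟩ := hmax.compare hirr hp hmax'
      have h1 := d_join_join_le hm hmax.1
        ⟨⟨hmax'.1.1.1, hmax'.1.1.2.trans hp⟩, hmax'.1.2⟩ ha hb hj hj'
      have h2 := d_join_left hm hmax.1 hj
      have h3 := d_join_left hm' hmax'.1 hj'
      have h5 : (d m p : ℝ) = d m p' + 1 := by
        rw [d_add _ _ _ hmp hp, hd]
        push_cast
        rfl
      change (d (U t) (U' t) : ℝ) ≤ (d p' (U' t) : ℝ) - d p (U t) + 1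
      linarith)
  rw [intervalIntegral.integral_add (i2.sub i1) intervalIntegrable_const,
    intervalIntegral.integral_sub i2 i1] at h4
  change _ ≤ (∫ t in (0 : ℝ)..1, (d p' (U' t) : ℝ)) - (∫ t in (0 : ℝ)..1, (d p (U t) : ℝ)) + _ at h4
  rw [e1, e2] at h4
  simp only [intervalIntegral.integral_const, sub_zero, smul_eq_mul, mul_one, sub_self, zero_add] at h4
  rw [d_self]
  simpa using h4

/-- Lowering `p` to a lower cover not above the meet does not change the fractional joins. -/
theorem isFracJoin_of_cover {t : ℝ} (ht : t ∈ Set.Ioo (0 : ℝ) 1) {p p' q m u : α}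
    (hm : IsMeet p q m) (hmp : ¬ m ≤ p') (hp : p' ≤ p) (hd : d p' p = 1)
    (h : IsFracJoin t p' q u) : IsFracJoin t p q u := by
  obtain ⟨m', a, b, hm', ⟨hab, hmax⟩, hu⟩ := h
  have hmm : m' ≤ m := hm.2.2 _ (hm'.1.trans hp) hm'.2.1
  have hcov : ∀ y, m ≤ y → y ≤ p → IsJoin y p' p := fun y h1 h2 => by
    obtain ⟨j, hj⟩ := exists_join h2 hp
    rcases eq_or_eq_of_cover hd hj.2.1 (hj.2.2 _ h2 hp) with h | h
    · exact absurd (h ▸ h1.trans hj.1) hmp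
    · exact h ▸ hj
  have hmeet : IsMeet m p' m' :=
    ⟨hmm, hm'.1, fun z h1 h2 => hm'.2.2 _ h2 (h1.trans hm.2.1)⟩
  have e0 := valuation le_rfl hmeet (hcov m le_rfl hm.1)
  have e1 := d_add _ _ _ hm'.1 hp
  have hm1 : d m' m = 1 := by rw [d_self] at e0; omega
  obtain ⟨b', hb'⟩ := exists_join hab.2.1.2 hm.2.1
  have hj1 : Joinable m' p' q a b' := by
    obtain ⟨w, h1, h2⟩ := hab.2.2
    obtain ⟨z, z1, z2, z3⟩ := exists_upper_bound (hab.1.2.trans hp) hm.1 hm.2.1 hab.2.1.2 h2 h1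
    exact ⟨hab.1, ⟨hab.2.1.1.trans hb'.1, hb'.2.2 _ hab.2.1.2 hm.2.1⟩, z, z1, hb'.2.2 _ z3 z2⟩
  -- Since `t > 0`, replacing `b` by `b ∨ m` cannot be a strict gain, so the optimal `b` is already
  -- above `m`.
  have hbb : b = b' := by
    have := hmax _ _ hj1
    simp only [objective] at this
    have h1 : (d m' b' : ℝ) ≤ d m' b := by nlinarith [ht.1]
    exact eq_of_d_le hab.2.1.1 hb'.1 (by exact_mod_cast h1)
  have hmb : m ≤ b := hbb ▸ hb'.2.1
  obtain ⟨a', ha'⟩ := exists_join (hab.1.2.trans hp) hm.1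
  have hu' : IsJoin a' b u :=
    ⟨ha'.2.2 _ hu.1 (hmb.trans hu.2.1), hu.2.1, fun z h1 h2 => hu.2.2 _ (ha'.1.trans h1) h2⟩
  have hrank : ∀ y, m ≤ y → d m' y = d m y + 1 := fun y hy => by
    have := d_add _ _ _ hmm hy
    omega
  have hra : d m a' = d m' a := by
    have h1 : IsMeet a m m' :=
      ⟨hab.1.1, hmm, fun z h1 h2 => hm'.2.2 _ (h1.trans hab.1.2) (h2.trans hm.2.1)⟩
    have := valuation le_rfl h1 ha'
    have := hrank _ ha'.2.1
    rw [d_self] at *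
    omega
  refine ⟨m, a', b, hm, ⟨⟨⟨ha'.2.1, ha'.2.2 _ (hab.1.2.trans hp) hm.1⟩, ⟨hmb, hab.2.1.2⟩, u,
    hu'.1, hu'.2.1⟩, ?_⟩, hu'⟩
  rintro x y ⟨⟨h1, h2⟩, ⟨h3, h4⟩, w, h5, h6⟩
  -- A competitor `(x, y)` for `p` becomes `(x ∧ p', y)` for `p'`; the objectives differ by the
  -- constant `t` because the second rank is measured from `m'` instead of `m`.
  obtain ⟨x', hx', -⟩ := exists_meet (hmm.trans h1) hm'.1
  have := hmax x' y ⟨⟨hx'.2.2 _ (hmm.trans h1) hm'.1, hx'.2.1⟩, ⟨hmm.trans h3, h4⟩, w,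
    hx'.1.trans h5, h6⟩
  have e2 := valuation (hx'.2.2 _ (hmm.trans h1) hm'.1) hx' (hcov x h1 h2)
  have e3 := hrank x h1
  have e4 : d m x = d m' x' := by omega
  simp only [objective] at this ⊢
  rw [hrank y h3, hrank b hmb] at this
  rw [e4, hra]
  push_cast at this
  linarith

theorem contracts_cover {o p p' q : α} (hp' : o ≤ p') (hq : o ≤ q) (hp : p' ≤ p)
    (hd : d p' p = 1) : Contracts 1 p q p' q := by
  obtain ⟨m, hm, -⟩ := exists_meet (hp'.trans hp) hq
  by_cases hmp : m ≤ p'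
  · exact contracts_cover_above hm hmp hp hd
  · intro n m' hn hm' U U' hU hU'
    obtain rfl := hm.unique hn
    have hmm : m' ≤ m := hm.2.2 _ (hm'.1.trans hp) hm'.2.1
    have h0 : d m m' ≤ 1 := by
      have hmeet : IsMeet m p' m' :=
        ⟨hmm, hm'.1, fun z h1 h2 => hm'.2.2 _ h2 (h1.trans hm.2.1)⟩
      obtain ⟨j, hj⟩ := exists_join hm.1 hp
      have e0 := valuation le_rfl hmeet hj
      have e1 := d_mono (hmm.trans hj.1) (hj.2.2 _ hm.1 hp)
      have e2 := d_add _ _ _ hm'.1 hp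
      rw [d_self] at e0
      rw [d_comm]
      omega
    have h1 : (d m m' : ℝ) ≤ 1 := by exact_mod_cast h0
    have := integral_mono_of_irrational (intervalIntegrable_d U U') (g := fun _ => 0) (by simp)
      (fun t ht hirr => by
        rw [(hU t ht hirr).unique hirr (isFracJoin_of_cover ht hm hmp hp hd (hU' t ht hirr)),
          d_self]
        simp)
    simp only [intervalIntegral.integral_const, smul_zero] at this
    push_cast
    linarith

/-- A geodesic between two elements of a filter stays in it, so one-step contractions compose. -/
theorem contracts_left {o q : α} (hq : o ≤ q) (n : ℕ) :
    ∀ p p' : α, o ≤ p → o ≤ p' → d p p' = n → Contracts n p q p' q := by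
  induction n with
  | zero =>
    intro p p' _ _ h
    rw [eq_of_d h]
    exact contracts_self _ _
  | succ n ih =>
    intro p p' hp hp' h
    obtain ⟨z, h1, h2, h3⟩ := exists_step p p' (fun e => by rw [e, d_self] at h; omega)
    have hz : o ≤ z := filter_convex _ _ _ _ hp hp' (by rw [h1, h2])
    obtain ⟨m, hm, -⟩ := exists_meet hz hq
    rw [add_comm]
    refine Contracts.trans hm ?_ (ih z p' hz hp' (by omega))
    rcases h3 with h3 | h3
    · exact (contracts_cover hp hq h3 h1).reverse
    · exact contracts_cover hz hq h3 (by rw [d_comm, h1])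

theorem contracts_filter {o p q p' q' : α} (hp : o ≤ p) (hq : o ≤ q) (hp' : o ≤ p')
    (hq' : o ≤ q') : Contracts (d p p' + d q q') p q p' q' := by
  obtain ⟨m, hm, -⟩ := exists_meet hp' hq
  exact (contracts_left hq _ p p' hp hp' rfl).trans hm (contracts_left hp' _ q q' hq hq' rfl).swap

end Contraction

/-! ### Products and transport along isometric isomorphisms -/

section Product

variable {α β : Type*} [PartialOrder α] [PartialOrder β]

theorem IsMeet.fst_snd {p q m : α × β} (h : IsMeet p q m) :
    IsMeet p.1 q.1 m.1 ∧ IsMeet p.2 q.2 m.2 :=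
  ⟨⟨h.1.1, h.2.1.1, fun z h1 h2 => (h.2.2 (z, m.2) ⟨h1, h.1.2⟩ ⟨h2, h.2.1.2⟩).1⟩,
    ⟨h.1.2, h.2.1.2, fun z h1 h2 => (h.2.2 (m.1, z) ⟨h.1.1, h1⟩ ⟨h.2.1.1, h2⟩).2⟩⟩

theorem IsJoin.fst_snd {p q m : α × β} (h : IsJoin p q m) :
    IsJoin p.1 q.1 m.1 ∧ IsJoin p.2 q.2 m.2 :=
  ⟨⟨h.1.1, h.2.1.1, fun z h1 h2 => (h.2.2 (z, m.2) ⟨h1, h.1.2⟩ ⟨h2, h.2.1.2⟩).1⟩,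
    ⟨h.1.2, h.2.1.2, fun z h1 h2 => (h.2.2 (m.1, z) ⟨h.1.1, h1⟩ ⟨h.2.1.1, h2⟩).2⟩⟩

theorem Joinable.fst_snd {m p q a b : α × β} (h : Joinable m p q a b) :
    Joinable m.1 p.1 q.1 a.1 b.1 ∧ Joinable m.2 p.2 q.2 a.2 b.2 := by
  obtain ⟨⟨h1, h2⟩, ⟨h3, h4⟩, u, h5, h6⟩ := h
  exact ⟨⟨⟨h1.1, h2.1⟩, ⟨h3.1, h4.1⟩, u.1, h5.1, h6.1⟩,
    ⟨⟨h1.2, h2.2⟩, ⟨h3.2, h4.2⟩, u.2, h5.2, h6.2⟩⟩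

theorem Joinable.prod {m p q a b : α} {m' p' q' a' b' : β} (h : Joinable m p q a b)
    (h' : Joinable m' p' q' a' b') : Joinable (m, m') (p, p') (q, q') (a, a') (b, b') := by
  obtain ⟨⟨h1, h2⟩, ⟨h3, h4⟩, u, h5, h6⟩ := h
  obtain ⟨⟨k1, k2⟩, ⟨k3, k4⟩, v, k5, k6⟩ := h'
  exact ⟨⟨⟨h1, k1⟩, ⟨h2, k2⟩⟩, ⟨⟨h3, k3⟩, ⟨h4, k4⟩⟩, (u, v), ⟨h5, k5⟩, ⟨h6, k6⟩⟩

end Product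

section Transport

variable {α β : Type*} [PartialOrder α] [ModularMetricPoset α] [PartialOrder β] {X : Set α} {Y : Set β} {φ : α → β} {ψ : β → α}

theorem IsMeet.mem {p q m : α} (hX : IsConvexSet X) (hp : p ∈ X) (hq : q ∈ X)
    (hm : IsMeet p q m) : m ∈ X :=
  hX p hp q hq m (by rw [hm.d_eq, d_comm m p])

theorem IsJoin.mem {p q m : α} (hX : IsConvexSet X) (hp : p ∈ X) (hq : q ∈ X)
    (hm : IsJoin p q m) : m ∈ X :=
  hX p hp q hq m (by rw [hm.d_eq, d_comm q m])

theorem mem_of_le_of_le {p q z : α} (hX : IsConvexSet X) (hp : p ∈ X) (hq : q ∈ X) (h1 : p ≤ z)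
    (h2 : z ≤ q) : z ∈ X :=
  hX p hp q hq z (d_add _ _ _ h1 h2)

theorem Joinable.transport (hX : IsConvexSet X) (mφ : Monotone φ) {m p q a b : α} (hp : p ∈ X)
    (hq : q ∈ X) (hm : m ∈ X) (h : Joinable m p q a b) :
    (a ∈ X ∧ b ∈ X) ∧ Joinable (φ m) (φ p) (φ q) (φ a) (φ b) := by
  have ha : a ∈ X := mem_of_le_of_le hX hm hp h.1.1 h.1.2
  have hb : b ∈ X := mem_of_le_of_le hX hm hq h.2.1.1 h.2.1.2
  obtain ⟨u, h1, h2⟩ := h.2.2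
  exact ⟨⟨ha, hb⟩, ⟨mφ h.1.1, mφ h.1.2⟩, ⟨mφ h.2.1.1, mφ h.2.1.2⟩, φ u, mφ h1, mφ h2⟩

variable [ModularMetricPoset β]

theorem IsMeet.transport (hY : IsConvexSet Y) (hφ : ∀ x ∈ X, φ x ∈ Y)
    (hψφ : ∀ x ∈ X, ψ (φ x) = x) (hφψ : ∀ y ∈ Y, φ (ψ y) = y)
    (mφ : Monotone φ) (mψ : Monotone ψ) {p q m : α} (hp : p ∈ X) (hq : q ∈ X)
    (hm : IsMeet p q m) : IsMeet (φ p) (φ q) (φ m) := by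
  obtain ⟨n, hn, -⟩ := exists_meet (mφ hm.1) (mφ hm.2.1)
  have hnY := hn.mem hY (hφ p hp) (hφ q hq)
  -- `ψ` is an inverse only on `Y`, so an arbitrary lower bound is first compared with the meet `n`,
  -- which lies in `Y` by convexity.
  have h1 : ψ n ≤ p := by simpa [hψφ p hp] using mψ hn.1
  have h2 : ψ n ≤ q := by simpa [hψφ q hq] using mψ hn.2.1
  have h3 : n ≤ φ m := by simpa [hφψ n hnY] using mφ (hm.2.2 _ h1 h2)
  exact ⟨mφ hm.1, mφ hm.2.1, fun z k1 k2 => (hn.2.2 z k1 k2).trans h3⟩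

theorem IsJoin.transport (hY : IsConvexSet Y) (hφ : ∀ x ∈ X, φ x ∈ Y)
    (hψφ : ∀ x ∈ X, ψ (φ x) = x) (hφψ : ∀ y ∈ Y, φ (ψ y) = y)
    (mφ : Monotone φ) (mψ : Monotone ψ) {p q m : α} (hp : p ∈ X) (hq : q ∈ X)
    (hm : IsJoin p q m) : IsJoin (φ p) (φ q) (φ m) := by
  obtain ⟨n, hn⟩ := exists_join (mφ hm.1) (mφ hm.2.1)
  have hnY := hn.mem hY (hφ p hp) (hφ q hq)
  have h1 : p ≤ ψ n := by simpa [hψφ p hp] using mψ hn.1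
  have h2 : q ≤ ψ n := by simpa [hψφ q hq] using mψ hn.2.1
  have h3 : φ m ≤ n := by simpa [hφψ n hnY] using mφ (hm.2.2 _ h1 h2)
  exact ⟨mφ hm.1, mφ hm.2.1, fun z k1 k2 => h3.trans (hn.2.2 z k1 k2)⟩

/-- Fractional joins are preserved by isometric order isomorphisms of convex subsets. -/
theorem IsFracJoin.transport (hX : IsConvexSet X) (hY : IsConvexSet Y) (hφ : ∀ x ∈ X, φ x ∈ Y)
    (hψ : ∀ y ∈ Y, ψ y ∈ X) (hψφ : ∀ x ∈ X, ψ (φ x) = x) (hφψ : ∀ y ∈ Y, φ (ψ y) = y)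
    (mφ : Monotone φ) (mψ : Monotone ψ) (hd : ∀ x ∈ X, ∀ y ∈ X, d (φ x) (φ y) = d x y)
    {p q u : α} (hp : p ∈ X) (hq : q ∈ X) {t : ℝ} (h : IsFracJoin t p q u) :
    u ∈ X ∧ IsFracJoin t (φ p) (φ q) (φ u) := by
  obtain ⟨m, a, b, hm, ⟨hab, hmax⟩, hu⟩ := h
  have hmX := hm.mem hX hp hq
  obtain ⟨⟨ha, hb⟩, hab'⟩ := hab.transport hX mφ hp hq hmX
  refine ⟨hu.mem hX ha hb, φ m, φ a, φ b,
    hm.transport hY hφ hψφ hφψ mφ mψ hp hq, ⟨hab', fun x y hxy => ?_⟩,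
    hu.transport hY hφ hψφ hφψ mφ mψ ha hb⟩
  obtain ⟨⟨hx, hy⟩, hxy'⟩ := hxy.transport hY mψ (hφ p hp) (hφ q hq) (hφ m hmX)
  rw [hψφ p hp, hψφ q hq, hψφ m hmX] at hxy'
  have := hmax _ _ hxy'
  simp only [objective] at this ⊢
  rw [hd m hmX a ha, hd m hmX b hb, ← hφψ x hx, ← hφψ y hy, hd m hmX _ (hψ x hx),
    hd m hmX _ (hψ y hy)]
  exact this

theorem IsFracJoin.map_orderIso (e : α ≃o β) (he : ∀ x y, d (e x) (e y) = d x y) {t : ℝ}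
    {p q u : α} (h : IsFracJoin t p q u) : IsFracJoin t (e p) (e q) (e u) :=
  (h.transport (X := Set.univ) (Y := Set.univ) (φ := e) (ψ := e.symm) (fun _ _ _ _ _ _ => trivial)
    (fun _ _ _ _ _ _ => trivial) (fun _ _ => trivial) (fun _ _ => trivial) (by simp) (by simp)
    e.monotone e.symm.monotone (fun x _ y _ => he x y) trivial trivial).2

theorem IsFracJoin.fst_snd {t : ℝ} {p q u : α × β} (h : IsFracJoin t p q u) :
    IsFracJoin t p.1 q.1 u.1 ∧ IsFracJoin t p.2 q.2 u.2 := by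
  obtain ⟨m, a, b, hm, ⟨hab, hmax⟩, hu⟩ := h
  refine ⟨⟨m.1, a.1, b.1, hm.fst_snd.1, ⟨hab.fst_snd.1, fun x y hxy => ?_⟩, hu.fst_snd.1⟩,
    ⟨m.2, a.2, b.2, hm.fst_snd.2, ⟨hab.fst_snd.2, fun x y hxy => ?_⟩, hu.fst_snd.2⟩⟩
  · have := hmax _ _ (hxy.prod hab.fst_snd.2)
    simp only [objective, d_prod, Nat.cast_add] at this ⊢
    linarith
  · have := hmax _ _ (hab.fst_snd.1.prod hxy)
    simp only [objective, d_prod, Nat.cast_add] at this ⊢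
    linarith

end Transport

/-! ### Contraction between two filters and submodularity of the distance -/

section Convexity

variable {α : Type*} [PartialOrder α] [ModularMetricPoset α]

/-- Between the fixed sets of `π ∘ σ` and `σ ∘ π`, which are convex, `σ` is an isometric order
isomorphism. It carries the meet and the fractional joins along, displacing each by `d p (σ p)`. -/
theorem contracts_gate {C D : Set α} {π σ : α → α} (hC : IsConvexSet C) (hD : IsConvexSet D)
    (hπ : IsGateMap C π) (hσ : IsGateMap D σ) {p q : α} (hp : π (σ p) = p) (hq : π (σ q) = q) :
    Contracts (d p (σ p) + d q (σ q)) p q (σ p) (σ q) := by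
  intro m m' hm hm' U U' hU hU'
  let X : Set α := {x | π (σ x) = x}
  let Y : Set α := {y | σ (π y) = y}
  have hX : IsConvexSet X := fun x hx y hy z hz => gate_gate_convex hC hπ hσ hx hy hz
  have hY : IsConvexSet Y := fun x hx y hy z hz => gate_gate_convex hD hσ hπ hx hy hz
  have hφ : ∀ x ∈ X, σ x ∈ Y := fun x hx => congrArg σ hx
  have hψ : ∀ y ∈ Y, π y ∈ X := fun y hy => congrArg π hy
  have hψφ : ∀ x ∈ X, π (σ x) = x := fun x hx => hx
  have hφψ : ∀ y ∈ Y, σ (π y) = y := fun y hy => hy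
  have e1 : m' = σ m :=
    hm'.unique (hm.transport hY hφ hψφ hφψ hσ.monotone hπ.monotone hp hq)
  have hmX : m ∈ X := hm.mem hX hp hq
  have e2 := (d_gate_eq hπ hσ hp hmX).1
  have e3 := (d_gate_eq hπ hσ hp hq).1
  have := integral_mono_of_irrational (intervalIntegrable_d U U') (g := fun _ => (d p (σ p) : ℝ))
    (by simp) (fun t ht hirr => by
      obtain ⟨h1, h2⟩ := (hU t ht hirr).transport hX hY hφ hψ hψφ hφψ hσ.monotone hπ.monotone
        (fun x hx y hy => (d_gate_eq hπ hσ hx hy).2) hp hq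
      rw [(hU' t ht hirr).unique hirr h2, (d_gate_eq hπ hσ hp h1).1])
  simp only [intervalIntegral.integral_const, sub_zero, one_smul] at this
  rw [e1, ← e2, ← e3]
  push_cast
  linarith

/-- A geodesic from `x` to `y` can pass through `π y` and `σ (π y)`: its outer legs stay in one
filter each and its middle leg joins mutual gates. -/
theorem contracts_of_filters {o o' p q p' q' : α} (hp : o ≤ p) (hq : o ≤ q) (hp' : o' ≤ p')
    (hq' : o' ≤ q') : Contracts (d p p' + d q q') p q p' q' := by
  have hC := isConvexSet_Ici o
  have hD := isConvexSet_Ici o'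
  obtain ⟨π, hπ⟩ := hC.exists_gateMap ⟨o, le_rfl⟩
  obtain ⟨σ, hσ⟩ := hD.exists_gateMap ⟨o', le_rfl⟩
  have key : ∀ x y : α, o ≤ x → o' ≤ y →
      d x y = d x (π y) + (d (π y) (σ (π y)) + d (σ (π y)) y) := by
    intro x y hx hy
    have h1 := (hπ y).2 x hx
    have h2 := (hσ (π y)).2 y hy
    rw [d_comm y x, d_comm y (π y), d_comm (π y) x] at h1
    omega
  have g1 := gate_gate_gate hπ hσ (z := p') hp'
  have g2 := gate_gate_gate hπ hσ (z := q') hq'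
  obtain ⟨n, hn, -⟩ := exists_meet (hπ p').1 (hπ q').1
  obtain ⟨n', hn', -⟩ := exists_meet (hσ (π p')).1 (hσ (π q')).1
  have c1 := contracts_filter hp hq (hπ p').1 (hπ q').1
  have c2 := contracts_gate hC hD hπ hσ g1 g2
  have c3 := contracts_filter (hσ (π p')).1 (hσ (π q')).1 hp' hq'
  have := c1.trans hn (c2.trans hn' c3)
  rw [key p p' hp hp', key q q' hq hq']
  convert this using 1
  ring

/-- The integral form of the submodularity of the distance function. -/
theorem d_submodular {p q m : α × α} (hm : IsMeet p q m) (U : SimpleFunc ℝ (α × α))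
    (hU : IsSelection p q U) :
    (d m.1 m.2 : ℝ) + ∫ t in (0 : ℝ)..1, (d (U t).1 (U t).2 : ℝ) ≤ d p.1 p.2 + d q.1 q.2 := by
  have h := hm.fst_snd
  have := contracts_of_filters h.1.1 h.1.2.1 h.2.1 h.2.2.1 m.1 m.2 h.1 h.2 (U.map Prod.fst)
    (U.map Prod.snd) (fun t h1 h2 => (hU t h1 h2).fst_snd.1) (fun t h1 h2 => (hU t h1 h2).fst_snd.2)
  exact_mod_cast this

end Convexity

end ModularMetricPoset

/-! ### Oriented modular graphs satisfy the axioms -/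

namespace OrientedModularGraph

variable {V : Type*}

/-- The graph with the reversed orientation. -/
def reverse (Γ : OrientedModularGraph V) : OrientedModularGraph V where
  graph := Γ.graph
  connected := Γ.connected
  exists_median := Γ.exists_median
  arrow u v := Γ.arrow v u
  adj_iff u v := (Γ.adj_iff u v).trans or_comm
  arrow_asymm u v h := Γ.arrow_asymm v u h
  admissible x₁ x₂ x₃ x₄ h1 h2 h3 h4 h5 h6 :=
    Γ.admissible x₂ x₁ x₄ x₃ h1.symm h4.symm h3.symm h2.symm h6 h5

variable (Γ : OrientedModularGraph V)

/-- The distance in the underlying graph. -/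
noncomputable abbrev dist (x y : V) : ℕ := Γ.graph.dist x y

theorem dist_comm (x y : V) : Γ.dist x y = Γ.dist y x := SimpleGraph.dist_comm

theorem dist_triangle (x y z : V) : Γ.dist x z ≤ Γ.dist x y + Γ.dist y z :=
  Γ.connected.dist_triangle

theorem dist_eq_zero {x y : V} : Γ.dist x y = 0 ↔ x = y := Γ.connected.dist_eq_zero_iff

theorem adj_iff_dist {x y : V} : Γ.graph.Adj x y ↔ Γ.dist x y = 1 :=
  SimpleGraph.dist_eq_one_iff_adj.symm

theorem dist_of_arrow {x y : V} (h : Γ.arrow x y) : Γ.dist x y = 1 :=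
  Γ.adj_iff_dist.1 ((Γ.adj_iff x y).2 (Or.inl h))

theorem arrow_or_arrow {x y : V} (h : Γ.dist x y = 1) : Γ.arrow x y ∨ Γ.arrow y x :=
  (Γ.adj_iff x y).1 (Γ.adj_iff_dist.2 h)

theorem exists_dist_step {x y : V} (h : x ≠ y) :
    ∃ z, Γ.dist x z = 1 ∧ Γ.dist x y = 1 + Γ.dist z y := by
  obtain ⟨p, hp⟩ := Γ.connected.exists_walk_length_eq_dist x y
  cases p with
  | nil => exact absurd rfl h
  | @cons _ z _ hz p =>
    have h1 := Γ.adj_iff_dist.1 hz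
    have h2 : Γ.dist z y ≤ p.length := SimpleGraph.dist_le p
    have h3 := Γ.dist_triangle x z y
    rw [SimpleGraph.Walk.length_cons] at hp
    exact ⟨z, h1, by change p.length + 1 = Γ.dist x y at hp; omega⟩

theorem even_dist (x y z : V) : Even (Γ.dist x y + Γ.dist y z + Γ.dist x z) := by
  obtain ⟨m, h1, h2, h3⟩ := Γ.exists_median x y z
  refine ⟨Γ.dist x m + Γ.dist m y + Γ.dist m z, ?_⟩
  have h4 := Γ.dist_comm y m
  simp only [dist] at *
  omega

/-- The quadrangle condition. -/
theorem quadrangle {x w y z : V} (hy : Γ.dist w y = 1) (hz : Γ.dist w z = 1) (hyz : y ≠ z)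
    (hxy : Γ.dist x w = Γ.dist x y + 1) (hxz : Γ.dist x w = Γ.dist x z + 1) :
    ∃ m, Γ.dist m y = 1 ∧ Γ.dist m z = 1 ∧ Γ.dist x y = Γ.dist x m + 1 := by
  obtain ⟨m, h1, h2, h3⟩ := Γ.exists_median x y z
  have e := Γ.even_dist y w z
  have t := Γ.dist_triangle y w z
  have t0 : Γ.dist y z ≠ 0 := fun h => hyz (Γ.dist_eq_zero.1 h)
  have c1 := Γ.dist_comm y w
  have c2 := Γ.dist_comm y m
  have e2 : Γ.dist y z = 2 := by
    obtain ⟨k, hk⟩ := e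
    omega
  simp only [dist] at *
  exact ⟨m, by omega, by omega, by omega⟩

/-- Opposite edges of a square have the same direction. -/
theorem square_arrow {x₁ x₂ x₃ x₄ : V} (h1 : Γ.dist x₁ x₂ = 1) (h2 : Γ.dist x₂ x₃ = 1)
    (h3 : Γ.dist x₃ x₄ = 1) (h4 : Γ.dist x₄ x₁ = 1) (h5 : x₁ ≠ x₃) (h6 : x₂ ≠ x₄)
    (h : Γ.arrow x₁ x₂) : Γ.arrow x₄ x₃ :=
  (Γ.admissible x₁ x₂ x₃ x₄ (Γ.adj_iff_dist.2 h1) (Γ.adj_iff_dist.2 h2) (Γ.adj_iff_dist.2 h3)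
    (Γ.adj_iff_dist.2 h4) h5 h6).1 h

/-- There is a directed path of length `n` from `x` to `y`. -/
inductive DirectedPath : ℕ → V → V → Prop
  | nil (x : V) : DirectedPath 0 x x
  | snoc {n : ℕ} {x y z : V} : DirectedPath n x y → Γ.arrow y z → DirectedPath (n + 1) x z

variable {Γ}

/-- Directed paths are geodesics. -/
theorem DirectedPath.dist_eq {n : ℕ} : ∀ {x y : V}, Γ.DirectedPath n x y → Γ.dist x y = n := by
  induction n using Nat.strong_induction_on with
  | _ n ih =>
    intro x y h
    cases h with
    | nil => exact Γ.dist_eq_zero.2 rfl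
    | @snoc k _ y' _ h hy =>
      have h1 := ih k (by omega) h
      have h2 := Γ.dist_of_arrow hy
      have h3 := Γ.dist_triangle x y' y
      have h3' := Γ.dist_triangle x y y'
      have h4 := Γ.even_dist x y' y
      by_contra hne
      have hlt : k = Γ.dist x y + 1 := by
        have := Γ.dist_comm y y'
        obtain ⟨l, hl⟩ := h4
        omega
      -- By parity the only alternative is that `y` is nearer to `x` than `y'` by one. A square
      -- below the predecessor `z` and `y` then turns the last arrow into `z → w`, a directed path
      -- too long to be a geodesic.
      cases h with
      | nil => omega
      | @snoc l _ z _ h' hz =>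
        have k1 := ih l (by omega) h'
        have k2 := Γ.dist_of_arrow hz
        have hzy : z ≠ y := fun e => Γ.arrow_asymm _ _ hz (e ▸ hy)
        obtain ⟨w, w1, w2, w3⟩ := Γ.quadrangle (x := x) (w := y') (y := z) (z := y)
          (by rw [Γ.dist_comm, k2]) h2 hzy (by omega) (by omega)
        have hyw : y' ≠ w := fun e => by subst e; omega
        have a1 : Γ.arrow z w := Γ.square_arrow (x₁ := y') (x₂ := y) (x₃ := w) (x₄ := z) h2
          (by rw [Γ.dist_comm, w2]) w1 k2 hyw hzy.symm hy
        have := ih (l + 1) (by omega) (h'.snoc a1)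
        omega

theorem DirectedPath.trans {n k : ℕ} {x y z : V} (h : Γ.DirectedPath n x y)
    (h' : Γ.DirectedPath k y z) : Γ.DirectedPath (n + k) x z := by
  induction h' with
  | nil => exact h
  | snoc _ ha ih => exact (ih h).snoc ha

theorem exists_directedPath {x y : V} (h : Relation.ReflTransGen Γ.arrow x y) :
    Γ.DirectedPath (Γ.dist x y) x y := by
  have : ∃ n, Γ.DirectedPath n x y := by
    induction h with
    | refl => exact ⟨0, .nil x⟩
    | tail _ ha ih =>
      obtain ⟨n, hn⟩ := ih
      exact ⟨n + 1, hn.snoc ha⟩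
  obtain ⟨n, hn⟩ := this
  rw [hn.dist_eq]
  exact hn

theorem dist_add {x y z : V} (h : Relation.ReflTransGen Γ.arrow x y)
    (h' : Relation.ReflTransGen Γ.arrow y z) : Γ.dist x z = Γ.dist x y + Γ.dist y z :=
  ((exists_directedPath h).trans (exists_directedPath h')).dist_eq

theorem exists_arrow_of_ne {x y : V} (h : Relation.ReflTransGen Γ.arrow x y) (hne : x ≠ y) :
    ∃ z, Γ.arrow x z ∧ Relation.ReflTransGen Γ.arrow z y := by
  rcases Relation.ReflTransGen.cases_head h with h | h
  · exact absurd h hne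
  · exact h

/-- A neighbour of `u` closer to a descendant `v` of `u` lies between `u` and `v`. -/
theorem arrow_of_closer (n : ℕ) : ∀ {u v y : V}, Γ.dist u v = n →
    Relation.ReflTransGen Γ.arrow u v → Γ.dist u y = 1 → Γ.dist u v = Γ.dist y v + 1 →
    Γ.arrow u y ∧ Relation.ReflTransGen Γ.arrow y v := by
  induction n with
  | zero => intros; omega
  | succ n ih =>
    intro u v y hn huv hy hyv
    have hne : u ≠ v := fun e => by rw [Γ.dist_eq_zero.2 e] at hn; omega
    obtain ⟨x, hx, hxv⟩ := exists_arrow_of_ne huv hne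
    have hx1 := Γ.dist_of_arrow hx
    have e1 := dist_add (.single hx) hxv
    by_cases hxy : x = y
    · exact ⟨hxy ▸ hx, hxy ▸ hxv⟩
    -- In the square `u, x, w, y` the induction hypothesis gives `x → w`; the opposite sides give `u
    -- → y` and `y → w`.
    obtain ⟨w, w1, w2, w3⟩ := Γ.quadrangle (x := v) (w := u) (y := x) (z := y) hx1 hy hxy
      (by rw [Γ.dist_comm v u, Γ.dist_comm v x]; omega)
      (by rw [Γ.dist_comm v u, Γ.dist_comm v y]; omega)
    have c1 := Γ.dist_comm v x
    have c2 := Γ.dist_comm v w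
    have c3 := Γ.dist_comm x w
    have c4 := Γ.dist_comm y w
    have c5 := Γ.dist_comm y u
    obtain ⟨a1, a2⟩ := ih (u := x) (v := v) (y := w) (by omega) hxv (by omega) (by omega)
    have huw : u ≠ w := fun e => by subst e; omega
    have b1 := Γ.square_arrow (x₁ := u) (x₂ := x) (x₃ := w) (x₄ := y) hx1 (by omega) w2 (c5.trans hy)
      huw hxy hx
    have b2 := Γ.square_arrow (x₁ := x) (x₂ := w) (x₃ := y) (x₄ := u) (by omega) w2 (by omega) hx1
      hxy huw.symm a1
    exact ⟨b2, a2.head b1⟩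

/-- The set of vertices from which a given vertex `o` is reachable is metrically convex. -/
theorem ancestors_convex (n : ℕ) : ∀ {o x y z : V}, Γ.dist x y = n →
    Relation.ReflTransGen Γ.arrow x o → Relation.ReflTransGen Γ.arrow y o →
    Γ.dist x y = Γ.dist x z + Γ.dist z y → Relation.ReflTransGen Γ.arrow z o := by
  induction n with
  | zero =>
    intro o x y z hn hx hy hz
    rwa [← Γ.dist_eq_zero.1 (show Γ.dist x z = 0 by omega)]
  | succ n ih =>
    intro o x y z hn hx hy hz
    have first : ∀ z₁, Γ.dist x z₁ = 1 → Γ.dist x y = 1 + Γ.dist z₁ y →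
        Relation.ReflTransGen Γ.arrow z₁ o := by
      intro z₁ h1 h2
      rcases Γ.arrow_or_arrow h1 with ha | ha
      -- If `x` is the median, then `y` reaches `x`, and `x → z₁` would lead away from `y`.
      -- Otherwise a step `x → x'` towards the median is nearer to both `y` and `o`, and a square
      -- transports its direction to an arrow out of `z₁`.
      · obtain ⟨m, m1, m2, m3⟩ := Γ.exists_median x y o
        by_cases hm : x = m
        · have hyx : Relation.ReflTransGen Γ.arrow y x := by
            have key : ∀ k, ∀ v, Γ.dist v o = k → Relation.ReflTransGen Γ.arrow v o → ∀ w,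
                Γ.dist v o = Γ.dist v w + Γ.dist w o → Relation.ReflTransGen Γ.arrow v w := by
              intro k
              induction k with
              | zero =>
                intro v hv _ w hw
                rw [Γ.dist_eq_zero.1 (show Γ.dist v w = 0 by omega)]
              | succ k ihk =>
                intro v hv hvo w hw
                by_cases hvw : v = w
                · rw [hvw]
                obtain ⟨v', v1, v2⟩ := Γ.exists_dist_step hvw
                have t1 := Γ.dist_triangle v v' o
                have t2 := Γ.dist_triangle v' w o
                obtain ⟨a1, a2⟩ := arrow_of_closer _ rfl hvo v1 (by omega)
                exact (ihk v' (by omega) a2 w (by omega)).head a1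
            refine key _ y rfl hy x ?_
            rw [← hm] at m2
            exact m2
          have c1 := Γ.dist_comm x y
          have c2 := Γ.dist_comm z₁ y
          have c3 := Γ.dist_comm z₁ x
          have := dist_add hyx (.single ha)
          omega
        · obtain ⟨x', x1, x2⟩ := Γ.exists_dist_step hm
          have t1 := Γ.dist_triangle x x' y
          have t2 := Γ.dist_triangle x' m y
          have t3 := Γ.dist_triangle x x' o
          have t4 := Γ.dist_triangle x' m o
          simp only [dist] at *
          obtain ⟨a1, a2⟩ := arrow_of_closer (Γ := Γ) _ rfl hx x1 (by simp only [dist]; omega)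
          by_cases hxz : x' = z₁
          · rwa [← hxz]
          obtain ⟨w, w1, w2, w3⟩ := Γ.quadrangle (x := y) (w := x) (y := x') (z := z₁) x1 h1 hxz
            (by rw [Γ.dist_comm y x, Γ.dist_comm y x']; simp only [dist]; omega)
            (by rw [Γ.dist_comm y x, Γ.dist_comm y z₁]; simp only [dist]; omega)
          have c1 := Γ.dist_comm y x'
          have c2 := Γ.dist_comm y w
          have c3 := Γ.dist_comm x' w
          have c4 := Γ.dist_comm z₁ x
          simp only [dist] at *
          have hwo : Relation.ReflTransGen Γ.arrow w o :=
            ih (x := x') (y := y) (by omega) a2 hy (by omega)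
          have hxw : x ≠ w := fun e => by subst e; omega
          exact hwo.head (Γ.square_arrow (x₁ := x) (x₂ := x') (x₃ := w) (x₄ := z₁) x1
            (by simp only [dist]; omega) w2 (by simp only [dist]; omega) hxw hxz a1)
      · exact hx.head ha
    by_cases hxz : x = z
    · rwa [← hxz]
    obtain ⟨z₁, h1, h2⟩ := Γ.exists_dist_step hxz
    have t1 := Γ.dist_triangle x z₁ y
    have t2 := Γ.dist_triangle z₁ z y
    exact ih (x := z₁) (y := y) (by omega) (first z₁ h1 (by omega)) hy (by omega)

theorem reverse_reachable {x y : V} :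
    Relation.ReflTransGen Γ.reverse.arrow x y ↔ Relation.ReflTransGen Γ.arrow y x :=
  Relation.reflTransGen_swap

instance : PartialOrder Γ.Vertex where
  le_antisymm x y h h' := by
    -- A closed directed walk is a geodesic, hence has length 0.
    have h1 := dist_add (Γ := Γ) h' h
    have h0 : Γ.dist x x = 0 := Γ.dist_eq_zero.2 rfl
    exact Γ.dist_eq_zero.1 (show Γ.dist x y = 0 by omega)

noncomputable instance : ModularMetricPoset Γ.Vertex where
  d x y := Γ.dist x y
  d_comm x y := Γ.dist_comm x y
  d_triangle x y z := Γ.dist_triangle x y z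
  d_eq_zero x y := Γ.dist_eq_zero
  exists_step x y h := by
    obtain ⟨z, h1, h2⟩ := Γ.exists_dist_step h
    exact ⟨z, h1, h2, (Γ.arrow_or_arrow h1).symm.imp .single .single⟩
  exists_median x y z := Γ.exists_median x y z
  d_add x y z h h' := by
    rw [Γ.dist_comm x z, Γ.dist_comm x y, Γ.dist_comm y z, dist_add (Γ := Γ) h' h, add_comm]
  filter_convex o x y z hx hy h := ancestors_convex _ rfl hx hy h
  ideal_convex o x y z hx hy h :=
    reverse_reachable.1 (ancestors_convex (Γ := Γ.reverse) _ rfl (reverse_reachable.2 hx)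
      (reverse_reachable.2 hy) h)

end OrientedModularGraph

/-! ### Cone values as lengths, and sums over `E(p, q)` as integrals -/

namespace FractionalJoin

open Real MeasureTheory

theorem sin_add_cos_pos {θ : ℝ} (h0 : 0 ≤ θ) (h1 : θ ≤ π / 2) : 0 < sin θ + cos θ := by
  have hs := sin_nonneg_of_nonneg_of_le_pi h0 (by linarith [pi_pos])
  have hc := cos_nonneg_of_neg_pi_div_two_le_of_le (by linarith [pi_pos]) h1
  have := sin_sq_add_cos_sq θ
  by_contra h
  have h2 : sin θ = 0 := by linarith
  have h3 : cos θ = 0 := by linarith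
  simp [h2, h3] at this

/-- The slope parameter of the direction with angle `θ`. -/
noncomputable def angleParam (θ : ℝ) : ℝ := sin θ / (sin θ + cos θ)

/-- After clearing denominators the inequality is `0 ≤ sin (φ - θ)`. -/
theorem angleParam_le {θ φ : ℝ} (h0 : 0 ≤ θ) (h : θ ≤ φ) (h1 : φ ≤ π / 2) :
    angleParam θ ≤ angleParam φ := by
  rw [angleParam, angleParam, div_le_div_iff₀ (sin_add_cos_pos h0 (h.trans h1))
    (sin_add_cos_pos (h0.trans h) h1)]
  have := sin_nonneg_of_nonneg_of_le_pi (x := φ - θ) (by linarith) (by linarith [pi_pos])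
  rw [sin_sub] at this
  linarith

theorem exists_angleParam {t : ℝ} (ht : t ∈ Set.Icc (0 : ℝ) 1) :
    ∃ θ ∈ Set.Icc 0 (π / 2), angleParam θ = t := by
  have hc : ContinuousOn angleParam (Set.Icc 0 (π / 2)) :=
    continuous_sin.continuousOn.div (by fun_prop) fun θ hθ => (sin_add_cos_pos hθ.1 hθ.2).ne'
  have := intermediate_value_Icc (by positivity) hc
  simp only [angleParam, sin_zero, cos_zero, sin_pi_div_two, cos_pi_div_two] at this
  exact this (by simpa using ht)

theorem angleParam_mem {θ : ℝ} (hθ : θ ∈ Set.Icc 0 (π / 2)) :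
    angleParam θ ∈ Set.Icc (0 : ℝ) 1 := by
  have h1 := angleParam_le le_rfl hθ.1 hθ.2
  have h2 := angleParam_le hθ.1 hθ.2 le_rfl
  simp only [angleParam, sin_zero, cos_zero, sin_pi_div_two, cos_pi_div_two] at h1 h2
  simpa [angleParam] using And.intro h1 h2

/-- The parameters `t` such that `(1 - t, t)` lies in the cone `C`. -/
def paramSet (C : Set (ℝ × ℝ)) : Set ℝ := {t | t ∈ Set.Icc (0 : ℝ) 1 ∧ (1 - t, t) ∈ C}

theorem isClosed_paramSet {C : Set (ℝ × ℝ)} (hC : IsClosed C) : IsClosed (paramSet C) :=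
  isClosed_Icc.inter (hC.preimage (f := fun t : ℝ => ((1 - t, t) : ℝ × ℝ)) (by fun_prop))

/-- The value of a closed convex cone is the length of its set of parameters. -/
theorem coneValue_eq_volume {C : Set (ℝ × ℝ)} (hcl : IsClosed C) (hconv : Convex ℝ C)
    (hcone : ∀ r : ℝ, 0 < r → ∀ c ∈ C, r • c ∈ C) :
    coneValue C = (volume (paramSet C)).toReal := by
  set A : Set ℝ := {θ | θ ∈ Set.Icc 0 (π / 2) ∧ (cos θ, sin θ) ∈ C} with hA
  have hmem : ∀ θ ∈ Set.Icc 0 (π / 2), (θ ∈ A ↔ angleParam θ ∈ paramSet C) := by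
    intro θ hθ
    have hpos := sin_add_cos_pos hθ.1 hθ.2
    -- Central projection from the unit circle to the segment `x + y = 1`; a cone does not see the
    -- rescaling.
    have e1 : ((1 - angleParam θ, angleParam θ) : ℝ × ℝ) =
        (sin θ + cos θ)⁻¹ • ((cos θ, sin θ) : ℝ × ℝ) := by
      rw [angleParam, Prod.smul_mk, smul_eq_mul, smul_eq_mul, Prod.mk.injEq]
      constructor <;> field_simp
      ring
    have e2 : ((cos θ, sin θ) : ℝ × ℝ) =
        (sin θ + cos θ) • ((1 - angleParam θ, angleParam θ) : ℝ × ℝ) := by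
      rw [e1, smul_inv_smul₀ hpos.ne']
    constructor
    · intro h
      refine ⟨angleParam_mem hθ, ?_⟩
      rw [e1]
      exact hcone _ (inv_pos.2 hpos) _ h.2
    · intro h
      refine ⟨hθ, ?_⟩
      rw [e2]
      exact hcone _ hpos _ h.2
  change angleParam (sSup A) - angleParam (sInf A) = _
  rcases A.eq_empty_or_nonempty with h | hne
  · have : paramSet C = ∅ := by
      refine Set.eq_empty_of_forall_notMem fun t ht => ?_
      obtain ⟨θ, hθ, rfl⟩ := exists_angleParam ht.1
      exact (h ▸ (hmem θ hθ).2 ht : θ ∈ (∅ : Set ℝ))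
    -- Both `sSup ∅` and `sInf ∅` are 0, so the empty cone has value 0.
    rw [this, h]
    simp
  · have hAcl : IsClosed A :=
      isClosed_Icc.inter (hcl.preimage (f := fun θ : ℝ => ((cos θ, sin θ) : ℝ × ℝ)) (by fun_prop))
    have hbdd : A ⊆ Set.Icc 0 (π / 2) := fun θ h => h.1
    have ha := hAcl.csSup_mem hne (bddAbove_Icc.mono hbdd)
    have hb := hAcl.csInf_mem hne (bddBelow_Icc.mono hbdd)
    have hle : sInf A ≤ sSup A := csInf_le (bddBelow_Icc.mono hbdd) ha
    have hT : paramSet C = Set.Icc (angleParam (sInf A)) (angleParam (sSup A)) := by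
      refine Set.Subset.antisymm ?_ ?_
      · intro t ht
        obtain ⟨θ, hθ, rfl⟩ := exists_angleParam ht.1
        have hθA := (hmem θ hθ).2 ht
        exact ⟨angleParam_le hb.1.1 (csInf_le (bddBelow_Icc.mono hbdd) hθA) hθ.2,
          angleParam_le hθ.1 (le_csSup (bddAbove_Icc.mono hbdd) hθA) ha.1.2⟩
      · have hc : Convex ℝ (paramSet C) := by
          intro x hx y hy a b ha hb hab
          refine ⟨convex_Icc (0 : ℝ) 1 hx.1 hy.1 ha hb hab, ?_⟩
          have := hconv hx.2 hy.2 ha hb hab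
          convert this using 1
          simp only [smul_eq_mul, Prod.smul_mk, Prod.mk_add_mk, Prod.mk.injEq, and_true]
          linear_combination (-1 : ℝ) * hab
        exact hc.ordConnected.out ((hmem _ hb.1).1 hb) ((hmem _ ha.1).1 ha)
    rw [hT, Real.volume_Icc, ENNReal.toReal_ofReal]
    linarith [angleParam_le hb.1.1 hle ha.1.2]

/-- If a linear functional has a unique maximizer `v` on `S`, it has a unique maximizer on the
convex hull of `S`. -/
theorem convexHull_subset_of_maximizer {S : Set (ℝ × ℝ)} {c v : ℝ × ℝ}
    (h : ∀ x ∈ S, c.1 * x.1 + c.2 * x.2 < c.1 * v.1 + c.2 * v.2 ∨ x = v) :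
    ∀ x ∈ convexHull ℝ S, c.1 * x.1 + c.2 * x.2 < c.1 * v.1 + c.2 * v.2 ∨ x = v := by
  suffices convexHull ℝ S ⊆ {x : ℝ × ℝ | c.1 * x.1 + c.2 * x.2 < c.1 * v.1 + c.2 * v.2 ∨ x = v} from
    fun x hx => this hx
  refine convexHull_min (fun x hx => h x hx) ?_
  intro x hx y hy a b ha hb hab
  simp only [Set.mem_ofPred_eq] at hx hy
  simp only [Set.mem_ofPred_eq, Prod.fst_add, Prod.snd_add, Prod.smul_fst, Prod.smul_snd,
    smul_eq_mul]
  have hle : ∀ z : ℝ × ℝ, (c.1 * z.1 + c.2 * z.2 < c.1 * v.1 + c.2 * v.2 ∨ z = v) →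
      c.1 * z.1 + c.2 * z.2 ≤ c.1 * v.1 + c.2 * v.2 := by
    rintro z (hz | rfl)
    · exact hz.le
    · exact le_rfl
  have e : c.1 * (a * x.1 + b * y.1) + c.2 * (a * x.2 + b * y.2) =
      a * (c.1 * x.1 + c.2 * x.2) + b * (c.1 * y.1 + c.2 * y.2) := by ring
  have e' : c.1 * v.1 + c.2 * v.2 =
      a * (c.1 * v.1 + c.2 * v.2) + b * (c.1 * v.1 + c.2 * v.2) := by
    rw [← add_mul, hab, one_mul]
  rcases ha.eq_or_lt with rfl | ha'
  · have hb1 : b = 1 := by linarith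
    subst hb1
    simpa using hy
  rcases hb.eq_or_lt with rfl | hb'
  · have ha1 : a = 1 := by linarith
    subst ha1
    simpa using hx
  rcases hx with hx' | rfl
  · left
    rw [e]
    have := mul_lt_mul_of_pos_left hx' ha'
    have := mul_le_mul_of_nonneg_left (hle y hy) hb
    linarith
  · rcases hy with hy' | rfl
    · left
      rw [e]
      have := mul_lt_mul_of_pos_left hy' hb'
      linarith
    · right
      rw [← add_smul, hab, one_smul]

section

variable {L : Type*} [SemilatticeInf L]

theorem isClosed_normalCone (p q u : L) : IsClosed (normalCone p q u) := by
  have : normalCone p q u = {c | 0 ≤ c.1} ∩ ({c | 0 ≤ c.2} ∩ ⋂ x ∈ convSet p q,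
      {c : ℝ × ℝ | c.1 * x.1 + c.2 * x.2 ≤ c.1 * (rankVec p q u).1 + c.2 * (rankVec p q u).2}) := by
    ext c
    simp [normalCone]
  rw [this]
  refine (isClosed_le continuous_const continuous_fst).inter
    ((isClosed_le continuous_const continuous_snd).inter ?_)
  exact isClosed_biInter fun x _ => isClosed_le (by fun_prop) (by fun_prop)

theorem convex_normalCone (p q u : L) : Convex ℝ (normalCone p q u) := by
  intro x hx y hy a b ha hb _
  refine ⟨?_, ?_, fun z hz => ?_⟩
  · exact add_nonneg (mul_nonneg ha hx.1) (mul_nonneg hb hy.1)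
  · exact add_nonneg (mul_nonneg ha hx.2.1) (mul_nonneg hb hy.2.1)
  · have h1 := mul_le_mul_of_nonneg_left (hx.2.2 z hz) ha
    have h2 := mul_le_mul_of_nonneg_left (hy.2.2 z hz) hb
    simp only [Prod.fst_add, Prod.snd_add, Prod.smul_fst, Prod.smul_snd, smul_eq_mul]
    linarith

theorem smul_mem_normalCone (p q u : L) (r : ℝ) (hr : 0 < r) (c : ℝ × ℝ)
    (hc : c ∈ normalCone p q u) : r • c ∈ normalCone p q u := by
  refine ⟨mul_nonneg hr.le hc.1, mul_nonneg hr.le hc.2.1, fun z hz => ?_⟩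
  have h1 := mul_le_mul_of_nonneg_left (hc.2.2 z hz) hr.le
  simp only [Prod.smul_fst, Prod.smul_snd, smul_eq_mul]
  linarith

theorem coneValue_normalCone (p q u : L) :
    coneValue (normalCone p q u) = (volume (paramSet (normalCone p q u))).toReal :=
  coneValue_eq_volume (isClosed_normalCone p q u) (convex_normalCone p q u)
    (smul_mem_normalCone p q u)

/-- If `u` is the only element of `I(p, q)` that maximizes the objective function at `t` up to
equality of rank vectors, then `u ∈ E(p, q)` and `t` belongs to the cone of `u`. -/
theorem mem_support_of_maximizer {p q u : L} {t : ℝ} (ht : t ∈ Set.Ioo (0 : ℝ) 1)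
    (hu : u ∈ joinSet p q) (h : ∀ w ∈ joinSet p q, (1 - t) * (rankVec p q w).1 +
      t * (rankVec p q w).2 < (1 - t) * (rankVec p q u).1 + t * (rankVec p q u).2 ∨
      rankVec p q w = rankVec p q u) :
    u ∈ support p q ∧ t ∈ paramSet (normalCone p q u) := by
  -- A unique maximizer of a functional with positive weights is an extreme point and is not
  -- dominated componentwise.
  have key : ∀ x ∈ convSet p q, (1 - t) * x.1 + t * x.2 <
      (1 - t) * (rankVec p q u).1 + t * (rankVec p q u).2 ∨ x = rankVec p q u := by
    refine convexHull_subset_of_maximizer (c := (1 - t, t)) ?_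
    rintro _ ⟨w, hw, rfl⟩
    exact h w hw
  have hmem : rankVec p q u ∈ convSet p q := subset_convexHull ℝ _ ⟨u, hu, rfl⟩
  have ht0 := ht.1
  have ht1 : 0 < 1 - t := by linarith [ht.2]
  refine ⟨⟨hu, ⟨hmem, ?_⟩, hmem, ?_⟩, ⟨ht.1.le, ht.2.le⟩, ht1.le, ht0.le, ?_⟩
  · rintro x hx y hy ⟨a, b, ha, hb, hab, hxy⟩
    have e1 := congrArg Prod.fst hxy
    have e2 := congrArg Prod.snd hxy
    simp only [Prod.fst_add, Prod.snd_add, Prod.smul_fst, Prod.smul_snd, smul_eq_mul] at e1 e2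
    rcases key x hx with h1 | h1
    · exfalso
      have h2 : (1 - t) * y.1 + t * y.2 ≤ (1 - t) * (rankVec p q u).1 + t * (rankVec p q u).2 := by
        rcases key y hy with h2 | h2
        · exact h2.le
        · rw [h2]
      have h3 := mul_lt_mul_of_pos_left h1 ha
      have h4 := mul_le_mul_of_nonneg_left h2 hb.le
      have h5 : a * ((1 - t) * x.1 + t * x.2) + b * ((1 - t) * y.1 + t * y.2) =
          (a + b) * ((1 - t) * (rankVec p q u).1 + t * (rankVec p q u).2) := by
        rw [hab, one_mul, ← e1, ← e2]
        ring
      linarith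
    · exact h1
  · intro x hx hle
    rcases key x hx with h1 | h1
    · exfalso
      have h2 := mul_le_mul_of_nonneg_left hle.1 ht1.le
      have h3 := mul_le_mul_of_nonneg_left hle.2 ht0.le
      linarith
    · exact h1.le
  · intro x hx
    rcases key x hx with h1 | h1
    · exact h1.le
    · rw [h1]

/-- An integral over a selection of maximizers is a sum over `E(p, q)`. -/
theorem integral_eq_sum_support {p q : L} (hfin : (support p q).Finite) (F : ℝ → ℝ) (f : L → ℝ)
    (hF : ∀ t ∈ Set.Ioo (0 : ℝ) 1, Irrational t → ∃ u ∈ support p q, F t = f u ∧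
      ∀ w ∈ support p q, t ∈ paramSet (normalCone p q w) ↔ w = u) :
    ∫ t in (0 : ℝ)..1, F t =
      ∑ u ∈ hfin.toFinset, coneValue (normalCone p q u) * f u := by
  classical
  -- Almost every `t` lies in the parameter set of exactly one element of `E(p, q)`.
  have hae : ∀ᵐ t : ℝ, t ∈ Set.Icc (0 : ℝ) 1 → F t =
      ∑ u ∈ hfin.toFinset, (paramSet (normalCone p q u)).indicator (fun _ => f u) t := by
    have h0 : ∀ᵐ t : ℝ, t ≠ 0 := (Set.countable_singleton (0 : ℝ)).ae_notMem _
    have h1 : ∀ᵐ t : ℝ, t ≠ 1 := (Set.countable_singleton (1 : ℝ)).ae_notMem _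
    filter_upwards [ModularMetricPoset.ae_irrational, h0, h1] with t ht h0 h1 hI
    obtain ⟨u, hu, hFu, hw⟩ := hF t ⟨lt_of_le_of_ne hI.1 h0.symm, lt_of_le_of_ne hI.2 h1⟩ ht
    rw [hFu, Finset.sum_eq_single_of_mem u (hfin.mem_toFinset.2 hu)]
    · rw [Set.indicator_of_mem ((hw u hu).2 rfl)]
    · intro w hwE hne
      exact Set.indicator_of_notMem (fun h => hne ((hw w (hfin.mem_toFinset.1 hwE)).1 h)) _
  rw [intervalIntegral.integral_of_le zero_le_one, ← integral_Icc_eq_integral_Ioc,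
    setIntegral_congr_ae measurableSet_Icc hae, integral_finsetSum]
  · refine Finset.sum_congr rfl fun u _ => ?_
    have hmeas := (isClosed_paramSet (isClosed_normalCone p q u)).measurableSet
    rw [integral_indicator_const _ hmeas, coneValue_normalCone, smul_eq_mul, measureReal_def,
      Measure.restrict_apply hmeas, Set.inter_eq_left.2 fun t ht => ht.1]
  · intro u _
    exact (integrable_const _).indicator (isClosed_paramSet (isClosed_normalCone p q u)).measurableSet

end

end FractionalJoin

/-! ### Intervals and filters as modular lattices and semilattices -/

namespace ModularMetricPoset

open OrderDual MeasureTheory FractionalJoin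

section Embedding

variable {β : Type*} [PartialOrder β] [ModularMetricPoset β] {P : Type*} [PartialOrder P]

/-- A poset isomorphic to an interval is a lattice. -/
noncomputable abbrev latticeOfInterval {a b : β} (e : P ≃o Set.Icc a b) : Lattice P :=
  have hinf : ∀ x y : P, ∃ m : P, IsMeet x y m := fun x y => by
    obtain ⟨m, hm, -⟩ := exists_meet (e x).2.1 (e y).2.1
    let m' : Set.Icc a b := ⟨m, hm.2.2 _ (e x).2.1 (e y).2.1, hm.1.trans (e x).2.2⟩
    refine ⟨e.symm m', (OrderIso.symm_apply_le e).2 hm.1, (OrderIso.symm_apply_le e).2 hm.2.1,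
      fun z h1 h2 => (OrderIso.le_symm_apply e).2 (hm.2.2 _ (e.monotone h1) (e.monotone h2))⟩
  have hsup : ∀ x y : P, ∃ m : P, IsJoin x y m := fun x y => by
    obtain ⟨m, hm⟩ := exists_join (e x).2.2 (e y).2.2
    let m' : Set.Icc a b := ⟨m, (e x).2.1.trans hm.1, hm.2.2 _ (e x).2.2 (e y).2.2⟩
    refine ⟨e.symm m', (OrderIso.le_symm_apply e).2 hm.1, (OrderIso.le_symm_apply e).2 hm.2.1,
      fun z h1 h2 => (OrderIso.symm_apply_le e).2 (hm.2.2 _ (e.monotone h1) (e.monotone h2))⟩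
  { (inferInstance : PartialOrder P) with
    inf := fun x y => (hinf x y).choose
    inf_le_left := fun x y => (hinf x y).choose_spec.1
    inf_le_right := fun x y => (hinf x y).choose_spec.2.1
    le_inf := fun z x y h1 h2 => (hinf x y).choose_spec.2.2 z h1 h2
    sup := fun x y => (hsup x y).choose
    le_sup_left := fun x y => (hsup x y).choose_spec.1
    le_sup_right := fun x y => (hsup x y).choose_spec.2.1
    sup_le := fun x y z h1 h2 => (hsup x y).choose_spec.2.2 z h1 h2 }

theorem isMeet_coe {a b : β} {x y m : Set.Icc a b} (h : IsMeet x y m) :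
    IsMeet (x : β) y m :=
  ⟨h.1, h.2.1, fun z h1 h2 => by
    obtain ⟨n, hn, -⟩ := exists_meet x.2.1 y.2.1
    have h3 := h.2.2 ⟨n, hn.2.2 _ x.2.1 y.2.1, hn.1.trans x.2.2⟩ hn.1 hn.2.1
    exact (hn.2.2 z h1 h2).trans h3⟩

theorem isJoin_coe {a b : β} {x y m : Set.Icc a b} (h : IsJoin x y m) :
    IsJoin (x : β) y m :=
  ⟨h.1, h.2.1, fun z h1 h2 => by
    obtain ⟨n, hn⟩ := exists_join x.2.2 y.2.2
    have h3 := h.2.2 ⟨n, x.2.1.trans hn.1, hn.2.2 _ x.2.2 y.2.2⟩ hn.1 hn.2.1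
    exact le_trans (show (m : β) ≤ n from h3) (hn.2.2 z h1 h2)⟩

theorem isMeet_map {Q : Type*} [PartialOrder Q] (e : P ≃o Q) {x y m : P} (h : IsMeet x y m) :
    IsMeet (e x) (e y) (e m) :=
  ⟨e.monotone h.1, e.monotone h.2.1, fun _ h1 h2 => (OrderIso.symm_apply_le e).1
    (h.2.2 _ ((OrderIso.symm_apply_le e).2 h1) ((OrderIso.symm_apply_le e).2 h2))⟩

theorem isJoin_map {Q : Type*} [PartialOrder Q] (e : P ≃o Q) {x y m : P} (h : IsJoin x y m) :
    IsJoin (e x) (e y) (e m) :=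
  ⟨e.monotone h.1, e.monotone h.2.1, fun _ h1 h2 => (OrderIso.le_symm_apply e).1
    (h.2.2 _ ((OrderIso.le_symm_apply e).2 h1) ((OrderIso.le_symm_apply e).2 h2))⟩

theorem isMeet_inf {Q : Type*} [SemilatticeInf Q] (x y : Q) : IsMeet x y (x ⊓ y) :=
  ⟨inf_le_left, inf_le_right, fun _ => le_inf⟩

theorem isJoin_sup {Q : Type*} [SemilatticeSup Q] (x y : Q) : IsJoin x y (x ⊔ y) :=
  ⟨le_sup_left, le_sup_right, fun _ => sup_le⟩

/-- Intervals are modular lattices. -/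
theorem isModularLattice_interval {a b : β} (e : P ≃o Set.Icc a b) :
    @IsModularLattice P (latticeOfInterval e) := by
  let _ := latticeOfInterval e
  refine ⟨fun {x} y {z} hxz => ?_⟩
  have hmeet : ∀ u v : P, IsMeet (e u : β) (e v) (e (u ⊓ v)) := fun u v =>
    isMeet_coe (isMeet_map e (isMeet_inf u v))
  have hjoin : ∀ u v : P, IsJoin (e u : β) (e v) (e (u ⊔ v)) := fun u v =>
    isJoin_coe (isJoin_map e (isJoin_sup u v))
  have hle : x ⊔ y ⊓ z ≤ (x ⊔ y) ⊓ z :=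
    le_inf (sup_le_sup_left inf_le_left _) (sup_le hxz inf_le_right)
  -- The two sides of the modular law are comparable and have the same meet and join with `y`, hence
  -- the same rank.
  have h1 : (x ⊔ y) ⊓ z ⊓ y = y ⊓ z :=
    le_antisymm (le_inf inf_le_right (inf_le_left.trans inf_le_right))
      (le_inf (le_inf (inf_le_left.trans le_sup_right) inf_le_right) inf_le_left)
  have h2 : (x ⊔ y) ⊓ z ⊔ y = x ⊔ y :=
    le_antisymm (sup_le inf_le_left le_sup_right)
      (sup_le ((le_inf le_sup_left hxz).trans le_sup_left) le_sup_right)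
  have h3 : (x ⊔ y ⊓ z) ⊓ y = y ⊓ z :=
    le_antisymm ((inf_le_inf_right y hle).trans h1.le) (le_inf le_sup_right inf_le_left)
  have h4 : (x ⊔ y ⊓ z) ⊔ y = x ⊔ y :=
    le_antisymm (sup_le (sup_le le_sup_left (inf_le_left.trans le_sup_right)) le_sup_right)
      (sup_le (le_sup_left.trans le_sup_left) le_sup_right)
  have m1 := hmeet ((x ⊔ y) ⊓ z) y
  have j1 := hjoin ((x ⊔ y) ⊓ z) y
  have m2 := hmeet (x ⊔ y ⊓ z) y
  have j2 := hjoin (x ⊔ y ⊓ z) y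
  rw [h1] at m1
  rw [h2] at j1
  rw [h3] at m2
  rw [h4] at j2
  have v1 := valuation (e (y ⊓ z)).2.1 m1 j1
  have v2 := valuation (e (y ⊓ z)).2.1 m2 j2
  have hb : (e (x ⊔ y ⊓ z) : β) ≤ e ((x ⊔ y) ⊓ z) := e.monotone hle
  have := eq_of_d_le (e (x ⊔ y ⊓ z)).2.1 hb (by omega)
  exact (e.injective (Subtype.ext this)).ge

theorem isModularLatticeOrder_of_orderIso {a b : β} (e : P ≃o Set.Icc a b) :
    IsModularLatticeOrder P :=
  ⟨latticeOfInterval e, rfl, isModularLattice_interval e⟩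

end Embedding

theorem isJoin_filter_iff {β : Type*} [PartialOrder β] {o : β} {x y u : Set.Ici o} : IsJoin x y u ↔ IsJoin (x : β) y u := by
  constructor
  · exact fun h => ⟨h.1, h.2.1, fun z h1 h2 => h.2.2 ⟨z, le_trans x.2 h1⟩ h1 h2⟩
  · exact fun h => ⟨h.1, h.2.1, fun z h1 h2 => h.2.2 z h1 h2⟩

section Filter

variable {β : Type*} [PartialOrder β] [ModularMetricPoset β]

/-- Principal filters are meet-semilattices. -/
noncomputable abbrev filterSemilattice (o : β) : SemilatticeInf (Set.Ici o) where
  toPartialOrder := inferInstance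
  inf x y := ⟨(exists_meet x.2 y.2).choose, (exists_meet x.2 y.2).choose_spec.1.2.2 _ x.2 y.2⟩
  inf_le_left x y := (exists_meet x.2 y.2).choose_spec.1.1
  inf_le_right x y := (exists_meet x.2 y.2).choose_spec.1.2.1
  le_inf z x y h1 h2 := (exists_meet x.2 y.2).choose_spec.1.2.2 z.1 h1 h2

attribute [local instance] filterSemilattice

variable {o : β}

theorem isMeet_inf_coe (p q : Set.Ici o) : IsMeet (p : β) q (p ⊓ q : Set.Ici o) :=
  (exists_meet p.2 q.2).choose_spec.1

/-- Distance from `o` is strictly increasing on the filter, and descending by lower steps produces a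
chain of that length. -/
theorem height_filter (x : Set.Ici o) : Order.height x = d o (x : β) := by
  apply le_antisymm
  · have hs : StrictMono fun y : Set.Ici o => d o (y : β) := by
      intro y z h
      by_contra hn
      exact h.ne (Subtype.ext (eq_of_d_le y.2 h.le (not_lt.1 hn)))
    have := Order.height_le_height_apply_of_strictMono _ hs x
    rwa [Order.height_nat] at this
  · suffices ∀ n, ∀ y : Set.Ici o, d o (y : β) = n → (n : ℕ∞) ≤ Order.height y from this _ x rfl
    intro n
    induction n with
    | zero => intros; simp
    | succ n ih =>
      intro y hy
      obtain ⟨z, h1, h2, h3⟩ := exists_lower_step y.2 fun e => by rw [← e, d_self] at hy; omega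
      have h4 := d_add _ _ _ h2 h3
      have hlt : (⟨z, h2⟩ : Set.Ici o) < y := by
        refine lt_of_le_of_ne h3 fun e => ?_
        rw [← e, d_self] at h1
        omega
      have := ih ⟨z, h2⟩ (by simp only; omega)
      push_cast
      exact (add_le_add_left this 1).trans (Order.height_add_one_le hlt)

theorem rank_filter (x : Set.Ici o) : rank x = d o (x : β) := by
  rw [rank, height_filter]
  rfl

theorem isLUB_pair_iff {P : Type*} [PartialOrder P] {x y u : P} :
    IsLUB {x, y} u ↔ IsJoin x y u := by
  simp only [IsLUB, IsLeast, mem_lowerBounds, mem_upperBounds, Set.mem_insert_iff,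
    Set.mem_singleton_iff, forall_eq_or_imp, forall_eq, IsJoin]
  tauto

theorem isModularSemilattice_filter (o : β) : IsModularSemilattice (Set.Ici o) where
  nonempty := ⟨⟨o, le_rfl⟩⟩
  finite_rank p := by
    rw [height_filter]
    exact ENat.natCast_ne_top _
  ideal_modular x := isModularLatticeOrder_of_orderIso (a := o) (b := (x : β))
    { toFun := fun y => ⟨y.1.1, y.1.2, y.2⟩
      invFun := fun y => ⟨⟨y.1, y.2.1⟩, y.2.2⟩
      left_inv := fun _ => rfl
      right_inv := fun _ => rfl
      map_rel_iff' := Iff.rfl }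
  triple_join x y z := by
    rintro ⟨a, ha⟩ ⟨b, hb⟩ ⟨c, hc⟩
    rw [isLUB_pair_iff, isJoin_filter_iff] at ha hb hc
    obtain ⟨u, h1, h2, h3⟩ := exists_upper_bound ha.1 ha.2.1 hb.1 hb.2.1 hc.1 hc.2.1
    obtain ⟨v, hv⟩ := exists_join (ha.2.2 _ h1 h2) h3
    refine ⟨⟨v, le_trans x.2 (ha.1.trans hv.1)⟩, ?_, ?_⟩
    · rintro w (rfl | rfl | rfl)
      · exact ha.1.trans hv.1
      · exact ha.2.1.trans hv.1
      · exact hv.2.1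
    · intro w hw
      exact hv.2.2 _ (ha.2.2 _ (hw (by simp)) (hw (by simp))) (hw (by simp))

theorem mem_joinSet_iff {p q u : Set.Ici o} : u ∈ joinSet p q ↔
    ∃ a b : β, Joinable ((p ⊓ q : Set.Ici o) : β) p q a b ∧ IsJoin a b (u : β) := by
  constructor
  · rintro ⟨a, b, ha, hb, hu⟩
    rw [isLUB_pair_iff, isJoin_filter_iff] at hu
    exact ⟨a, b, ⟨ha, hb, u, hu.1, hu.2.1⟩, hu⟩
  · rintro ⟨a, b, ⟨ha, hb, -⟩, hu⟩
    exact ⟨⟨a, le_trans (p ⊓ q).2 ha.1⟩, ⟨b, le_trans (p ⊓ q).2 hb.1⟩, ha, hb,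
      isLUB_pair_iff.2 (isJoin_filter_iff.2 hu)⟩

theorem rankVec_filter {p q u : Set.Ici o} {a b : β}
    (h : Joinable ((p ⊓ q : Set.Ici o) : β) p q a b) (hu : IsJoin a b (u : β)) :
    rankVec p q u = ((d ((p ⊓ q : Set.Ici o) : β) a : ℝ), (d ((p ⊓ q : Set.Ici o) : β) b : ℝ)) := by
  have hm := isMeet_inf_coe p q
  have e1 := (isMeet_inf_coe u p).unique (isMeet_join_left hm h.1.1 h.1.2 h.2.1.1 h.2.1.2 hu)
  have e2 := (isMeet_inf_coe u q).unique (isMeet_join_right hm h.1.1 h.1.2 h.2.1.1 h.2.1.2 hu)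
  rw [rankVec, rank_filter, rank_filter, rank_filter, e1, e2, d_add _ _ _ (p ⊓ q).2 h.1.1,
    d_add _ _ _ (p ⊓ q).2 h.2.1.1]
  push_cast
  rw [add_sub_cancel_left, add_sub_cancel_left]

/-- If two elements share an extreme rank vector, it is the midpoint of the vectors of `(a ∨ a', b ∧
b')` and `(a ∧ a', b ∨ b')`. Extremality makes all three equal, so `a = a'` and `b = b'`. -/
theorem rankVec_injOn (p q : Set.Ici o) : Set.InjOn (rankVec p q) (support p q) := by
  intro u hu v hv huv
  obtain ⟨a, b, hab, hju⟩ := mem_joinSet_iff.1 hu.1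
  obtain ⟨a', b', hab', hjv⟩ := mem_joinSet_iff.1 hv.1
  have eu := rankVec_filter hab hju
  have ev := rankVec_filter hab' hjv
  obtain ⟨c, hc⟩ := exists_join hab.1.2 hab'.1.2
  obtain ⟨f, hf, -⟩ := exists_meet hab.1.1 hab'.1.1
  obtain ⟨e, he, -⟩ := exists_meet hab.2.1.1 hab'.2.1.1
  obtain ⟨g, hg⟩ := exists_join hab.2.1.2 hab'.2.1.2
  have j1 := hab.sup_inf hab' hc he
  have j2 := hab.inf_sup hab' hf hg
  have hmem : ∀ x y, Joinable ((p ⊓ q : Set.Ici o) : β) p q x y →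
      (((d ((p ⊓ q : Set.Ici o) : β) x : ℝ), (d ((p ⊓ q : Set.Ici o) : β) y : ℝ)) : ℝ × ℝ) ∈
        convSet p q := by
    intro x y hxy
    obtain ⟨z, h1, h2⟩ := hxy.2.2
    obtain ⟨w, hw⟩ := exists_join h1 h2
    have ho : o ≤ w := le_trans (p ⊓ q).2 (hxy.1.1.trans hw.1)
    rw [← rankVec_filter (u := ⟨w, ho⟩) hxy hw]
    exact subset_convexHull ℝ _ ⟨_, mem_joinSet_iff.2 ⟨x, y, hxy, hw⟩, rfl⟩
  have v1 : (d ((p ⊓ q : Set.Ici o) : β) a : ℝ) + d ((p ⊓ q : Set.Ici o) : β) a' =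
      d ((p ⊓ q : Set.Ici o) : β) f + d ((p ⊓ q : Set.Ici o) : β) c := by
    exact_mod_cast valuation j2.1.1 hf hc
  have v2 : (d ((p ⊓ q : Set.Ici o) : β) b : ℝ) + d ((p ⊓ q : Set.Ici o) : β) b' =
      d ((p ⊓ q : Set.Ici o) : β) e + d ((p ⊓ q : Set.Ici o) : β) g := by
    exact_mod_cast valuation j1.2.1.1 he hg
  rw [eu, ev, Prod.mk.injEq] at huv
  have hext := hu.2.1.2 (hmem _ _ j1) (hmem _ _ j2) ⟨1 / 2, 1 / 2, by norm_num, by norm_num,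
    by norm_num, by
      rw [eu, Prod.smul_mk, Prod.smul_mk, Prod.mk_add_mk, Prod.mk.injEq]
      simp only [smul_eq_mul]
      constructor <;> linarith [huv.1, huv.2]⟩
  rw [eu, Prod.mk.injEq] at hext
  obtain ⟨x1, x2⟩ := hext
  have ha : a = c := eq_of_d_le hab.1.1 hc.1 (by exact_mod_cast x1.le)
  have ha' : a' = c := eq_of_d_le hab'.1.1 hc.2.1 (by
    rw [huv.1] at x1
    exact_mod_cast x1.le)
  have hb : e = b := eq_of_d_le j1.2.1.1 he.1 (by exact_mod_cast x2.ge)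
  have hb' : e = b' := eq_of_d_le j1.2.1.1 he.2.1 (by
    rw [huv.2] at x2
    exact_mod_cast x2.ge)
  subst ha hb
  rw [ha'] at hjv
  rw [← hb'] at hjv
  exact Subtype.ext (hju.unique hjv)

theorem support_finite (p q : Set.Ici o) : (support p q).Finite := by
  refine Set.Finite.of_finite_image (f := rankVec p q) ?_ (rankVec_injOn p q)
  refine ((rankPairs_finite ((p ⊓ q : Set.Ici o) : β) p q).image
    fun v => ((v.1 : ℝ), (v.2 : ℝ))).subset ?_
  rintro _ ⟨u, hu, rfl⟩
  obtain ⟨a, b, hab, hj⟩ := mem_joinSet_iff.1 hu.1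
  exact ⟨_, ⟨a, b, hab, rfl⟩, (rankVec_filter hab hj).symm⟩

/-- Membership in the normal cone makes the pair of `w` optimal at `t`, and irrational parameters
have one optimal pair. -/
theorem eq_of_mem_paramSet {p q w : Set.Ici o} {t : ℝ}
    (hirr : Irrational t) {a b u : β}
    (hmax : IsMaximizer t ((p ⊓ q : Set.Ici o) : β) p q a b) (hu : IsJoin a b u)
    (hw : w ∈ support p q) (hwt : t ∈ paramSet (normalCone p q w)) : (w : β) = u := by
  obtain ⟨a', b', hab', hj⟩ := mem_joinSet_iff.1 hw.1
  have key : IsMaximizer t ((p ⊓ q : Set.Ici o) : β) p q a' b' := by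
    refine ⟨hab', fun x y hxy => (hmax.2 x y hxy).trans ?_⟩
    have ho : o ≤ u := le_trans (p ⊓ q).2 (hmax.1.1.1.trans hu.1)
    have := hwt.2.2.2 (rankVec p q ⟨u, ho⟩)
      (subset_convexHull ℝ _ ⟨_, mem_joinSet_iff.2 ⟨a, b, hmax.1, hu⟩, rfl⟩)
    rwa [rankVec_filter hab' hj, rankVec_filter hmax.1 (u := ⟨u, ho⟩) hu] at this
  obtain ⟨rfl, rfl⟩ := hmax.unique hirr key
  exact hj.unique hu

/-- The integral form of the submodularity inequality implies submodularity on filters. -/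
theorem isSubmodular_filter (o : β) (f : β → ℝ) (H : ∀ p q m : β, IsMeet p q m →
    ∀ U : SimpleFunc ℝ β, IsSelection p q U →
      f m + ∫ t in (0 : ℝ)..1, f (U t) ≤ f p + f q) :
    IsSubmodular (fun y : Set.Ici o => ((f y : ℝ) : WithTop ℝ)) := by
  refine ⟨filterSemilattice o, rfl, isModularSemilattice_filter o, fun p q => ?_⟩
  have hfin := support_finite p q
  refine ⟨hfin, ?_⟩
  have hm := isMeet_inf_coe p q
  obtain ⟨U, hU⟩ := exists_selection hm
  have hI := integral_eq_sum_support hfin (fun t => f (U t)) (fun y => f y) (fun t ht hirr => by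
    obtain ⟨m, a, b, hm', hmax, hj⟩ := hU t ht hirr
    obtain rfl := hm.unique hm'
    have ho : o ≤ U t := le_trans (p ⊓ q).2 (hmax.1.1.1.trans hj.1)
    have hv := rankVec_filter (u := ⟨U t, ho⟩) hmax.1 hj
    have hs := mem_support_of_maximizer ht (p := p) (q := q) (u := ⟨U t, ho⟩)
      (mem_joinSet_iff.2 ⟨a, b, hmax.1, hj⟩) (fun w hw => by
        obtain ⟨x, y, hxy, hjw⟩ := mem_joinSet_iff.1 hw
        have hle := hmax.2 x y hxy
        rw [rankVec_filter hxy hjw, hv]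
        rcases hle.lt_or_eq with h | h
        · exact Or.inl h
        · obtain ⟨h1, h2⟩ := irrational_combo hirr h
          exact Or.inr (by rw [h1, h2]))
    refine ⟨⟨U t, ho⟩, hs.1, rfl, fun w hw => ⟨fun hwt => ?_, fun h => h ▸ hs.2⟩⟩
    exact Subtype.ext (eq_of_mem_paramSet hirr hmax hj hw hwt))
  have key := H p q _ hm U hU
  rw [hI] at key
  rw [finsum_mem_eq_finite_toFinset_sum _ hfin]
  calc _ = ((f ((p ⊓ q : Set.Ici o) : β) +
        ∑ u ∈ hfin.toFinset, coneValue (normalCone p q u) * f u : ℝ) : WithTop ℝ) := by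
          rw [WithTop.coe_add, WithTop.coe_sum]
          congr 1
    _ ≤ ((f p + f q : ℝ) : WithTop ℝ) := WithTop.coe_le_coe.2 key
    _ = _ := WithTop.coe_add _ _

end Filter

/-! ### Complemented intervals -/

section Complemented

variable {α : Type*} [PartialOrder α] [ModularMetricPoset α]

/-- The interval `[p, q]` is complemented, expressed in terms of the metric. -/
def IsComplementIn (p q x y : α) : Prop :=
  p ≤ y ∧ y ≤ q ∧ d p x + d p y = d p q ∧ d x y = d p q

/-- The interval `[p, q]` is a complemented lattice. -/
def Complemented (p q : α) : Prop :=
  p ≤ q ∧ ∀ x, p ≤ x → x ≤ q → ∃ y, IsComplementIn p q x y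

theorem isComplementIn_of_isMeet {p q x y : α} (hy : y ≤ q) (hm : IsMeet x y p)
    (h : d p x + d p y = d p q) : IsComplementIn p q x y :=
  ⟨hm.2.1, hy, h, by rw [hm.d_eq, h]⟩

theorem IsComplementIn.isMeet {p q x y : α} (hx : p ≤ x) (h : IsComplementIn p q x y) : IsMeet x y p :=
  isMeet_of_between hx h.1 (by rw [h.2.2.2, h.2.2.1])

theorem Complemented.dual {p q : α} (h : Complemented p q) :
    Complemented (toDual q) (toDual p) := by
  refine ⟨h.1, fun x hx hx' => ?_⟩
  obtain ⟨y, h1, h2, h3, h4⟩ := h.2 (ofDual x) hx' hx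
  refine ⟨toDual y, h2, h1, ?_, ?_⟩
  · have e1 := d_add p (ofDual x) q hx' hx
    have e2 := d_add _ _ _ h1 h2
    change d q (ofDual x) + d q y = d q p
    change d p q = d p (ofDual x) + d (ofDual x) q at e1
    rw [d_comm q, d_comm q, d_comm q]
    omega
  · change d (ofDual x) y = d q p
    rw [h4, d_comm]

theorem complemented_of_dual {p q : α} (h : Complemented (toDual q) (toDual p)) :
    Complemented p q :=
  Complemented.dual (α := αᵒᵈ) h

/-- If `y` complements `x` in `[p, q]`, then `y ∧ q₁` complements `x` in `[p, q₁]`; the rank count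
is modularity. -/
theorem Complemented.lower {p q q₁ : α} (h : Complemented p q) (h1 : p ≤ q₁) (h2 : q₁ ≤ q) :
    Complemented p q₁ := by
  refine ⟨h1, fun x hx hx' => ?_⟩
  obtain ⟨y, hy⟩ := h.2 x hx (hx'.trans h2)
  have hm := hy.isMeet hx
  obtain ⟨z, hz, -⟩ := exists_meet hy.1 h1
  have hpz := hz.2.2 _ hy.1 h1
  have hmz : IsMeet x z p := ⟨hx, hpz, fun w k1 k2 => hm.2.2 _ k1 (k2.trans hz.1)⟩
  refine ⟨z, isComplementIn_of_isMeet hz.2.1 hmz ?_⟩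
  obtain ⟨j, hj⟩ := exists_join hy.2.1 h2
  have v1 := valuation hpz hz hj
  have e1 := d_mono (hy.1.trans hj.1) (hj.2.2 _ hy.2.1 h2)
  have e2 := hy.2.2.1
  obtain ⟨k, hk⟩ := exists_join hx' hz.2.1
  have v2 := valuation le_rfl hmz hk
  have e3 := d_mono (hx.trans hk.1) (hk.2.2 _ hx' hz.2.1)
  rw [d_self] at v2
  omega

theorem Complemented.upper {p q p₁ : α} (h : Complemented p q) (h1 : p ≤ p₁) (h2 : p₁ ≤ q) :
    Complemented p₁ q :=
  complemented_of_dual (h.dual.lower (q₁ := toDual p₁) h2 h1)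

theorem Complemented.sub {p q p₁ q₁ : α} (h : Complemented p q) (h1 : p ≤ p₁) (h2 : p₁ ≤ q₁)
    (h3 : q₁ ≤ q) : Complemented p₁ q₁ :=
  (h.lower (h1.trans h2) h3).upper h1 h2

theorem Complemented.exists_atom {p q x : α} (h : Complemented p q) (h1 : p ≤ x) (h2 : x ≤ q)
    (hne : x ≠ q) : ∃ a, p ≤ a ∧ a ≤ q ∧ d p a = 1 ∧ ¬ a ≤ x := by
  obtain ⟨y, hy⟩ := h.2 x h1 h2
  have hm := hy.isMeet h1
  have hpy : p ≠ y := fun e => by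
    have := hy.2.2.1
    rw [← e, d_self] at this
    exact hne (eq_of_d_le h1 h2 (by omega))
  obtain ⟨a, a1, a2, a3⟩ := exists_upper_step hy.1 hpy
  refine ⟨a, a2, a3.trans hy.2.1, a1, fun hax => ?_⟩
  have := le_antisymm (hm.2.2 _ hax a3) a2
  rw [this, d_self] at a1
  omega

theorem isMeet_atom {p a x : α} (ha : p ≤ a) (hx : p ≤ x) (h1 : d p a = 1) (hax : ¬ a ≤ x) :
    IsMeet a x p := by
  obtain ⟨m, hm, -⟩ := exists_meet ha hx
  rcases eq_or_eq_of_cover h1 (hm.2.2 _ ha hx) hm.1 with h | h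
  · exact h ▸ hm
  · exact absurd (h ▸ hm.2.1) hax

/-- An interval whose top is a join of atoms is complemented. -/
theorem complemented_of_atoms {p q : α} (hpq : p ≤ q) (h : ∀ x, p ≤ x → x ≤ q → x ≠ q →
    ∃ a, p ≤ a ∧ a ≤ q ∧ d p a = 1 ∧ ¬ a ≤ x) : Complemented p q := by
  refine ⟨hpq, fun x hx hxq => ?_⟩
  -- Take `y` of maximal rank with `x ∧ y = p`. If `x ∨ y ≠ q`, joining `y` with an atom not below
  -- `x ∨ y` keeps the meet and raises the rank.
  let S : Set ℕ := {n | ∃ y, y ≤ q ∧ IsMeet x y p ∧ d p y = n}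
  have hS : S.Finite := (Set.finite_Iic (d p q)).subset (by
    rintro _ ⟨y, h1, h2, rfl⟩
    exact d_mono h2.2.1 h1)
  obtain ⟨_, ⟨y, hyq, hy, rfl⟩, hmax⟩ := Set.exists_max_image S id hS
    ⟨0, p, hpq, ⟨hx, le_rfl, fun z _ h => h⟩, d_self p⟩
  refine ⟨y, isComplementIn_of_isMeet hyq hy ?_⟩
  obtain ⟨j, hj⟩ := exists_join hxq hyq
  have hpj := hx.trans hj.1
  have hjq := hj.2.2 _ hxq hyq
  have v := valuation le_rfl hy hj
  rw [d_self] at v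
  by_cases hne : j = q
  · rw [hne] at v
    omega
  · exfalso
    obtain ⟨a, a1, a2, a3, a4⟩ := h j hpj hjq hne
    obtain ⟨y₁, hy₁⟩ := exists_join a2 hyq
    obtain ⟨j₁, hj₁⟩ := exists_join a2 hjq
    have va := valuation le_rfl (isMeet_atom a1 hy.2.1 a3 fun h => a4 (h.trans hj.2.1)) hy₁
    have vj := valuation le_rfl (isMeet_atom a1 hpj a3 a4) hj₁
    obtain ⟨n, hn, -⟩ := exists_meet hx (hy.2.1.trans hy₁.2.1)
    have hpn : p ≤ n := hn.2.2 _ hx (hy.2.1.trans hy₁.2.1)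
    have hj₂ : IsJoin x y₁ j₁ := ⟨hj.1.trans hj₁.2.1, hy₁.2.2 _ hj₁.1 (hj.2.1.trans hj₁.2.1),
      fun z h1 h2 => hj₁.2.2 _ (hy₁.1.trans h2) (hj.2.2 _ h1 (hy₁.2.1.trans h2))⟩
    have v₂ := valuation hpn hn hj₂
    rw [d_self] at va vj
    have hn0 : p = n := eq_of_d (by omega)
    have := hmax _ ⟨y₁, hy₁.2.2 _ a2 hyq, hn0 ▸ hn, rfl⟩
    simp only [id] at this
    omega

/-- Adding an atom to a complemented interval. -/
theorem Complemented.extend {p q q₁ a : α} (h : Complemented p q) (h1 : q ≤ q₁)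
    (h2 : d q q₁ = 1) (ha : p ≤ a) (haq : a ≤ q₁) (ha1 : d p a = 1) (hna : ¬ a ≤ q) :
    Complemented p q₁ := by
  refine complemented_of_atoms (h.1.trans h1) fun x hx hxq hne => ?_
  -- For `x` not above `q`, an atom of `[p, q]` outside `x ∧ q` works; the new atom is needed only
  -- for `x = q`.
  by_cases hqx : q ≤ x
  · rcases eq_or_eq_of_cover h2 hqx hxq with e | e
    · exact ⟨a, ha, haq, ha1, e ▸ hna⟩
    · exact absurd e hne
  · obtain ⟨m, hm, -⟩ := exists_meet hx h.1
    obtain ⟨b, b1, b2, b3, b4⟩ := h.exists_atom (hm.2.2 _ hx h.1) hm.2.1 fun e => hqx (e ▸ hm.1)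
    exact ⟨b, b1, b2.trans h1, b3, fun hb => b4 (hm.2.2 _ hb b2)⟩

theorem Complemented.extend_lower {p q p₁ a : α} (h : Complemented p q) (h1 : p₁ ≤ p)
    (h2 : d p₁ p = 1) (ha : a ≤ q) (haq : p₁ ≤ a) (ha1 : d a q = 1) (hna : ¬ p ≤ a) :
    Complemented p₁ q :=
  complemented_of_dual (h.dual.extend (q₁ := toDual p₁) (a := toDual a) h1
    (by rw [d_toDual, d_comm, h2]) ha haq (by rw [d_toDual, d_comm, ha1]) hna)

/-- Perspective intervals are simultaneously complemented. -/
theorem Complemented.perspective {p c z e : α} (hm : IsMeet p c z) (hj : IsJoin p c e)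
    (h : Complemented p e) : Complemented z c := by
  refine ⟨hm.2.1, fun x hx hxc => ?_⟩
  -- Lift `x` to `x ∨ p`, complement it by `w` in `[p, e]`, and return to `w ∧ c`.
  obtain ⟨x', hx'⟩ := exists_join hj.1 (hxc.trans hj.2.1)
  have hx'e := hx'.2.2 _ hj.1 (hxc.trans hj.2.1)
  obtain ⟨w, hw⟩ := h.2 x' hx'.1 hx'e
  have hmw := hw.isMeet hx'.1
  obtain ⟨y, hy, -⟩ := exists_meet (hm.1.trans hw.1) hm.2.1
  have hzy := hy.2.2 _ (hm.1.trans hw.1) hm.2.1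
  have hmy : IsMeet x y z := ⟨hx, hzy, fun v h1 h2 =>
    hm.2.2 _ (hmw.2.2 _ (h1.trans hx'.2.1) (h2.trans hy.1)) (h2.trans hy.2.1)⟩
  refine ⟨y, isComplementIn_of_isMeet hy.2.1 hmy ?_⟩
  have hpx : IsMeet p x z := ⟨hm.1, hx, fun v h1 h2 => hm.2.2 _ h1 (h2.trans hxc)⟩
  have v1 := valuation le_rfl hpx hx'
  have v2 := valuation le_rfl hm hj
  have hwe : IsJoin w c e :=
    ⟨hw.2.1, hj.2.1, fun v h1 h2 => hj.2.2 _ (hw.1.trans h1) h2⟩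
  have v3 := valuation hzy hy hwe
  have e1 := d_add _ _ _ hm.1 hx'.1
  have e2 := d_add _ _ _ hm.1 hw.1
  have e3 := d_add _ _ _ hm.1 h.1
  have e4 := hw.2.2.1
  rw [d_self] at v1 v2
  omega

/-- The gates of a complemented interval span a complemented interval. -/
theorem Complemented.gate {a b p q : α} {π : α → α} (hab : Complemented a b)
    (hπ : IsGateMap (Set.Icc p q) π) : Complemented (π a) (π b) := by
  obtain ⟨σ, hσ⟩ := (isConvexSet_Icc a b).exists_gateMap ⟨a, le_rfl, hab.1⟩
  have hse : π a ≤ π b := hπ.monotone hab.1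
  have fa : π (σ (π a)) = π a := gate_gate_gate hπ hσ ⟨le_rfl, hab.1⟩
  have fb : π (σ (π b)) = π b := gate_gate_gate hπ hσ ⟨hab.1, le_rfl⟩
  -- The interval of gates is isometrically isomorphic, via `σ`, to a subinterval of `[a, b]`, so
  -- complements transfer.
  have fix : ∀ x, π a ≤ x → x ≤ π b → π (σ x) = x := fun x h1 h2 =>
    gate_gate_convex (isConvexSet_Icc p q) hπ hσ fa fb (d_add _ _ _ h1 h2)
  have fix' : ∀ y, σ (π a) ≤ y → y ≤ σ (π b) → σ (π y) = y := fun x h1 h2 =>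
    gate_gate_convex (isConvexSet_Icc a b) hσ hπ (congrArg σ fa) (congrArg σ fb)
      (d_add _ _ _ h1 h2)
  have hsub : Complemented (σ (π a)) (σ (π b)) :=
    hab.sub (hσ _).1.1 (hσ.monotone hse) (hσ _).1.2
  refine ⟨hse, fun x hx hx' => ?_⟩
  obtain ⟨y, h1, h2, h3, h4⟩ := hsub.2 (σ x) (hσ.monotone hx) (hσ.monotone hx')
  have hy := fix' y h1 h2
  have hπy : π (σ (π y)) = π y := congrArg π hy
  have k1 := (d_gate_eq hπ hσ fa (fix x hx hx')).2
  have k2 := (d_gate_eq hπ hσ fa hπy).2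
  have k3 := (d_gate_eq hπ hσ fa fb).2
  have k4 := (d_gate_eq hπ hσ (fix x hx hx') hπy).2
  rw [hy] at k2 k4
  have m1 := hπ.monotone h1
  have m2 := hπ.monotone h2
  rw [fa] at m1
  rw [fb] at m2
  exact ⟨π y, m1, m2, by omega, by omega⟩

end Complemented

/-- A bipartite graph metric with the quadrangle condition has medians. -/
theorem exists_median_of_quadrangle {X : Type*} (D : X → X → ℕ) (comm : ∀ x y, D x y = D y x)
    (tri : ∀ x y z, D x z ≤ D x y + D y z) (zero : ∀ x y, D x y = 0 ↔ x = y)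
    (step : ∀ x y, x ≠ y → ∃ z, D x z = 1 ∧ D x y = 1 + D z y)
    (bip : ∀ x y z, D x y = 1 → D z x ≠ D z y)
    (quad : ∀ a x y z, D x y = 1 → D x z = 1 → y ≠ z → D a x = D a y + 1 → D a x = D a z + 1 →
      ∃ m, D m y = 1 ∧ D m z = 1 ∧ D a y = D a m + 1) (x y z : X) :
    ∃ m, D x y = D x m + D m y ∧ D y z = D y m + D m z ∧ D x z = D x m + D m z := by
  -- Some geodesic between `v` and `w` starts, at one of its ends, with a step towards `u`. Moving
  -- that end inward shortens the perimeter, on which the median is found by induction.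
  have closer : ∀ k u v w, D v w = k + 1 →
      (∃ v', D v v' = 1 ∧ D v w = 1 + D v' w ∧ D u v = D u v' + 1) ∨
      (∃ w', D w w' = 1 ∧ D w v = 1 + D w' v ∧ D u w = D u w' + 1) := by
    intro k
    induction k with
    | zero =>
      intro u v w h
      have h0 := (zero v v).2 rfl
      have h0' := (zero w w).2 rfl
      have h1 := bip v w u (by omega)
      have h2 := tri u v w
      have h3 := tri u w v
      have h4 := comm w v
      rcases lt_or_gt_of_ne h1 with h5 | h5
      · exact Or.inr ⟨v, by omega, by omega, by omega⟩
      · exact Or.inl ⟨w, by omega, by omega, by omega⟩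
    | succ k ih =>
      intro u v w h
      obtain ⟨v₁, h1, h2⟩ := step v w fun e => by rw [(zero v w).2 e] at h; omega
      have h3 := bip v v₁ u h1
      have h4 := tri u v v₁
      have h5 := tri u v₁ v
      have h6 := comm v₁ v
      by_cases hlt : D u v₁ < D u v
      · exact Or.inl ⟨v₁, h1, h2, by omega⟩
      rcases ih u v₁ w (by omega) with ⟨v₂, k1, k2, k3⟩ | ⟨w', k1, k2, k3⟩
      · have hne : v ≠ v₂ := fun e => by subst e; omega
        obtain ⟨m, m1, m2, m3⟩ := quad u v₁ v v₂ (by omega) k1 hne (by omega) (by omega)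
        have t1 := tri m v₂ w
        have t2 := tri v m w
        have t3 := comm m v
        exact Or.inl ⟨m, by omega, by omega, by omega⟩
      · have t1 := tri w' v₁ v
        have t2 := tri w w' v
        have c1 := comm w v
        have c2 := comm w v₁
        exact Or.inr ⟨w', k1, by omega, k3⟩
  suffices ∀ n x y z, D x y + D y z + D x z = n →
      ∃ m, D x y = D x m + D m y ∧ D y z = D y m + D m z ∧ D x z = D x m + D m z from
    this _ x y z rfl
  intro n
  induction n using Nat.strong_induction_on with
  | _ n ih =>
    intro x y z hn
    rcases Nat.eq_zero_or_pos (D y z) with h0 | h0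
    · obtain rfl := (zero y z).1 h0
      have := (zero y y).2 rfl
      exact ⟨y, by omega, by omega, by omega⟩
    · obtain ⟨k, hk⟩ := Nat.exists_eq_add_of_le' h0
      rcases closer k x y z hk with ⟨y', k1, k2, k3⟩ | ⟨z', k1, k2, k3⟩
      · obtain ⟨m, m1, m2, m3⟩ := ih _ (by omega) x y' z rfl
        have t1 := tri y y' m
        have t2 := tri y m z
        have t3 := tri x m y
        have c1 := comm m y
        have c2 := comm m y'
        exact ⟨m, by omega, by omega, m3⟩
      · have c0 := comm z y
        have c0' := comm z' y
        obtain ⟨m, m1, m2, m3⟩ := ih _ (by omega) x y z' rfl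
        have t1 := tri z z' m
        have t2 := tri y m z
        have t3 := tri x m z
        have c1 := comm m z
        have c2 := comm m z'
        exact ⟨m, m1, by omega, by omega⟩

/-! ### Steps and the quadrangle condition for complemented intervals -/

section Star

variable {α : Type*} [PartialOrder α] [ModularMetricPoset α]

theorem quadrangle {a x y z : α} (hy : d x y = 1) (hz : d x z = 1) (hyz : y ≠ z)
    (h1 : d a x = d a y + 1) (h2 : d a x = d a z + 1) :
    ∃ m, d m y = 1 ∧ d m z = 1 ∧ d a y = d a m + 1 ∧ d y z = 2 := by
  obtain ⟨m, m1, m2, m3⟩ := exists_median a y z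
  have e := even_d y x z
  have t := d_triangle y x z
  have t0 : d y z ≠ 0 := fun h => hyz (eq_of_d h)
  have c1 := d_comm y x
  have c2 := d_comm y m
  have e2 : d y z = 2 := by
    obtain ⟨k, hk⟩ := e
    omega
  exact ⟨m, by omega, by omega, by omega, e2⟩

theorem IsGateMap.dual {p q : α} {π : α → α} (hπ : IsGateMap (Set.Icc p q) π) :
    IsGateMap (α := αᵒᵈ) (Set.Icc (toDual q) (toDual p)) (fun x => toDual (π (ofDual x))) :=
  fun z => ⟨⟨(hπ z).1.2, (hπ z).1.1⟩, fun w hw => (hπ z).2 w ⟨hw.2, hw.1⟩⟩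

/-- The lower end moves towards the gate of `p'`: this stays inside `[p, q]`, and passing to an
upper part preserves complementation. -/
theorem exists_raise_lower {p q p' : α} {π : α → α} (h : Complemented p q)
    (hπ : IsGateMap (Set.Icc p q) π) (hne : p ≠ π p') :
    ∃ z, Complemented z q ∧ d p z = 1 ∧ d p p' = 1 + d z p' ∧ p ≤ z := by
  obtain ⟨z, h1, h2, -⟩ := exists_step p (π p') hne
  obtain ⟨k1, k2⟩ := mem_Icc_of_between (hπ p').1.1 (show d p (π p') = d p z + d z (π p') by omega)
  have hzq := k2.trans (hπ p').1.2
  have e1 := (hπ p').2 p ⟨le_rfl, h.1⟩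
  have e2 := (hπ p').2 z ⟨k1, hzq⟩
  have c1 := d_comm p' p
  have c2 := d_comm p' z
  have c3 := d_comm (π p') p
  have c4 := d_comm (π p') z
  exact ⟨z, h.upper k1 hzq, h1, by omega, k1⟩

theorem exists_lower_upper {p q q' : α} {π : α → α} (h : Complemented p q)
    (hπ : IsGateMap (Set.Icc p q) π) (hne : q ≠ π q') :
    ∃ w, Complemented p w ∧ d q w = 1 ∧ d q q' = 1 + d w q' ∧ w ≤ q := by
  obtain ⟨w, h1, h2, h3, h4⟩ := exists_raise_lower (p' := toDual q') h.dual hπ.dual hne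
  exact ⟨ofDual w, complemented_of_dual h1, h2, h3, h4⟩

/-- One step of the translation of an interval towards a parallel one. -/
theorem exists_translate {p q : α} {D : Set α} {π σ : α → α} (hpq : p ≤ q)
    (hπ : IsGateMap (Set.Icc p q) π) (hσ : IsGateMap D σ) (hp : π (σ p) = p) (hq : π (σ q) = q)
    (hne : p ≠ σ p) : ∃ p₁ q₁, d p p₁ = 1 ∧ d q q₁ = 1 ∧ d p (σ p) = 1 + d p₁ (σ p) ∧
      d q (σ q) = 1 + d q₁ (σ q) ∧ p₁ ≤ q₁ ∧
      ((p ≤ p₁ ∧ q ≤ q₁ ∧ ¬ p₁ ≤ q) ∨ (p₁ ≤ p ∧ q₁ ≤ q ∧ ¬ p ≤ q₁)) := by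
  obtain ⟨e1, e2⟩ := d_gate_eq hπ hσ hp hq
  obtain ⟨p₁, h1, h2, -⟩ := exists_step p (σ p) hne
  have hc := d_comm (σ p) p
  have hc1 := d_comm (σ p) p₁
  have hc2 := d_comm p₁ p
  have g1 : π p₁ = p := by
    have := hπ.eq_of_between (z := σ p) (w := p₁) (by rw [hp]; omega)
    rw [this, hp]
  have g2 : σ p₁ = σ p := hσ.eq_of_between (by omega)
  have f1 := (hπ p₁).2 q ⟨hpq, le_rfl⟩
  have f2 := (hσ p₁).2 (σ q) (hσ q).1
  rw [g1] at f1
  rw [g2] at f2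
  obtain ⟨q₁, m1, m2, m3⟩ := exists_median q p₁ (σ q)
  have c1 := d_comm q p₁
  have c2 := d_comm q₁ p₁
  have hq1 : d q q₁ = 1 := by omega
  have hq2 : d q₁ (σ q) + 1 = d q (σ q) := by omega
  have hq3 : d p₁ q₁ = d p q := by omega
  have hcq := d_comm (σ q) q
  have hcq1 := d_comm (σ q) q₁
  have hcq2 := d_comm q₁ q
  have g3 : π q₁ = q := by
    have := hπ.eq_of_between (z := σ q) (w := q₁) (by rw [hq]; omega)
    rw [this, hq]
  have hneq1 : q ≠ q₁ := fun e => by rw [← e, d_self] at hq1; omega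
  have hnep1 : p ≠ p₁ := fun e => by rw [← e, d_self] at h1; omega
  refine ⟨p₁, q₁, h1, hq1, by omega, by omega, ?_⟩
  rcases comparable_of_d_eq_one h1 with hp1 | hp1
  · have hpq1 : p ≤ q₁ := filter_convex _ _ _ _ hp1 hpq (by rw [f1] at *; omega)
    have hqq1 : q ≤ q₁ := by
      rcases comparable_of_d_eq_one hq1 with h | h
      · exact h
      · exact absurd (g3.symm.trans (hπ.eq_self ⟨hpq1, h⟩)) hneq1
    have e3 := d_add _ _ _ hpq hqq1
    refine ⟨(mem_Icc_of_between hpq1 (z := p₁) (by omega)).2, Or.inl ⟨hp1, hqq1, fun h => ?_⟩⟩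
    exact hnep1 (g1.symm.trans (hπ.eq_self ⟨hp1, h⟩))
  · have hqq1 : q₁ ≤ q := by
      rcases comparable_of_d_eq_one hq1 with h | h
      · have e3 := d_add _ _ _ hp1 (hpq.trans h)
        have e4 := d_add _ _ _ hpq h
        omega
      · exact h
    have e3 := d_add _ _ _ hp1 hpq
    refine ⟨(mem_Icc_of_between (hp1.trans hpq) (z := q₁) (by omega)).1,
      Or.inr ⟨hp1, hqq1, fun h => ?_⟩⟩
    exact hneq1 (g3.symm.trans (hπ.eq_self ⟨h, hqq1⟩))

/-- Two complemented intervals are joined by a path of the expected length. -/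
theorem star_step {p q p' q' : α} (h : Complemented p q) (h' : Complemented p' q')
    (hne : ¬ (p = p' ∧ q = q')) : ∃ z w, Complemented z w ∧ d p z + d q w = 1 ∧
      d p p' + d q q' = 1 + (d z p' + d w q') ∧ ((p ≤ z ∧ w ≤ q) ∨ (z ≤ p ∧ q ≤ w)) := by
  obtain ⟨π, hπ⟩ := (isConvexSet_Icc p q).exists_gateMap ⟨p, le_rfl, h.1⟩
  obtain ⟨σ, hσ⟩ := (isConvexSet_Icc p' q').exists_gateMap ⟨p', le_rfl, h'.1⟩
  -- Shrink towards the gates while possible. Once both ends are gates, either `[p, q]` lies in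
  -- `[p', q']` and can grow inside it, or it is parallel to its gate image and one end moves by
  -- half of a translation; the other translated end supplies the new atom or coatom.
  by_cases hp : p = π p'
  swap
  · obtain ⟨z, h1, h2, h3, h4⟩ := exists_raise_lower h hπ hp
    exact ⟨z, q, h1, by rw [d_self, h2], by omega, Or.inl ⟨h4, le_rfl⟩⟩
  by_cases hq : q = π q'
  swap
  · obtain ⟨w, h1, h2, h3, h4⟩ := exists_lower_upper h hπ hq
    exact ⟨p, w, h1, by rw [d_self, h2], by omega, Or.inl ⟨le_rfl, h4⟩⟩
  have fp : π (σ p) = p := by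
    rw [hp]
    exact gate_gate_gate hπ hσ ⟨le_rfl, h'.1⟩
  have fq : π (σ q) = q := by
    rw [hq]
    exact gate_gate_gate hπ hσ ⟨h'.1, le_rfl⟩
  by_cases h0 : p = σ p
  · have e1 := (d_gate_eq hπ hσ fp fq).1
    rw [← h0, d_self] at e1
    have h0' : q = σ q := eq_of_d e1.symm
    have hpD : p' ≤ p := by
      rw [h0]
      exact (hσ p).1.1
    have hqD : q ≤ q' := by
      rw [h0']
      exact (hσ q).1.2
    by_cases hpp : p = p'
    · have hqq : q ≠ q' := fun e => hne ⟨hpp, e⟩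
      obtain ⟨w, w1, w2, -⟩ := exists_step q q' hqq
      obtain ⟨w3, w4⟩ := mem_Icc_of_between hqD (z := w) (by omega)
      exact ⟨p, w, h'.sub hpD (h.1.trans w3) w4, by rw [d_self, w1], by omega,
        Or.inr ⟨le_rfl, w3⟩⟩
    · obtain ⟨z, z1, z2, -⟩ := exists_step p p' hpp
      have c1 := d_comm p p'
      have c2 := d_comm z p'
      have c3 := d_comm p z
      obtain ⟨z3, z4⟩ := mem_Icc_of_between hpD (z := z) (by omega)
      exact ⟨z, q, h'.sub z3 (z4.trans h.1) hqD, by rw [d_self, z1], by omega,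
        Or.inr ⟨z4, le_rfl⟩⟩
  · obtain ⟨p₁, q₁, h1, h2, h3, h4, h5, h6⟩ := exists_translate h.1 hπ hσ fp fq h0
    rcases h6 with ⟨k1, k2, k3⟩ | ⟨k1, k2, k3⟩
    · have e1 := (hσ q).2 q' ⟨h'.1, le_rfl⟩
      have t1 := d_triangle q₁ (σ q) q'
      have t2 := d_triangle q q₁ q'
      exact ⟨p, q₁, h.extend k2 h2 k1 h5 h1 k3, by rw [d_self, h2], by omega,
        Or.inr ⟨le_rfl, k2⟩⟩
    · have e1 := (hσ p).2 p' ⟨le_rfl, h'.1⟩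
      have t1 := d_triangle p₁ (σ p) p'
      have t2 := d_triangle p p₁ p'
      exact ⟨p₁, q, h.extend_lower k1 (by rw [d_comm, h1]) k2 h5 (by rw [d_comm, h2]) k3,
        by rw [d_self, h1], by omega, Or.inr ⟨k1, le_rfl⟩⟩

/-- If one of `y, z` is above `p`, a parallel edge puts `m` above the other one. If both are below,
a coatom of `[z, q]` not above `p` is not above `y` either, since `p` lies between `y` and `z`; it
extends `[y, q]` down to `m`. -/
theorem star_quadrangle_lower {a p q y z : α} (hy : Complemented y q) (hz : Complemented z q)
    (hpq : p ≤ q) (h1 : d p y = 1) (h2 : d p z = 1) (hne : y ≠ z) (h3 : d a p = d a y + 1)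
    (h4 : d a p = d a z + 1) :
    ∃ m, Complemented m q ∧ d m y = 1 ∧ d m z = 1 ∧ d a y = d a m + 1 := by
  obtain ⟨m, m1, m2, m3, m4⟩ := quadrangle h1 h2 hne h3 h4
  refine ⟨m, ?_, m1, m2, m3⟩
  have c1 := d_comm y p
  have c2 := d_comm z p
  have c3 := d_comm y m
  have c4 := d_comm z m
  have c5 := d_comm z y
  have t1 := d_triangle a m p
  have t2 := d_triangle m y p
  have hpm : d m p = 2 := by omega
  have c6 := d_comm m p
  have hmq : m ≤ q := ideal_convex q y z m hy.1 hz.1 (by omega)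
  have py : p ≤ y → z ≤ m := square h1 (by omega) h2 (by omega) (by omega) m4
  have pz : p ≤ z → y ≤ m := square h2 (by omega) h1 (by omega) (by omega) (by omega)
  have yp : y ≤ p → m ≤ z := square (by omega) h2 (by omega) m2 m4 (by omega)
  rcases comparable_of_d_eq_one h1 with k1 | k1
  · exact hz.upper (py k1) hmq
  rcases comparable_of_d_eq_one h2 with k2 | k2
  · exact hy.upper (pz k2) hmq
  have zp : m ≤ y := square (x := z) (y := p) (x' := m) (y' := y) (by omega) h1 (by omega) m1
    (by omega) (by omega) k2
  have hzp : z ≠ p := fun e => by rw [e, d_self] at h2; omega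
  obtain ⟨c, c1, c2, c3, c4⟩ := hz.dual.exists_atom (x := toDual p) hpq k2
    (fun e => hzp (toDual_inj.1 e).symm)
  refine hy.extend_lower (a := ofDual c) zp m1 c1 ((yp k1).trans c2) ?_ fun hyc => ?_
  · rw [d_comm]
    exact c3
  · exact c4 (ideal_convex (ofDual c) y z p hyc c2 (by omega))

theorem star_quadrangle_upper {b p q y z : α} (hy : Complemented p y) (hz : Complemented p z)
    (hpq : p ≤ q) (h1 : d q y = 1) (h2 : d q z = 1) (hne : y ≠ z) (h3 : d b q = d b y + 1)
    (h4 : d b q = d b z + 1) :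
    ∃ m, Complemented p m ∧ d m y = 1 ∧ d m z = 1 ∧ d b y = d b m + 1 := by
  obtain ⟨m, hm, h⟩ := star_quadrangle_lower (a := toDual b) hy.dual hz.dual hpq h1 h2
    (fun e => hne (toDual_inj.1 e)) h3 h4
  exact ⟨ofDual m, complemented_of_dual hm, h⟩

/-- The change is made at both ends at once. If only one end moves outward, the result lies in a
given interval. If both move inward, `y ≤ z` because the gates of `a ≤ b` lie between them. If both
move outward, the gates of `[a, b]` supply the missing atom. -/
theorem star_quadrangle_mixed {a b p q y z : α} (hab : Complemented a b) (hpq : p ≤ q)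
    (hy : Complemented y q) (hz : Complemented p z) (h1 : d p y = 1) (h2 : d q z = 1)
    (h3 : d a p = d a y + 1) (h4 : d b q = d b z + 1) : Complemented y z := by
  rcases comparable_of_d_eq_one h1 with k1 | k1 <;> rcases comparable_of_d_eq_one h2 with k2 | k2
  · exact hz.sub k1 (hy.1.trans k2) le_rfl
  · obtain ⟨π, hπ⟩ := (isConvexSet_Icc p q).exists_gateMap ⟨p, le_rfl, hpq⟩
    have e1 := (hπ a).2 p ⟨le_rfl, hpq⟩
    have e2 := (hπ a).2 y ⟨k1, hy.1⟩
    have e3 := (hπ b).2 q ⟨hpq, le_rfl⟩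
    have e4 := (hπ b).2 z ⟨hz.1, k2⟩
    have c1 := d_comm (π a) p
    have c2 := d_comm (π a) y
    have c3 := d_comm z q
    have hya : y ≤ π a := (mem_Icc_of_between (hπ a).1.1 (z := y) (by omega)).2
    have hbz : π b ≤ z := (mem_Icc_of_between (hπ b).1.2 (z := z) (by omega)).1
    exact hy.lower (hya.trans ((hπ.monotone hab.1).trans hbz)) k2
  · have hyz := k1.trans hz.1
    obtain ⟨π, hπ⟩ := (isConvexSet_Icc y z).exists_gateMap ⟨y, le_rfl, hyz⟩
    have hse := hab.gate hπ
    have e1 := (hπ a).2 p ⟨k1, hz.1⟩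
    have e2 := (hπ a).2 y ⟨le_rfl, hyz⟩
    have e3 := (hπ b).2 q ⟨hy.1, k2⟩
    have e4 := (hπ b).2 z ⟨hyz, le_rfl⟩
    have hs : ¬ p ≤ π a := fun h => by
      have := d_add _ _ _ k1 h
      have c1 := d_comm (π a) p
      have c2 := d_comm (π a) y
      omega
    have he : ¬ π b ≤ q := fun h => by
      have := d_add _ _ _ h k2
      omega
    -- Such a `c` makes `[y, c]` perspective to `[p, p ∨ c]`, hence complemented, so it has an atom
    -- outside `q`. The gate of `a` serves as `c` unless it is below `q`; then an atom above it
    -- does.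
    obtain ⟨c, hyc, hcz, hpc, hcq⟩ : ∃ c, y ≤ c ∧ c ≤ z ∧ ¬ p ≤ c ∧ ¬ c ≤ q := by
      by_cases hsq : π a ≤ q
      · obtain ⟨x, hx, -⟩ := exists_meet hse.1 hsq
        obtain ⟨c, c1, c2, c3, c4⟩ := hse.exists_atom (hx.2.2 _ hse.1 hsq) hx.1
          fun e => he (e ▸ hx.2.1)
        have hcq : ¬ c ≤ q := fun h => c4 (hx.2.2 _ c2 h)
        refine ⟨c, (hπ a).1.1.trans c1, c2.trans (hπ b).1.2, fun hpc => ?_, hcq⟩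
        obtain ⟨n, hn, -⟩ := exists_meet c1 hsq
        rcases eq_or_eq_of_cover c3 (hn.2.2 _ c1 hsq) hn.1 with e | e
        · exact hs (e ▸ hn.2.2 _ hpc hpq)
        · exact hcq (e ▸ hn.2.1)
      · exact ⟨π a, (hπ a).1.1, (hπ a).1.2, hs, hsq⟩
    have hm : IsMeet p c y := isMeet_atom k1 hyc (by rw [d_comm, h1]) hpc
    obtain ⟨e, hj⟩ := exists_join hz.1 hcz
    have hyc' := (hz.lower hj.1 (hj.2.2 _ hz.1 hcz)).perspective hm hj
    obtain ⟨x, hx, -⟩ := exists_meet hyc hy.1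
    obtain ⟨t, t1, t2, t3, t4⟩ := hyc'.exists_atom (hx.2.2 _ hyc hy.1) hx.1
      fun e => hcq (e ▸ hx.2.1)
    exact hy.extend k2 h2 t1 (t2.trans hcz) t3 fun h => t4 (hx.2.2 _ t2 h)
  · exact hy.lower (k1.trans hz.1) k2

theorem star_quadrangle {a b p q y₁ y₂ z₁ z₂ : α} (hab : Complemented a b) (hpq : p ≤ q)
    (hy : Complemented y₁ y₂) (hz : Complemented z₁ z₂) (h1 : d p y₁ + d q y₂ = 1)
    (h2 : d p z₁ + d q z₂ = 1) (hne : ¬ (y₁ = z₁ ∧ y₂ = z₂))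
    (h3 : d a p + d b q = d a y₁ + d b y₂ + 1) (h4 : d a p + d b q = d a z₁ + d b z₂ + 1) :
    ∃ m₁ m₂, Complemented m₁ m₂ ∧ d m₁ y₁ + d m₂ y₂ = 1 ∧ d m₁ z₁ + d m₂ z₂ = 1 ∧
      d a y₁ + d b y₂ = d a m₁ + d b m₂ + 1 := by
  have c1 := d_comm p y₁
  have c2 := d_comm q y₂
  have c3 := d_comm p z₁
  have c4 := d_comm q z₂
  rcases Nat.eq_zero_or_pos (d p y₁) with hy0 | hy0 <;>
    rcases Nat.eq_zero_or_pos (d p z₁) with hz0 | hz0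
  · obtain rfl := eq_of_d hy0
    obtain rfl := eq_of_d hz0
    obtain ⟨m, hm, k1, k2, k3⟩ := star_quadrangle_upper (b := b) hy hz hpq (by omega) (by omega)
      (fun e => hne ⟨rfl, e⟩) (by omega) (by omega)
    exact ⟨p, m, hm, by omega, by omega, by omega⟩
  · obtain rfl := eq_of_d hy0
    have e0 : d q z₂ = 0 := by omega
    obtain rfl := eq_of_d e0
    exact ⟨z₁, y₂, star_quadrangle_mixed hab hpq hz hy (by omega) (by omega) (by omega) (by omega),
      by rw [d_self]; omega, by rw [d_self]; omega, by omega⟩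
  · obtain rfl := eq_of_d hz0
    have e0 : d q y₂ = 0 := by omega
    obtain rfl := eq_of_d e0
    exact ⟨y₁, z₂, star_quadrangle_mixed hab hpq hy hz (by omega) (by omega) (by omega) (by omega),
      by rw [d_self]; omega, by rw [d_self]; omega, by omega⟩
  · have e0 : d q y₂ = 0 := by omega
    have e0' : d q z₂ = 0 := by omega
    obtain rfl := eq_of_d e0
    obtain rfl := eq_of_d e0'
    obtain ⟨m, hm, k1, k2, k3⟩ := star_quadrangle_lower (a := a) hy hz hpq (by omega) (by omega)
      (fun e => hne ⟨e, rfl⟩) (by omega) (by omega)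
    exact ⟨m, q, hm, by omega, by omega, by omega⟩

end Star

/-! ### The modular metric poset of complemented intervals -/

theorem interval_ext {α : Type*} [PartialOrder α] {s t : ComplementedInterval α}
    (h1 : s.1.fst = t.1.fst) (h2 : s.1.snd = t.1.snd) : s = t :=
  Subtype.ext (NonemptyInterval.ext (Prod.ext h1 h2))

theorem interval_le_iff {α : Type*} [PartialOrder α] {s t : ComplementedInterval α} :
    s ≤ t ↔ t.1.fst ≤ s.1.fst ∧ s.1.snd ≤ t.1.snd := Iff.rfl

/-- Complements are restated by inequalities alone, so that the lattice structure hidden in the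
hypothesis need not be compared with another one. -/
theorem exists_complement_of_order {P : Type*} [inst : Preorder P]
    (h : IsComplementedModularLatticeOrder P) {bot top : P} (hbot : ∀ z, bot ≤ z)
    (htop : ∀ z, z ≤ top) (x : P) :
    ∃ y : P, (∀ z, z ≤ x → z ≤ y → z ≤ bot) ∧ ∀ z, x ≤ z → y ≤ z → top ≤ z := by
  obtain ⟨i, b, rfl, -, hc⟩ := h
  obtain ⟨y, hy⟩ := hc.exists_isCompl x
  exact ⟨y, fun z h1 h2 => (hy.disjoint h1 h2).trans bot_le,
    fun z h1 h2 => le_trans le_top (hy.codisjoint h1 h2)⟩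

section

variable {α : Type*} [PartialOrder α] [ModularMetricPoset α]

theorem IsComplementIn.isJoin {p q x y : α} (hx : p ≤ x) (hxq : x ≤ q)
    (h : IsComplementIn p q x y) : IsJoin x y q := by
  obtain ⟨j, hj⟩ := exists_join hxq h.2.1
  have hjq := hj.2.2 _ hxq h.2.1
  have v := valuation le_rfl (h.isMeet hx) hj
  have e := h.2.2.1
  rw [d_self] at v
  rwa [← eq_of_d_le (hx.trans hj.1) hjq (by omega)]

theorem complemented_iff {p q : α} (hpq : p ≤ q) :
    IsComplementedModularLatticeOrder (Set.Icc p q) ↔ Complemented p q := by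
  constructor
  · intro h
    refine ⟨hpq, fun x hx hxq => ?_⟩
    obtain ⟨y, h1, h2⟩ := exists_complement_of_order h (bot := ⟨p, le_rfl, hpq⟩)
      (top := ⟨q, hpq, le_rfl⟩) (fun z => z.2.1) (fun z => z.2.2) ⟨x, hx, hxq⟩
    have hm : IsMeet x (y : α) p := isMeet_coe (a := p) (b := q) (x := ⟨x, hx, hxq⟩) (y := y)
      (m := ⟨p, le_rfl, hpq⟩) ⟨hx, y.2.1, h1⟩
    have hj : IsJoin x (y : α) q := isJoin_coe (a := p) (b := q) (x := ⟨x, hx, hxq⟩) (y := y)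
      (m := ⟨q, hpq, le_rfl⟩) ⟨hxq, y.2.2, h2⟩
    have v := valuation le_rfl hm hj
    rw [d_self, zero_add] at v
    exact ⟨y, isComplementIn_of_isMeet y.2.2 hm v⟩
  · intro h
    let i : Lattice (Set.Icc p q) := latticeOfInterval (OrderIso.refl (Set.Icc p q))
    let b : @BoundedOrder (Set.Icc p q) i.toSemilatticeInf.toPartialOrder.toLE :=
      { top := ⟨q, hpq, le_rfl⟩
        le_top := fun z => z.2.2
        bot := ⟨p, le_rfl, hpq⟩
        bot_le := fun z => z.2.1 }
    refine ⟨i, b, rfl, isModularLattice_interval _, ⟨fun x => ?_⟩⟩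
    obtain ⟨y, hy⟩ := h.2 x x.2.1 x.2.2
    refine ⟨⟨y, hy.1, hy.2.1⟩, fun z h1 h2 => ?_, fun z h1 h2 => ?_⟩
    · exact (hy.isMeet x.2.1).2.2 z h1 h2
    · exact (hy.isJoin x.2.1 x.2.2).2.2 z h1 h2

theorem complemented_of_mem (s : ComplementedInterval α) : Complemented s.1.fst s.1.snd :=
  (complemented_iff s.1.fst_le_snd).1 s.2

/-- The element of `α*` defined by a complemented interval. -/
def mkInterval {p q : α} (h : Complemented p q) : ComplementedInterval α :=
  ⟨⟨(p, q), h.1⟩, (complemented_iff h.1).2 h⟩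

/-- The distance on `α*`. -/
def starDist (s t : ComplementedInterval α) : ℕ := d s.1.fst t.1.fst + d s.1.snd t.1.snd

instance instStar : ModularMetricPoset (ComplementedInterval α) where
  d := starDist
  d_comm s t := by rw [starDist, starDist, d_comm s.1.fst, d_comm s.1.snd]
  d_triangle s t u := by
    have h1 := d_triangle s.1.fst t.1.fst u.1.fst
    have h2 := d_triangle s.1.snd t.1.snd u.1.snd
    simp only [starDist]
    omega
  d_eq_zero s t := by
    rw [starDist, Nat.add_eq_zero_iff, d_eq_zero, d_eq_zero]
    exact ⟨fun h => interval_ext h.1 h.2, fun h => h ▸ ⟨rfl, rfl⟩⟩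
  exists_step s t h := by
    obtain ⟨z, w, h1, h2, h3, h4⟩ := star_step (complemented_of_mem s) (complemented_of_mem t)
      fun e => h (interval_ext e.1 e.2)
    exact ⟨mkInterval h1, h2, h3, h4.symm⟩
  exists_median := by
    -- Coordinatewise medians of endpoints need not span a complemented interval, so the median
    -- comes from the local criterion.
    refine exists_median_of_quadrangle starDist ?_ ?_ ?_ ?_ ?_ ?_
    · intro s t
      rw [starDist, starDist, d_comm s.1.fst, d_comm s.1.snd]
    · intro s t u
      have h1 := d_triangle s.1.fst t.1.fst u.1.fst
      have h2 := d_triangle s.1.snd t.1.snd u.1.snd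
      simp only [starDist]
      omega
    · intro s t
      rw [starDist, Nat.add_eq_zero_iff, d_eq_zero, d_eq_zero]
      exact ⟨fun h => interval_ext h.1 h.2, fun h => h ▸ ⟨rfl, rfl⟩⟩
    · intro s t h
      obtain ⟨z, w, h1, h2, h3, -⟩ := star_step (complemented_of_mem s) (complemented_of_mem t)
        fun e => h (interval_ext e.1 e.2)
      exact ⟨mkInterval h1, h2, h3⟩
    · intro s t u h1 h2
      simp only [starDist] at h1 h2
      obtain ⟨k, hk⟩ := even_d u.1.fst s.1.fst t.1.fst
      obtain ⟨l, hl⟩ := even_d u.1.snd s.1.snd t.1.snd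
      omega
    · intro a s t u h1 h2 h3 h4 h5
      obtain ⟨m₁, m₂, hm, k1, k2, k3⟩ := star_quadrangle (complemented_of_mem a) s.1.fst_le_snd
        (complemented_of_mem t) (complemented_of_mem u) h1 h2 (fun e => h3 (interval_ext e.1 e.2))
        h4 h5
      exact ⟨mkInterval hm, k1, k2, k3⟩
  d_add s t u h1 h2 := by
    have e1 := d_add _ _ _ h2.1 h1.1
    have e2 := d_add _ _ _ h1.2 h2.2
    have c1 := d_comm s.1.fst t.1.fst
    have c2 := d_comm s.1.fst u.1.fst
    have c3 := d_comm t.1.fst u.1.fst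
    change d u.1.fst s.1.fst = d u.1.fst t.1.fst + d t.1.fst s.1.fst at e1
    change d s.1.snd u.1.snd = d s.1.snd t.1.snd + d t.1.snd u.1.snd at e2
    simp only [starDist]
    omega
  filter_convex o s t u h1 h2 h := by
    have t1 := d_triangle s.1.fst u.1.fst t.1.fst
    have t2 := d_triangle s.1.snd u.1.snd t.1.snd
    simp only [starDist] at h
    exact interval_le_iff.2 ⟨ideal_convex _ _ _ _ h1.1 h2.1 (by omega),
      filter_convex _ _ _ _ h1.2 h2.2 (by omega)⟩
  ideal_convex o s t u h1 h2 h := by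
    have t1 := d_triangle s.1.fst u.1.fst t.1.fst
    have t2 := d_triangle s.1.snd u.1.snd t.1.snd
    simp only [starDist] at h
    exact interval_le_iff.2 ⟨filter_convex _ _ _ _ h1.1 h2.1 (by omega),
      ideal_convex _ _ _ _ h1.2 h2.2 (by omega)⟩

theorem d_star (s t : ComplementedInterval α) :
    d s t = d s.1.fst t.1.fst + d s.1.snd t.1.snd := rfl

theorem complemented_prod_iff {p q : α × α} :
    Complemented p q ↔ Complemented p.1 q.1 ∧ Complemented p.2 q.2 := by
  constructor
  · intro h
    -- No two points of an interval are farther apart than its ends, so a complement in the product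
    -- attains the full distance in each coordinate.
    have bound : ∀ {a b x y : α}, a ≤ x → x ≤ b → a ≤ y → y ≤ b → d x y ≤ d a b := by
      intro a b x y h1 h2 h3 h4
      have e1 := d_add _ _ _ h1 h2
      have e2 := d_add _ _ _ h3 h4
      have t1 := d_triangle x a y
      have t2 := d_triangle x b y
      rw [d_comm x a] at t1
      rw [d_comm b y] at t2
      omega
    refine ⟨⟨h.1.1, fun x hx hxq => ?_⟩, ⟨h.1.2, fun x hx hxq => ?_⟩⟩
    · obtain ⟨y, k1, k2, k3, k4⟩ := h.2 (x, p.2) ⟨hx, le_rfl⟩ ⟨hxq, h.1.2⟩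
      simp only [d_prod, d_self] at k3 k4
      have b1 := bound hx hxq k1.1 k2.1
      have b2 := bound le_rfl h.1.2 k1.2 k2.2
      have b3 := d_triangle x p.1 y.1
      rw [d_comm x p.1] at b3
      exact ⟨y.1, k1.1, k2.1, by omega, by omega⟩
    · obtain ⟨y, k1, k2, k3, k4⟩ := h.2 (p.1, x) ⟨le_rfl, hx⟩ ⟨h.1.1, hxq⟩
      simp only [d_prod, d_self] at k3 k4
      have b1 := bound hx hxq k1.2 k2.2
      have b2 := bound le_rfl h.1.1 k1.1 k2.1
      have b3 := d_triangle x p.2 y.2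
      rw [d_comm x p.2] at b3
      exact ⟨y.2, k1.2, k2.2, by omega, by omega⟩
  · rintro ⟨h, h'⟩
    refine ⟨⟨h.1, h'.1⟩, fun x hx hxq => ?_⟩
    obtain ⟨y, k1, k2, k3, k4⟩ := h.2 x.1 hx.1 hxq.1
    obtain ⟨z, l1, l2, l3, l4⟩ := h'.2 x.2 hx.2 hxq.2
    refine ⟨(y, z), ⟨k1, l1⟩, ⟨k2, l2⟩, ?_, ?_⟩ <;> simp only [d_prod] <;> omega

/-- `(α × α)*` is the product of `α*` with itself. -/
def starProdIso : ComplementedInterval (α × α) ≃o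
    ComplementedInterval α × ComplementedInterval α where
  toFun s := (mkInterval (complemented_prod_iff.1 (complemented_of_mem s)).1,
    mkInterval (complemented_prod_iff.1 (complemented_of_mem s)).2)
  invFun t := mkInterval (p := (t.1.1.fst, t.2.1.fst)) (q := (t.1.1.snd, t.2.1.snd))
    (complemented_prod_iff.2 ⟨complemented_of_mem t.1, complemented_of_mem t.2⟩)
  left_inv _ := rfl
  right_inv _ := rfl
  map_rel_iff' {s t} := by
    constructor
    · rintro ⟨h1, h2⟩
      exact ⟨⟨h1.1, h2.1⟩, ⟨h1.2, h2.2⟩⟩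
    · rintro ⟨h1, h2⟩
      exact ⟨⟨h1.1, h2.1⟩, ⟨h1.2, h2.2⟩⟩

/-! ### L-convexity of multiples of the distance -/

theorem isSubmodular_d {β : Type*} [PartialOrder β] (e : β ≃o α × α) {c : ℝ} (hc : 0 ≤ c)
    (o : β) : IsSubmodular (fun y : Set.Ici o =>
      ((c * (d (e y).1 (e y).2 : ℝ) : ℝ) : WithTop ℝ)) := by
  let _ : ModularMetricPoset β := ofOrderIso e
  refine isSubmodular_filter o (fun y => c * (d (e y).1 (e y).2 : ℝ)) fun p q m hm U hU => ?_
  have key := d_submodular (isMeet_map e hm) (U.map e) fun t ht hirr =>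
    (hU t ht hirr).map_orderIso e fun _ _ => rfl
  have h := mul_le_mul_of_nonneg_left key hc
  rw [intervalIntegral.integral_const_mul]
  simp only [SimpleFunc.coe_map, Function.comp_apply] at h
  linarith

theorem chainConnected_univ {β : Type*} [PartialOrder β] [ModularMetricPoset β] {X : Set β}
    (hX : ∀ x, x ∈ X) : ChainConnected X := by
  intro p _ q _
  suffices ∀ n, ∀ p, d p q = n →
      Relation.ReflTransGen (fun a b => a ∈ X ∧ b ∈ X ∧ (a ≤ b ∨ b ≤ a)) p q from this _ p rfl
  intro n
  induction n with
  | zero =>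
    intro p h
    rw [eq_of_d h]
  | succ n ih =>
    intro p h
    obtain ⟨z, h1, h2, h3⟩ := exists_step p q fun e => by rw [e, d_self] at h; omega
    exact (ih z (by omega)).head ⟨hX p, hX z, h3⟩

/-- Multiples of the distance function are L-convex. -/
theorem isLConvex_d {β : Type*} [PartialOrder β] (e : β ≃o α × α) {c : ℝ} (hc : 0 ≤ c)
    {g : β → WithTop ℝ} (hg : ∀ y, g y = ((c * (d (e y).1 (e y).2 : ℝ) : ℝ) : WithTop ℝ)) :
    IsLConvex g := by
  obtain rfl : g = fun y => ((c * (d (e y).1 (e y).2 : ℝ) : ℝ) : WithTop ℝ) := funext hg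
  refine ⟨fun x => isSubmodular_d e hc x, fun x => ?_, ?_⟩
  -- A reversed ideal is a filter of the dual poset, which carries the same metric.
  · let e' : βᵒᵈ ≃o αᵒᵈ × αᵒᵈ :=
      { toFun := fun y => (toDual (e (ofDual y)).1, toDual (e (ofDual y)).2)
        invFun := fun z => toDual (e.symm (ofDual z.1, ofDual z.2))
        left_inv := fun y => e.symm_apply_apply (ofDual y)
        right_inv := fun z => by simp
        map_rel_iff' := fun {a b} => e.le_iff_le (x := ofDual b) (y := ofDual a) }
    exact isSubmodular_d e' hc (toDual x)
  · let _ : ModularMetricPoset β := ofOrderIso e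
    exact chainConnected_univ fun x => WithTop.coe_lt_top _

end

end ModularMetricPoset

open ModularMetricPoset in
theorem mainTheorem8 {V : Type*} (Γ : OrientedModularGraph V) :
    IsLConvex Γ.distFun ∧ IsLConvex (starExtension Γ.distFun) := by
  constructor
  · refine isLConvex_d (α := Γ.Vertex) (OrderIso.refl _) zero_le_one fun y => ?_
    rw [one_mul]
    rfl
  · refine isLConvex_d (α := ComplementedInterval Γ.Vertex) starProdIso
      (c := 1 / 2) (by norm_num) fun y => ?_
    rw [d_star, Nat.cast_add]
    rfl
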